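/- **Theorem (modified scattering).** Write $\langle a\rangle=(1+|a|^2)^{1/2}$. Let $\frac12<\alpha<1$, $\lambda\in\mathbb R\setminus\{0\}$ and $w(x)=\lambda|x|^{-\alpha}$ on $\mathbb R^3$. For $h=h(x,v)$ put $\rho_h(x)=\int_{\mathbb R^3}h(x,v)\,dv$ and $\mathbf E_h(x)=-\int_{\mathbb R^3}\nabla w(x-y)\rho_h(y)\,dy$. For every $K>0$ there are constants $\eta_0>0$ and $C>0$, depending only on $\alpha,\lambda,K$, such that the following holds for every $0<\eta_*\le\eta_0$. Let $f_0=f_0(x,v)\ge 0$ on $\mathbb R^3\times\mathbb R^3$ satisfy $$\|\langle x\rangle f_0\|_{W^{1,1}_{x,v}\cap W^{1,\infty}_{x,v}}+\|\langle x\rangle f_0\|_{W^{1,1}_x(W^{1,\infty}_v)\cap W^{1,1}_v(W^{1,\infty}_x)}\le\eta_*,$$ where the norm of an intersection is the sum of the two norms, $\|u\|_{W^{1,p}_{x,v}}$ is the sum of the $L^p(\mathbb R^6)$ norms of $u$ and its first-order weak partial derivatives, $\|u\|_{W^{1,1}_x(W^{1,\infty}_v)}=\sum_{|m|\le1,\,|m'|\le1}\|\partial_x^m\partial_v^{m'}u\|_{L^1_xL^\infty_v}$,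 and $W_v^{1,1}(W_x^{1,\infty})$ is defined with the roles of $x$ and $v$ interchanged. Let $f\ge0$ be a global weak solution of the Vlasov–Riesz system $$\partial_tf+v\cdot\nabla_xf+\mathbf E_f\cdot\nabla_vf=0,\qquad f(0)=f_0,\qquad \mathbf E_f(t,\cdot)=\mathbf E_{f(t)},$$ with $f\in C([0,\infty);L^1\cap L^\infty(\mathbb R^6))$ and $f(t)\in W^{1,1}_{x,v}\cap W^{1,\infty}_{x,v}$ for every $t\ge0$, and such that for all $t\ge0$ $$\langle t\rangle^{1+\alpha}\|\mathbf E_f(t)\|_{L^\infty_x}+\langle t\rangle^{2+\alpha}\|\nabla\mathbf E_f(t)\|_{L^\infty_x}+\langle t\rangle^{3}\|\nabla^2\mathbf E_f(t)\|_{L^\infty_x}\le K\eta_* ,$$ where $\|\nabla^k\mathbf E_f(t)\|_{L^\infty_x}$ is the sum of the $L^\infty$ norms of the weak partial derivatives $\partial_{i_1}\cdots\partial_{i_k}\mathbf E_f(t)$, $1\le i_1,\dots,i_k\le3$. Then: 1. The characteristic system $\dot{\mathcal X}=\mathcal V$, $\dot{\mathcal V}=\mathbf E_f(t,\mathcal X)$,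 $(\mathcal X,\mathcal V)(0,x,v)=(x,v)$ has a unique solution on $[0,\infty)$ for each $(x,v)$; the limit $\mathcal V^+(x,v)=\lim_{t\to\infty}\mathcal V(t,x,v)$ exists for each $(x,v)$; and for each $v\in\mathbb R^3$ the integral $$\mathbf A_\infty(v)=-\iint_{\mathbb R^6}\nabla w\big(v-\mathcal V^+(\tilde x,\tilde v)\big)f_0(\tilde x,\tilde v)\,d\tilde x\,d\tilde v$$ converges absolutely. 2. There is $f^+\in L^1(\mathbb R^6)\cap L^\infty(\mathbb R^6)$ such that, with $$\Phi^{\mathrm{ref}}(t)(x,v)=\Big(x+tv-\tfrac{t^{1-\alpha}-1}{1-\alpha}\mathbf A_\infty(v),\,v\Big),$$ for all $t\ge1$, $$\big\|f\big(t,\Phi^{\mathrm{ref}}(t)(x,v)\big)-f^+(x,v)\big\|_{L^\infty_{x,v}(\mathbb R^6)}\le\frac{C\,\eta_*^2}{t^{2\alpha-1}} .$$ -/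

import Mathlib

open MeasureTheory Set Filter Topology
open scoped ENNReal ContDiff

noncomputable section

namespace VlasovRiesz

/-- Physical space `ℝ³` with its Euclidean norm. -/
abbrev Space := EuclideanSpace ℝ (Fin 3)

/-- Phase space `ℝ³ × ℝ³`, with points `(x, v)` and Lebesgue measure `volume`. -/
abbrev Phase := Space × Space

/-- The bracket `⟨a⟩ = (1 + |a|²)^{1/2}`. -/
def bracket {G : Type*} [NormedAddCommGroup G] (a : G) : ℝ := Real.sqrt (1 + ‖a‖ ^ 2)

/-! ### Weak derivatives and Sobolev norms -/

section Weak

variable {G : Type*} [NormedAddCommGroup G] [NormedSpace ℝ G]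
variable {F : Type*} [NormedAddCommGroup F] [NormedSpace ℝ F]

/-- The classical iterated directional derivative of a scalar function along a list of
directions. -/
def dirDeriv : List G → (G → ℝ) → G → ℝ
  | [], φ => φ
  | e :: l, φ => fun z => fderiv ℝ (dirDeriv l φ) z e

/-- `g` is the weak derivative of `u` along the list `l` of directions: both are locally
integrable, and `∫ (∂^l φ) u = (-1)^|l| ∫ φ g` for all `φ ∈ C_c^∞`. For `l = []` this says that
`u` is locally integrable and `g = u` almost everywhere. -/
def IsWeakDeriv [MeasureSpace G] (l : List G) (u g : G → F) : Prop :=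
  LocallyIntegrable u ∧ LocallyIntegrable g ∧
    ∀ φ : G → ℝ, ContDiff ℝ ∞ φ → HasCompactSupport φ →
      ∫ z, dirDeriv l φ z • u z = (-1 : ℝ) ^ l.length • ∫ z, φ z • g z

/-- The norm `N` of the weak derivative `∂^l u`. Weak derivatives are unique up to null sets, so
for a norm `N` that ignores null sets this is `N (∂^l u)` if the weak derivative exists, and `⊤`
if it does not. -/
def weakNorm [MeasureSpace G] (N : (G → F) → ℝ≥0∞) (l : List G) (u : G → F) : ℝ≥0∞ :=
  ⨅ (g : G → F) (_ : IsWeakDeriv l u g), N g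

end Weak

/-- The `i`-th standard basis vector of `ℝ³`. -/
def basisVec (i : Fin 3) : Space := EuclideanSpace.single i 1

/-- The multi-indices `m` with `|m| ≤ 1` in the position variable (`none` is `m = 0`), as lists of
directions in phase space. -/
def xIndex : Option (Fin 3) → List Phase
  | none => []
  | some i => [(basisVec i, 0)]

/-- The multi-indices `m` with `|m| ≤ 1` in the velocity variable. -/
def vIndex : Option (Fin 3) → List Phase
  | none => []
  | some i => [(0, basisVec i)]

/-- The norm of `L_x^p(ℝ³; L_v^q(ℝ³))`. -/
def normXV (p q : ℝ≥0∞) (u : Phase → ℝ) : ℝ≥0∞ :=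
  eLpNorm (fun x : Space => eLpNorm (fun v : Space => u (x, v)) q volume) p volume

/-- The norm of `L_v^p(ℝ³; L_x^q(ℝ³))`. -/
def normVX (p q : ℝ≥0∞) (u : Phase → ℝ) : ℝ≥0∞ :=
  eLpNorm (fun v : Space => eLpNorm (fun x : Space => u (x, v)) q volume) p volume

/-- The norm of `W^{1,p}_{x,v}(ℝ⁶)`: the sum of the `L^p` norms of `u` and of its six first-order
weak partial derivatives. -/
def sobolevNorm (p : ℝ≥0∞) (u : Phase → ℝ) : ℝ≥0∞ :=
  weakNorm (fun g => eLpNorm g p volume) [] u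
    + (∑ i : Fin 3, weakNorm (fun g => eLpNorm g p volume) [(basisVec i, 0)] u)
    + ∑ i : Fin 3, weakNorm (fun g => eLpNorm g p volume) [(0, basisVec i)] u

/-- The norm of `W_x^{1,p}(ℝ³; W_v^{1,q}(ℝ³))`:
the sum over `|m| ≤ 1`, `|m'| ≤ 1` of the norms of `∂_x^m ∂_v^{m'} u` in `L_x^p L_v^q`. -/
def mixedNormXV (p q : ℝ≥0∞) (u : Phase → ℝ) : ℝ≥0∞ :=
  ∑ m : Option (Fin 3), ∑ m' : Option (Fin 3), weakNorm (normXV p q) (xIndex m ++ vIndex m') u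

/-- The norm of `W_v^{1,p}(ℝ³; W_x^{1,q}(ℝ³))`. -/
def mixedNormVX (p q : ℝ≥0∞) (u : Phase → ℝ) : ℝ≥0∞ :=
  ∑ m : Option (Fin 3), ∑ m' : Option (Fin 3), weakNorm (normVX p q) (xIndex m ++ vIndex m') u

/-- The norm of `u` in `W^{1,1} ∩ W^{1,∞}` plus its norm in
`W_x^{1,1}(W_v^{1,∞}) ∩ W_v^{1,1}(W_x^{1,∞})`, where the norm of an intersection of two spaces is
the sum of the two norms. -/
def dataNorm (u : Phase → ℝ) : ℝ≥0∞ :=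
  (sobolevNorm 1 u + sobolevNorm ⊤ u) + (mixedNormXV 1 ⊤ u + mixedNormVX 1 ⊤ u)

/-! ### The Vlasov–Riesz system -/

/-- The interaction potential `w(x) = λ |x|^{-α}`. -/
def potential (α lam : ℝ) (x : Space) : ℝ := lam * ‖x‖ ^ (-α)

/-- The spatial density `ρ_h(x) = ∫ h(x, v) dv`. -/
def density (h : Phase → ℝ) (x : Space) : ℝ := ∫ v : Space, h (x, v)

/-- The force field `E_h(x) = -∫ ∇w(x - y) ρ_h(y) dy`. -/
def force (α lam : ℝ) (h : Phase → ℝ) (x : Space) : Space :=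
  -∫ y : Space, density h y • gradient (potential α lam) (x - y)

/-- `f` is a global (weak) solution of `∂_t f + v · ∇_x f + E_f · ∇_v f = 0`, `f(0) = f₀`, which is
nonnegative, continuous in time with values in `L¹ ∩ L^∞`, and belongs to `W^{1,1} ∩ W^{1,∞}` at
every time. Only the values `f t` with `t ≥ 0` matter. -/
structure IsGlobalSolution (α lam : ℝ) (f₀ : Phase → ℝ) (f : ℝ → Phase → ℝ) : Prop where
  nonneg : ∀ t, 0 ≤ t → 0 ≤ᵐ[volume] f t
  sobolev_one : ∀ t, 0 ≤ t → sobolevNorm 1 (f t) < ⊤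
  sobolev_top : ∀ t, 0 ≤ t → sobolevNorm ⊤ (f t) < ⊤
  continuous_one : ∀ t, 0 ≤ t →
    Tendsto (fun s => eLpNorm (f s - f t) 1 volume) (𝓝[Ici 0] t) (𝓝 0)
  continuous_top : ∀ t, 0 ≤ t →
    Tendsto (fun s => eLpNorm (f s - f t) ⊤ volume) (𝓝[Ici 0] t) (𝓝 0)
  initial : f 0 =ᵐ[volume] f₀
  /-- The equation tested against `φ ∈ C_c^∞(ℝ⁶)` and integrated in time; the derivative of `φ` at
  `z = (x, v)` along `(v, E_f(s, x))` is `v · ∇_x φ + E_f · ∇_v φ`. -/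
  equation : ∀ φ : Phase → ℝ, ContDiff ℝ ∞ φ → HasCompactSupport φ → ∀ t, 0 ≤ t →
    ∫ z, f t z * φ z = (∫ z, f 0 z * φ z) +
      ∫ s in (0 : ℝ)..t, ∫ z, f s z * fderiv ℝ φ z (z.2, force α lam (f s) z.1)

/-- The dispersion bound: for all `t ≥ 0`,
`⟨t⟩^{1+α} ‖E_f(t)‖_∞ + ⟨t⟩^{2+α} ‖∇E_f(t)‖_∞ + ⟨t⟩³ ‖∇²E_f(t)‖_∞ ≤ B`. -/
def DispersionBound (α lam : ℝ) (f : ℝ → Phase → ℝ) (B : ℝ) : Prop :=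
  ∀ t, 0 ≤ t →
    ENNReal.ofReal (bracket t ^ (1 + α)) * eLpNorm (force α lam (f t)) ⊤ volume
      + ENNReal.ofReal (bracket t ^ (2 + α)) *
          (∑ i : Fin 3,
            weakNorm (fun g => eLpNorm g ⊤ volume) [basisVec i] (force α lam (f t)))
      + ENNReal.ofReal (bracket t ^ (3 : ℝ)) *
          (∑ i : Fin 3, ∑ j : Fin 3,
            weakNorm (fun g => eLpNorm g ⊤ volume) [basisVec i, basisVec j]
              (force α lam (f t)))
      ≤ ENNReal.ofReal B

/-- `(X, V)` is the forward characteristic flow of the force field `E` on `[0, ∞)`: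
`∂_t X = V`, `∂_t V = E(t, X)`, `(X, V)(0, z) = z`. -/
structure IsCharFlow (E : ℝ → Space → Space) (X V : ℝ → Phase → Space) : Prop where
  init_x : ∀ z, X 0 z = z.1
  init_v : ∀ z, V 0 z = z.2
  deriv_x : ∀ z t, 0 ≤ t → HasDerivWithinAt (fun s => X s z) (V t z) (Ici 0) t
  deriv_v : ∀ z t, 0 ≤ t → HasDerivWithinAt (fun s => V s z) (E t (X t z)) (Ici 0) t

/-- The integrand `∇w(v - V⁺(z)) f₀(z)` in the velocity correction. -/
def correctionIntegrand (α lam : ℝ) (f₀ : Phase → ℝ) (Vp : Phase → Space) (v : Space)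
    (z : Phase) : Space :=
  f₀ z • gradient (potential α lam) (v - Vp z)

/-- The velocity correction `A_∞(v) = -∬ ∇w(v - V⁺(x̃, ṽ)) f₀(x̃, ṽ) dx̃ dṽ`. -/
def correction (α lam : ℝ) (f₀ : Phase → ℝ) (Vp : Phase → Space) (v : Space) : Space :=
  -∫ z : Phase, correctionIntegrand α lam f₀ Vp v z

/-- The modified reference flow
`Φ^ref(t)(x, v) = (x + t v - (t^{1-α} - 1)/(1-α) A(v), v)`. -/
def refFlow (α : ℝ) (A : Space → Space) (t : ℝ) (z : Phase) : Phase :=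
  (z.1 + t • z.2 - ((t ^ (1 - α) - 1) / (1 - α)) • A z.2, z.2)

end VlasovRiesz

end

open scoped NNReal

noncomputable section

namespace VlasovRiesz

/-! ### The interaction kernel -/

/-! In the coordinates `(x - t v, v)` free transport stands still and the characteristic field
becomes `(-t E, E)`, evaluated at `x + t v`. By the dispersion bound its two components have size
`t^{-α}` and `t^{-1-α}`. Velocities therefore converge, at rate `t^{-α}`, while the first coordinate
may drift like `t^{1-α}`; the correction in the reference flow removes exactly this drift.

To identify the drift, note that `f` is constant along characteristics and the flow preserves
volume, so `E(t, x)` is `-∫ f₀ ∇w(x - X(t))`. The kernel `∇w` is homogeneous of degree `-(1+α)` and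
`X(t, z) / t = V⁺(z) + O(⟨x⟩ t^{-α})`, hence `E(t, t a) = t^{-1-α} A_∞(a) + O(η t^{-1-2α})`
(`force_asymptotics`). Replacing `X / t` by `V⁺` costs a singularity of order `α + 2 < 3`. It is
integrable against a density in `L¹ ∩ L¹_x L^∞_v`, because `v ↦ X / t` and `v ↦ V⁺` contract
distances by at most a factor two (`spread_v`, `lintegral_singular_le`).

For the convergence, `f(t, Φ^ref(t) z) = f₀(Z(t))`, where `Z(t)` is the reference point at time `t`
carried back to time `0`. During a step `d` the true path through the reference point leaves the
reference path by `O(η d t^{-2α})`, times a position weight, in the first coordinate and by `O(η d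
t^{-1-α})` in velocity. Going back to time `0` amplifies the velocity error by at most a multiple of
`t^{1-α}` (`backward_stability`), so `Z` moves by `O(η d t^{-2α} ⟨Z⟩)`, the bracket being that of
the position (`pullback_step`). The Lipschitz bound `η / ⟨x⟩` on `f₀` absorbs the weight and
supplies the second factor `η`. As `2α > 1`, the increments sum to `O(η² t^{1-2α})`
(`exists_limit_of_steps`).

The rest is regularity. Bounded weak derivatives give Lipschitz representatives. Liouville's theorem
and constancy along characteristics are proved for fields that are only Lipschitz in space, by Euler
steps and by a mollifier commutator. The representation of the force is upgraded from almost every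
point to every point by continuity. -/

/-- The kernel `∇w`, with the value `0` at the origin. -/
def kernel (α lam : ℝ) (x : Space) : Space := -(α * lam * ‖x‖ ^ (-(α + 2))) • x

/-- Either there is no derivative at `0`, where `fderiv` defaults to `0`, or the differential equals
its own negative. Hence `gradient (potential α lam)` vanishes at the origin like `kernel`, and the
two agree at every point. -/
lemma fderiv_zero_of_even {g : Space → ℝ} (hg : ∀ x, g (-x) = g x) : fderiv ℝ g 0 = 0 := by
  by_cases hd : DifferentiableAt ℝ g 0
  · have h1 : HasFDerivAt g (fderiv ℝ g 0) (-(0 : Space)) := by simpa using hd.hasFDerivAt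
    have h2 := h1.comp (0 : Space) ((hasFDerivAt_id (𝕜 := ℝ) (0 : Space)).neg)
    have h3 : g ∘ Neg.neg = g := by ext x; simp [hg]
    have h5 : fderiv ℝ g 0 = (fderiv ℝ g 0).comp (-ContinuousLinearMap.id ℝ Space) := by
      refine HasFDerivAt.unique hd.hasFDerivAt ?_
      have h4 : HasFDerivAt (g ∘ Neg.neg) ((fderiv ℝ g 0).comp (-ContinuousLinearMap.id ℝ Space))
        (0 : Space) := h2
      rwa [h3] at h4
    ext v
    have := congrArg (fun L : Space →L[ℝ] ℝ => L v) h5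
    simp at this ⊢
    linarith
  · exact fderiv_zero_of_not_differentiableAt hd

lemma gradient_potential (α lam : ℝ) (x : Space) :
    gradient (potential α lam) x = kernel α lam x := by
  by_cases hx : x = 0
  · subst hx
    have : fderiv ℝ (potential α lam) 0 = 0 :=
      fderiv_zero_of_even fun x => by simp [potential]
    simp [gradient, this, kernel]
  · have hn : ‖x‖ ≠ 0 := by simpa using hx
    have hpos : 0 < ‖x‖ := by positivity
    have h1 : HasStrictFDerivAt (fun y : Space => ‖y‖ ^ 2) (2 • (innerSL ℝ x)) x :=
      hasStrictFDerivAt_norm_sq x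
    have h2 : HasFDerivAt (fun y : Space => (‖y‖ ^ 2) ^ (-α / 2))
        ((-α / 2 * (‖x‖ ^ 2) ^ (-α / 2 - 1)) • (2 • (innerSL ℝ x))) x :=
      h1.hasFDerivAt.rpow_const (Or.inl (by positivity))
    have h3 : (fun y : Space => potential α lam y) = fun y => lam * (‖y‖ ^ 2) ^ (-α / 2) := by
      ext y
      rw [potential, ← Real.rpow_natCast, ← Real.rpow_mul (norm_nonneg _)]
      congr 2; push_cast; ring
    have h4 := h2.const_mul lam
    rw [← h3] at h4
    have h5 : HasGradientAt (potential α lam) (kernel α lam x) x := by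
      rw [hasGradientAt_iff_hasFDerivAt]
      convert! h4 using 1
      ext v
      simp [kernel]
      have : (‖x‖ ^ 2) ^ (-α / 2 - 1) = ‖x‖ ^ (-(α + 2)) := by
        rw [← Real.rpow_natCast, ← Real.rpow_mul (norm_nonneg _)]
        congr 1; push_cast; ring
      rw [this]
      ring_nf
    exact h5.gradient

lemma norm_kernel {α : ℝ} (hα : 0 < α) (lam : ℝ) (x : Space) :
    ‖kernel α lam x‖ = |α * lam| * ‖x‖ ^ (-(α + 1)) := by
  rw [kernel, norm_smul, norm_neg, norm_mul, Real.norm_eq_abs, Real.norm_eq_abs,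
    abs_of_nonneg (Real.rpow_nonneg (norm_nonneg x) _)]
  rcases eq_or_lt_of_le (norm_nonneg x) with h | h
  · rw [← h, Real.zero_rpow (by linarith), Real.zero_rpow (by linarith)]; simp
  · rw [mul_assoc]
    congr 1
    nth_rw 2 [← Real.rpow_one ‖x‖]
    rw [← Real.rpow_add h]
    congr 1; ring

lemma kernel_smul (α lam : ℝ) {t : ℝ} (ht : 0 < t) (x : Space) :
    kernel α lam (t • x) = t ^ (-(1 + α)) • kernel α lam x := by
  rw [kernel, kernel, norm_smul, Real.norm_of_nonneg ht.le, Real.mul_rpow ht.le (norm_nonneg _),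
    smul_smul, smul_smul]
  congr 1
  have : t ^ (-(α + 2)) * t = t ^ (-(1 + α)) := by
    nth_rw 2 [← Real.rpow_one t]
    rw [← Real.rpow_add ht]; congr 1; ring
  rw [← this]; ring

lemma measurable_kernel (α lam : ℝ) : Measurable (kernel α lam) := by
  unfold kernel; fun_prop

/-- Bernoulli's inequality for `(P / Q) ^ γ`, in the form that controls the variation of the radial
factor of the kernel. -/
lemma rpow_neg_sub_mul_le {P Q γ : ℝ} (hP : 0 < P) (hPQ : P ≤ Q) (hγ : 1 ≤ γ) :
    (P ^ (-γ) - Q ^ (-γ)) * Q ≤ γ * (P ^ (-γ) * (Q - P)) := by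
  have hQ : 0 < Q := hP.trans_le hPQ
  have hb := one_add_mul_self_le_rpow_one_add (s := P / Q - 1) (p := γ)
    (by have := div_nonneg hP.le hQ.le; linarith) hγ
  have e : 1 + (P / Q - 1) = P / Q := by ring
  rw [e, Real.div_rpow hP.le hQ.le] at hb
  have hPg := Real.rpow_pos_of_pos hP γ
  have hQg := Real.rpow_pos_of_pos hQ γ
  rw [Real.rpow_neg hP.le, Real.rpow_neg hQ.le]
  have h1 : 1 - P ^ γ / Q ^ γ ≤ γ * ((Q - P) / Q) := by
    have : (Q - P) / Q = 1 - P / Q := by field_simp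
    rw [this]; linarith
  calc ((P ^ γ)⁻¹ - (Q ^ γ)⁻¹) * Q = (P ^ γ)⁻¹ * Q * (1 - P ^ γ / Q ^ γ) := by field_simp
    _ ≤ (P ^ γ)⁻¹ * Q * (γ * ((Q - P) / Q)) := by gcongr
    _ = γ * ((P ^ γ)⁻¹ * (Q - P)) := by field_simp

/-- With `p` the shorter vector, the difference is the radial factor at `p` times `p - q`, plus the
variation of that factor times `q`; the Bernoulli bound reduces the second to `α + 2` copies of the
first. When `p = 0` the real power at `p` defaults to `0`, and the term at `q` carries the estimate.
-/
lemma norm_kernel_sub_le_of_le {α : ℝ} (hα : 0 < α) (lam : ℝ) {p q : Space} (hpq : ‖p‖ ≤ ‖q‖) :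
    ‖kernel α lam p - kernel α lam q‖ ≤
      |α * lam| * (α + 3) * (‖p - q‖ * (‖p‖ ^ (-(α + 2)) + ‖q‖ ^ (-(α + 2)))) := by
  rcases eq_or_lt_of_le (norm_nonneg p) with h | h
  · have hp : p = 0 := by simpa using h.symm
    subst hp
    have : kernel α lam 0 = 0 := by simp [kernel]
    rw [this, zero_sub, norm_neg, zero_sub, norm_neg, norm_zero,
      Real.zero_rpow (by linarith), zero_add, kernel, norm_smul, norm_neg, norm_mul,
      Real.norm_eq_abs, Real.norm_eq_abs, abs_of_nonneg (Real.rpow_nonneg (norm_nonneg q) _)]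
    have h0 : 0 ≤ |α * lam| * (‖q‖ * ‖q‖ ^ (-(α + 2))) := by positivity
    nlinarith
  · set P := ‖p‖
    set Q := ‖q‖
    have e : kernel α lam p - kernel α lam q = -(α * lam) • ((P ^ (-(α + 2))) • (p - q) +
        (P ^ (-(α + 2)) - Q ^ (-(α + 2))) • q) := by
      simp only [kernel, P, Q, smul_add, smul_sub, sub_smul, smul_smul, neg_mul, neg_smul]
      abel
    have hle : Q ^ (-(α + 2)) ≤ P ^ (-(α + 2)) :=
      Real.rpow_le_rpow_of_nonpos h hpq (by linarith)
    have hk := rpow_neg_sub_mul_le h hpq (γ := α + 2) (by linarith)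
    have hd : Q - P ≤ ‖p - q‖ := by
      rw [norm_sub_rev]; exact norm_sub_norm_le q p
    have hPn : 0 ≤ P ^ (-(α + 2)) := Real.rpow_nonneg h.le _
    have hQn : 0 ≤ Q ^ (-(α + 2)) := Real.rpow_nonneg (h.le.trans hpq) _
    rw [e, norm_smul, norm_neg, Real.norm_eq_abs, mul_assoc]
    gcongr
    calc _ ≤ P ^ (-(α + 2)) * ‖p - q‖ + (P ^ (-(α + 2)) - Q ^ (-(α + 2))) * Q := by
          refine (norm_add_le _ _).trans ?_
          rw [norm_smul, norm_smul, Real.norm_of_nonneg hPn,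
            Real.norm_of_nonneg (sub_nonneg.2 hle)]
      _ ≤ P ^ (-(α + 2)) * ‖p - q‖ + (α + 2) * (P ^ (-(α + 2)) * ‖p - q‖) := by
          have : P ^ (-(α + 2)) * (Q - P) ≤ P ^ (-(α + 2)) * ‖p - q‖ := by gcongr
          nlinarith
      _ ≤ _ := by
          have : 0 ≤ (α + 3) * (‖p - q‖ * Q ^ (-(α + 2))) := by positivity
          nlinarith

lemma norm_kernel_sub_le {α : ℝ} (hα : 0 < α) (lam : ℝ) (p q : Space) :
    ‖kernel α lam p - kernel α lam q‖ ≤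
      |α * lam| * (α + 3) * (‖p - q‖ * (‖p‖ ^ (-(α + 2)) + ‖q‖ ^ (-(α + 2)))) := by
  rcases le_total ‖p‖ ‖q‖ with h | h
  · exact norm_kernel_sub_le_of_le hα lam h
  · rw [norm_sub_rev, norm_sub_rev p q, add_comm (‖p‖ ^ _)]
    exact norm_kernel_sub_le_of_le hα lam h

/-! ### Singular integrals -/

/-- Preimages under a map contracting distances by at most a factor two have three-dimensional
Hausdorff measure at most `2³ = 8` times larger, and Lebesgue measure is a multiple of Hausdorff
measure. This is a change of variables with no Jacobian, so the map need not be differentiable. -/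
lemma lintegral_comp_le_of_antilipschitz {g : Space → Space} (hg : AntilipschitzWith 2 g)
    (hm : Measurable g) {φ : Space → ℝ≥0∞} (hφ : Measurable φ) :
    ∫⁻ v, φ (g v) ≤ 8 * ∫⁻ y, φ y := by
  have key : Measure.map g volume ≤ (8 : ℝ≥0∞) • (volume : Measure Space) := by
    have hH : ∃ c : ℝ≥0∞, c ≠ ⊤ ∧
        (volume : Measure Space) = c • (Measure.hausdorffMeasure 3 : Measure Space) := by
      have h3 : (Module.finrank ℝ Space : ℝ) = 3 := by simp
      have hi : Measure.IsAddHaarMeasure (Measure.hausdorffMeasure 3 : Measure Space) := by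
        rw [← h3]; infer_instance
      refine ⟨_, ENNReal.coe_ne_top,
        Measure.isAddLeftInvariant_eq_smul (volume : Measure Space) (Measure.hausdorffMeasure 3)⟩
    obtain ⟨c, -, hc⟩ := hH
    refine Measure.le_iff.2 fun s hs => ?_
    rw [Measure.map_apply hm hs, Measure.smul_apply, hc, Measure.smul_apply, Measure.smul_apply,
      smul_eq_mul, smul_eq_mul, smul_eq_mul]
    have := hg.hausdorffMeasure_preimage_le (d := 3) (by norm_num) s
    calc c * Measure.hausdorffMeasure 3 (g ⁻¹' s)
        ≤ c * (((2 : ℝ≥0) : ℝ≥0∞) ^ (3 : ℝ) * Measure.hausdorffMeasure 3 s) := by gcongr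
      _ = 8 * (c * Measure.hausdorffMeasure 3 s) := by
          have : (((2 : ℝ≥0) : ℝ≥0∞) ^ (3 : ℝ)) = 8 := by
            rw [show (3 : ℝ) = ((3 : ℕ) : ℝ) by norm_num, ENNReal.rpow_natCast]
            norm_num
          rw [this]; ring
  calc ∫⁻ v, φ (g v) = ∫⁻ y, φ y ∂(Measure.map g volume) := (lintegral_map hφ hm).symm
    _ ≤ ∫⁻ y, φ y ∂((8 : ℝ≥0∞) • (volume : Measure Space)) := lintegral_mono' key le_rfl
    _ = _ := by rw [lintegral_smul_measure, smul_eq_mul]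

/-- `∫_{|y| < 1} |y|^{-β} dy`. -/
def singMass (β : ℝ) : ℝ≥0∞ := ∫⁻ y in Metric.ball (0 : Space) 1, ENNReal.ofReal (‖y‖ ^ (-β))

lemma singMass_ne_top {β : ℝ} (hβ : β < 3) : singMass β ≠ ⊤ := by
  have h := integrableOn_ball_of_norm_le_rpow (E := Space) (F := ℝ) (μ := volume) (r := 1)
    (f := fun y => ‖y‖ ^ (-β)) (C := 1) (α := β) (by simp) (by simpa using hβ)
    (Eventually.of_forall fun x => by
      rw [one_mul, Real.norm_of_nonneg (Real.rpow_nonneg (norm_nonneg x) _)])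
    (measurable_norm.pow_const _).aestronglyMeasurable
  have := h.lintegral_lt_top
  exact this.ne

lemma ofReal_rpow_le {β : ℝ} (hβ : 0 < β) (y : Space) :
    ENNReal.ofReal (‖y‖ ^ (-β)) ≤
      1 + (Metric.ball (0 : Space) 1).indicator (fun y => ENNReal.ofReal (‖y‖ ^ (-β))) y := by
  by_cases h : ‖y‖ < 1
  · rw [indicator_of_mem (by simpa using h)]
    exact le_add_self
  · rw [indicator_of_notMem (by simpa using h), add_zero]
    refine ENNReal.ofReal_le_one.2 ?_
    exact Real.rpow_le_one_of_one_le_of_nonpos (not_lt.1 h) (by linarith)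

/-- The singular kernel `|a - p(x, v)|^{-β}` against a density whose `L¹` and `L¹_x L^∞_v` norms
are finite, when `v ↦ p(x, v)` expands distances by at least `1/2`. -/
lemma lintegral_singular_le {β : ℝ} (hβ : 0 < β) (hβ' : β < 3) {p : Phase → Space} (hp : Measurable p)
    (hanti : ∀ x, AntilipschitzWith 2 fun v => p (x, v)) {u : Phase → ℝ} (hu : Measurable u)
    (a : Space) :
    ∫⁻ z, ENNReal.ofReal (‖a - p z‖ ^ (-β)) * ‖u z‖ₑ ≤
      eLpNorm u 1 volume + 8 * singMass β * normXV 1 ⊤ u := by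
  set φ : Space → ℝ≥0∞ :=
    (Metric.ball (0 : Space) 1).indicator (fun y => ENNReal.ofReal (‖y‖ ^ (-β))) with hφ
  have hφm : Measurable φ :=
    Measurable.indicator (by fun_prop) Metric.isOpen_ball.measurableSet
  have hφi : ∫⁻ y, φ y = singMass β := by
    rw [hφ, lintegral_indicator Metric.isOpen_ball.measurableSet]; rfl
  have hm : Measurable fun z => φ (a - p z) := hφm.comp (measurable_const.sub hp)
  calc ∫⁻ z, ENNReal.ofReal (‖a - p z‖ ^ (-β)) * ‖u z‖ₑ
      ≤ ∫⁻ z, (‖u z‖ₑ + φ (a - p z) * ‖u z‖ₑ) := by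
        refine lintegral_mono fun z => ?_
        -- Outside the unit ball the kernel is at most `1` and the `L¹` norm suffices; only the part
        -- near the singularity needs the supremum in `v`.
        calc _ ≤ (1 + φ (a - p z)) * ‖u z‖ₑ := by gcongr; exact ofReal_rpow_le hβ _
          _ = _ := by ring
    _ = (∫⁻ z, ‖u z‖ₑ) + ∫⁻ z, φ (a - p z) * ‖u z‖ₑ := lintegral_add_left hu.enorm _
    _ ≤ _ := by
        rw [eLpNorm_one_eq_lintegral_enorm]
        refine add_le_add_right ?_ _
        rw [Measure.volume_eq_prod, lintegral_prod (fun z : Phase => φ (a - p z) * ‖u z‖ₑ)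
          (hm.mul hu.enorm).aemeasurable]
        calc ∫⁻ x, ∫⁻ v, φ (a - p (x, v)) * ‖u (x, v)‖ₑ
            ≤ ∫⁻ x, (8 * singMass β) * eLpNorm (fun v => u (x, v)) ⊤ volume := by
              refine lintegral_mono fun x => ?_
              calc ∫⁻ v, φ (a - p (x, v)) * ‖u (x, v)‖ₑ
                  ≤ ∫⁻ v, φ (a - p (x, v)) * eLpNorm (fun v => u (x, v)) ⊤ volume := by
                    refine lintegral_mono_ae ?_
                    have := enorm_ae_le_eLpNormEssSup (fun v => u (x, v)) (volume : Measure Space)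
                    filter_upwards [this] with v hv
                    rw [eLpNorm_exponent_top]
                    gcongr
                _ = (∫⁻ v, φ (a - p (x, v))) * eLpNorm (fun v => u (x, v)) ⊤ volume :=
                    lintegral_mul_const _ (hm.comp measurable_prodMk_left)
                _ ≤ _ := by
                    gcongr
                    rw [← hφi]
                    refine lintegral_comp_le_of_antilipschitz (g := fun v => a - p (x, v)) ?_
                      (measurable_const.sub (hp.comp measurable_prodMk_left)) hφm
                    intro v w
                    simpa [edist_sub_left] using hanti x v w
          _ ≤ _ := by
              rw [normXV, eLpNorm_one_eq_lintegral_enorm]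
              simp only [enorm_eq_self]
              rw [lintegral_const_mul' _ _ (ENNReal.mul_ne_top (by norm_num) (singMass_ne_top hβ'))]

/-- The version of `lintegral_singular_le` with the roles of `x` and `v` interchanged. -/
lemma lintegral_singular_le_swap {β : ℝ} (hβ : 0 < β) (hβ' : β < 3) {p : Phase → Space}
    (hp : Measurable p) (hanti : ∀ v, AntilipschitzWith 2 fun x => p (x, v)) {u : Phase → ℝ}
    (hu : Measurable u) (a : Space) :
    ∫⁻ z, ENNReal.ofReal (‖a - p z‖ ^ (-β)) * ‖u z‖ₑ ≤
      eLpNorm u 1 volume + 8 * singMass β * normVX 1 ⊤ u := by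
  have h := lintegral_singular_le hβ hβ' (p := fun z => p z.swap) (hp.comp measurable_swap)
    hanti (u := fun z => u z.swap) (hu.comp measurable_swap) a
  have hswap : MeasurePreserving (Prod.swap : Phase → Phase) volume volume :=
    Measure.measurePreserving_swap
  have e1 := hswap.lintegral_comp (f := fun z => ENNReal.ofReal (‖a - p z‖ ^ (-β)) * ‖u z‖ₑ)
    (by have := hp; have := hu; fun_prop)
  have e2 : eLpNorm (fun z : Phase => u z.swap) 1 volume = eLpNorm u 1 volume :=
    eLpNorm_comp_measurePreserving hu.aestronglyMeasurable hswap
  have e3 : normXV 1 ⊤ (fun z => u z.swap) = normVX 1 ⊤ u := rfl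
  rwa [e1, e2, e3] at h

section

open scoped Convolution

/-! ### Functions with bounded weak derivatives are Lipschitz -/

section LipschitzRepresentative

variable {G : Type*} [NormedAddCommGroup G] [NormedSpace ℝ G] [FiniteDimensional ℝ G]
  [MeasureSpace G] [BorelSpace G] [(volume : Measure G).IsAddHaarMeasure]
  {F : Type*} [NormedAddCommGroup F] [NormedSpace ℝ F]

-- The derivative of the convolution falls on the bump. Testing the weak derivative with `z ↦ φ(x -
-- z)`, whose differential has the opposite sign, moves it onto `u`.
open ContinuousLinearMap in
lemma hasFDerivAt_mollify [CompleteSpace F] (φ : ContDiffBump (0 : G)) {u : G → F} (hu : LocallyIntegrable u)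
    (x : G) :
    ∃ D : G →L[ℝ] F, HasFDerivAt (φ.normed volume ⋆[lsmul ℝ ℝ, volume] u) D x ∧
      ∀ e g, IsWeakDeriv [e] u g → D e = ∫ z, φ.normed volume (x - z) • g z := by
  have hcs : HasCompactSupport (φ.normed (volume : Measure G)) := φ.hasCompactSupport_normed
  have hsm : ContDiff ℝ ∞ (φ.normed (volume : Measure G)) := φ.contDiff_normed
  refine ⟨_, hcs.hasFDerivAt_convolution_left (lsmul ℝ ℝ) (hsm.of_le (by simp)) hu x, ?_⟩
  intro e g hg
  have hex : ConvolutionExistsAt (fderiv ℝ (φ.normed (volume : Measure G))) u x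
      (precompL G (lsmul ℝ ℝ)) volume :=
    (hcs.fderiv ℝ).convolutionExists_left _ (hsm.continuous_fderiv (by simp)) hu x
  have hψ : ContDiff ℝ ∞ fun z => φ.normed (volume : Measure G) (x - z) :=
    hsm.comp (contDiff_const.sub contDiff_id)
  have hψc : HasCompactSupport fun z => φ.normed (volume : Measure G) (x - z) :=
    hcs.comp_homeomorph (Homeomorph.subLeft x)
  have h := hg.2.2 _ hψ hψc
  have hd : ∀ z, fderiv ℝ (fun z => φ.normed (volume : Measure G) (x - z)) z e =
      -fderiv ℝ (φ.normed (volume : Measure G)) (x - z) e := by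
    intro z
    have h1 : HasFDerivAt (φ.normed (volume : Measure G)) _ (x - z) :=
      (hsm.differentiable (by simp) _).hasFDerivAt
    have h2 := h1.comp z ((hasFDerivAt_const x z).sub (hasFDerivAt_id z))
    have h3 : HasFDerivAt (fun z => φ.normed (volume : Measure G) (x - z)) _ z := h2
    rw [h3.fderiv]
    simp
  simp only [dirDeriv, hd, neg_smul, integral_neg, List.length_singleton, pow_one, one_smul,
    neg_inj] at h
  rw [← h, convolution_eq_swap, ContinuousLinearMap.integral_apply hex.integrable_swap]
  simp [precompL_apply]

-- The bump has integral one, so averaging keeps the bounds `B i` on the directional derivatives.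
-- The constant does not depend on the mollification scale, which is what allows a limit.
open ContinuousLinearMap in
lemma lipschitzWith_mollify [CompleteSpace F] {ι : Type*} [Fintype ι] (e : ι → G) (c : G → ι → ℝ)
    (hc : ∀ z, z = ∑ i, c z i • e i) (hc1 : ∀ z i, |c z i| ≤ ‖z‖) {u : G → F} {B : ι → ℝ≥0}
    (hu : LocallyIntegrable u)
    (h : ∀ i, ∃ g, IsWeakDeriv [e i] u g ∧ eLpNorm g ⊤ volume ≤ B i) (φ : ContDiffBump (0 : G)) :
    LipschitzWith (∑ i, B i) (φ.normed volume ⋆[lsmul ℝ ℝ, volume] u) := by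
  choose g hg hgB using h
  refine lipschitzWith_of_nnnorm_fderiv_le (𝕜 := ℝ) (fun x => ?_) (fun x => ?_)
  · obtain ⟨D, hD, -⟩ := hasFDerivAt_mollify φ hu x
    exact hD.differentiableAt
  · obtain ⟨D, hD, hDe⟩ := hasFDerivAt_mollify φ hu x
    rw [hD.fderiv]
    have hi : ∀ i, ‖D (e i)‖ ≤ B i := by
      intro i
      rw [hDe _ _ (hg i)]
      have hae : ∀ᵐ z, ‖g i z‖ ≤ B i := by
        have h1 := ae_le_eLpNormEssSup (f := g i) (μ := (volume : Measure G))
        filter_upwards [h1] with z hz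
        have := hz.trans ((eLpNorm_exponent_top (f := g i) (μ := volume)).symm.le.trans (hgB i))
        rwa [enorm_le_coe, ← NNReal.coe_le_coe, coe_nnnorm] at this
      have hint : Integrable (fun z => φ.normed (volume : Measure G) (x - z)) :=
        φ.integrable_normed.comp_sub_left x
      calc ‖∫ z, φ.normed volume (x - z) • g i z‖
          ≤ ∫ z, φ.normed volume (x - z) * B i := by
            refine norm_integral_le_of_norm_le (hint.mul_const _) ?_
            filter_upwards [hae] with z hz
            rw [norm_smul, Real.norm_of_nonneg (φ.nonneg_normed _)]
            exact mul_le_mul_of_nonneg_left hz (φ.nonneg_normed _)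
        _ = B i := by
            rw [integral_mul_const, integral_sub_left_eq_self (φ.normed volume) volume x,
              φ.integral_normed, one_mul]
    rw [← NNReal.coe_le_coe, coe_nnnorm]
    refine ContinuousLinearMap.opNorm_le_bound _ (NNReal.coe_nonneg _) fun z => ?_
    calc ‖D z‖ = ‖∑ i, c z i • D (e i)‖ := by
          conv_lhs => rw [hc z]
          simp
      _ ≤ ∑ i, ‖c z i • D (e i)‖ := norm_sum_le _ _
      _ ≤ ∑ i, ‖z‖ * B i := by
          refine Finset.sum_le_sum fun i _ => ?_
          rw [norm_smul, Real.norm_eq_abs]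
          exact mul_le_mul (hc1 z i) (hi i) (norm_nonneg _) (norm_nonneg _)
      _ = _ := by rw [← Finset.mul_sum, mul_comm]; simp

/-- The mollifications converge to `u` almost everywhere with a common Lipschitz constant, so `u`
itself is Lipschitz on the set of convergence. Extending a vector-valued Lipschitz map off that set
costs `lipschitzExtensionConstant F`. -/
lemma exists_lipschitz_representative [FiniteDimensional ℝ F] {ι : Type*} [Fintype ι] (e : ι → G) (c : G → ι → ℝ)
    (hc : ∀ z, z = ∑ i, c z i • e i) (hc1 : ∀ z i, |c z i| ≤ ‖z‖) {u : G → F} {B : ι → ℝ≥0}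
    (hu : LocallyIntegrable u)
    (h : ∀ i, ∃ g, IsWeakDeriv [e i] u g ∧ eLpNorm g ⊤ volume ≤ B i) :
    ∃ w : G → F, LipschitzWith (lipschitzExtensionConstant F * ∑ i, B i) w ∧ w =ᵐ[volume] u := by
  have : CompleteSpace F := FiniteDimensional.complete ℝ F
  -- The ratio of the radii stays equal to `2`, since convergence at Lebesgue points needs it
  -- bounded.
  let φ : ℕ → ContDiffBump (0 : G) := fun n =>
    { rIn := 1 / (n + 1), rOut := 2 * (1 / (n + 1)), rIn_pos := by positivity,
      rIn_lt_rOut := by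
        have : (0 : ℝ) < 1 / (n + 1) := by positivity
        linarith }
  have hφ : Tendsto (fun n => (φ n).rOut) atTop (𝓝 0) := by
    have := (tendsto_one_div_add_atTop_nhds_zero_nat (𝕜 := ℝ)).const_mul 2
    simpa [φ] using this
  have hae := ContDiffBump.ae_convolution_tendsto_right_of_locallyIntegrable hφ (K := 2)
    (Eventually.of_forall fun n => le_rfl) hu
  set S := {x | Tendsto (fun n => ((φ n).normed volume ⋆[ContinuousLinearMap.lsmul ℝ ℝ, volume] u) x)
    atTop (𝓝 (u x))} with hS
  have hL : LipschitzOnWith (∑ i, B i) u S := by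
    refine LipschitzOnWith.of_dist_le_mul fun x hx y hy => ?_
    refine le_of_tendsto (Tendsto.dist hx hy) (Eventually.of_forall fun n => ?_)
    exact (lipschitzWith_mollify e c hc hc1 hu h (φ n)).dist_le_mul x y
  obtain ⟨w, hw, hwS⟩ := hL.extend_finite_dimension
  refine ⟨w, hw, ?_⟩
  filter_upwards [hae] with x hx
  exact (hwS hx).symm

end LipschitzRepresentative

lemma space_eq_sum (x : Space) : x = ∑ i, x i • basisVec i := by
  ext j
  fin_cases j <;> simp [basisVec, Fin.sum_univ_three]

lemma exists_weakDeriv_of_weakNorm_lt {G F : Type*} [NormedAddCommGroup G] [NormedSpace ℝ G]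
    [NormedAddCommGroup F] [NormedSpace ℝ F] [MeasureSpace G] {N : (G → F) → ℝ≥0∞} {l : List G}
    {u : G → F} {B : ℝ≥0∞} (h : weakNorm N l u < B) : ∃ g, IsWeakDeriv l u g ∧ N g < B := by
  obtain ⟨g, hg⟩ := iInf_lt_iff.1 h
  obtain ⟨hw, hB⟩ := iInf_lt_iff.1 hg
  exact ⟨g, hw, hB⟩

lemma exists_lipschitz_representative_space {u : Space → Space} {B : ℝ≥0}
    (h : ∀ i, weakNorm (fun g => eLpNorm g ⊤ volume) [basisVec i] u < B) :
    ∃ w : Space → Space, LipschitzWith (lipschitzExtensionConstant Space * (3 * B)) w ∧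
      w =ᵐ[volume] u := by
  have h' : ∀ i, ∃ g, IsWeakDeriv [basisVec i] u g ∧ eLpNorm g ⊤ volume ≤ B := fun i =>
    let ⟨g, hg, hB⟩ := exists_weakDeriv_of_weakNorm_lt (h i)
    ⟨g, hg, hB.le⟩
  obtain ⟨g, hg, -⟩ := h' 0
  have := exists_lipschitz_representative basisVec (fun z i => z i) space_eq_sum
    (fun z i => by simpa using PiLp.norm_apply_le z i) hg.1 h'
  simpa using this

lemma exists_lipschitz_representative_phase {u : Phase → ℝ} {B : ℝ≥0}
    (hx : ∀ i, weakNorm (fun g => eLpNorm g ⊤ volume) [(basisVec i, 0)] u < B)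
    (hv : ∀ i, weakNorm (fun g => eLpNorm g ⊤ volume) [(0, basisVec i)] u < B) :
    ∃ w : Phase → ℝ, LipschitzWith (lipschitzExtensionConstant ℝ * (6 * B)) w ∧
      w =ᵐ[volume] u := by
  have : (volume : Measure Phase).IsAddHaarMeasure :=
    inferInstanceAs (Measure.IsAddHaarMeasure ((volume : Measure Space).prod volume))
  let e : Fin 3 ⊕ Fin 3 → Phase := Sum.elim (fun i => (basisVec i, 0)) fun i => (0, basisVec i)
  let c : Phase → Fin 3 ⊕ Fin 3 → ℝ := fun z => Sum.elim (fun i => z.1 i) fun i => z.2 i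
  have h' : ∀ i, ∃ g, IsWeakDeriv [e i] u g ∧ eLpNorm g ⊤ volume ≤ B := by
    rintro (i | i)
    · obtain ⟨g, hg, hB⟩ := exists_weakDeriv_of_weakNorm_lt (hx i)
      exact ⟨g, hg, hB.le⟩
    · obtain ⟨g, hg, hB⟩ := exists_weakDeriv_of_weakNorm_lt (hv i)
      exact ⟨g, hg, hB.le⟩
  obtain ⟨g, hg, -⟩ := h' (Sum.inl 0)
  have := exists_lipschitz_representative e c (fun z => by
      rw [Fintype.sum_sum_type]
      ext1
      · simpa [e, c, Prod.fst_sum] using space_eq_sum z.1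
      · simpa [e, c, Prod.snd_sum] using space_eq_sum z.2) (by
      rintro z (i | i)
      · exact (by simpa [c] using PiLp.norm_apply_le z.1 i : |c z (Sum.inl i)| ≤ ‖z.1‖).trans
          (norm_fst_le z)
      · exact (by simpa [c] using PiLp.norm_apply_le z.2 i : |c z (Sum.inr i)| ≤ ‖z.2‖).trans
          (norm_snd_le z)) hg.1 h'
  simpa using this

end

/-! ### Global flows of bounded Lipschitz fields -/

section Evolution

variable {G : Type*} [NormedAddCommGroup G] [NormedSpace ℝ G]

/-- A time-dependent vector field that is bounded and Lipschitz, uniformly in time. -/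
structure BddLipField (c : ℝ → G → G) (L : ℝ≥0) : Prop where
  cont : ∀ x, Continuous fun t => c t x
  lip : ∀ t, LipschitzWith L (c t)
  bdd : ∀ t x, ‖c t x‖ ≤ L

lemma BddLipField.exists_local [CompleteSpace G] {c : ℝ → G → G} {L : ℝ≥0} (hc : BddLipField c L)
    (s : ℝ) (x : G) {T : ℝ} (hT : 0 < T) :
    ∃ w : ℝ → G, w s = x ∧ ContinuousOn w (Icc (s - T) (s + T)) ∧
      ∀ t ∈ Ioo (s - T) (s + T), HasDerivAt w (c t (w t)) t := by
  have hs : s ∈ Icc (s - T) (s + T) := ⟨by linarith, by linarith⟩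
  -- The field is bounded by `L` on the whole space, so the ball of radius `L T` is not left during
  -- time `T`; the existence interval can be as long as desired.
  have hP : IsPicardLindelof c (⟨s, hs⟩ : Icc (s - T) (s + T)) x (L * T.toNNReal) 0 L L :=
    { lipschitzOnWith := fun t _ => (hc.lip t).lipschitzOnWith
      continuousOn := fun y _ => (hc.cont y).continuousOn
      norm_le := fun t _ y _ => hc.bdd t y
      mul_max_le := by simp [hT.le] }
  obtain ⟨w, hw, hd⟩ := hP.exists_eq_forall_mem_Icc_hasDerivWithinAt₀
  refine ⟨w, hw, fun t ht => (hd t ht).continuousWithinAt, fun t ht => ?_⟩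
  exact (hd t (Ioo_subset_Icc_self ht)).hasDerivAt (Icc_mem_nhds ht.1 ht.2)

/-- By uniqueness the solutions on growing intervals extend one another. The value at `t` is read
from the solution of index `⌈|t - s|⌉₊`, and near `t` all these agree with the one of the next
index, which is differentiable there. -/
lemma BddLipField.exists_global [CompleteSpace G] {c : ℝ → G → G} {L : ℝ≥0}
    (hc : BddLipField c L) (s : ℝ) (x : G) :
    ∃ w : ℝ → G, w s = x ∧ ∀ t, HasDerivAt w (c t (w t)) t := by
  choose w hws hwc hwd using fun n : ℕ =>
    hc.exists_local s x (T := (n : ℝ) + 1) (by positivity)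
  have huniq : ∀ n m : ℕ, n ≤ m → EqOn (w n) (w m) (Icc (s - (n + 1)) (s + (n + 1))) := by
    intro n m hnm
    have hnm' : (n : ℝ) ≤ m := by exact_mod_cast hnm
    have hpos : (0 : ℝ) ≤ n := by positivity
    refine ODE_solution_unique_of_mem_Icc (v := c) (s := fun _ => univ) (K := L) (t₀ := s)
      (fun t _ => (hc.lip t).lipschitzOnWith) ⟨by linarith, by linarith⟩ (hwc n)
      (hwd n) (fun _ _ => trivial)
      ((hwc m).mono (Icc_subset_Icc (by linarith) (by linarith)))
      (fun t ht => hwd m t ⟨by linarith [ht.1], by linarith [ht.2]⟩) (fun _ _ => trivial)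
      ((hws n).trans (hws m).symm)
  refine ⟨fun t => w ⌈|t - s|⌉₊ t, hws _, fun t => ?_⟩
  set N := ⌈|t - s|⌉₊ + 1 with hN
  have hev : ∀ t', |t' - s| < N → w ⌈|t' - s|⌉₊ t' = w N t' := by
    intro t' ht'
    refine huniq _ _ ?_ ?_
    · exact Nat.ceil_le.2 ht'.le
    · have h1 := Nat.le_ceil (|t' - s|)
      have h2 := abs_le.1 h1
      exact ⟨by linarith, by linarith⟩
  have htN : |t - s| < N := by
    have := Nat.le_ceil (|t - s|)
    push_cast [hN]; linarith
  have hd := hwd N t (by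
    have := abs_lt.1 htN
    exact ⟨by linarith, by linarith⟩)
  have hopen : ∀ᶠ t' in 𝓝 t, |t' - s| < N :=
    (continuous_id.sub continuous_const).abs.continuousAt.eventually_lt continuousAt_const htN
  have h1 := hd.congr_of_eventuallyEq (hopen.mono hev)
  rwa [← hev t htN] at h1

/-- The evolution of the field `c` from time `s` to time `t`. -/
def evol (c : ℝ → G → G) (s t : ℝ) (x : G) : G :=
  open Classical in
  if h : ∃ w : ℝ → G, w s = x ∧ ∀ t, HasDerivAt w (c t (w t)) t then h.choose t else x

variable [CompleteSpace G] {c : ℝ → G → G} {L : ℝ≥0}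

lemma BddLipField.evol_self (hc : BddLipField c L) (s : ℝ) (x : G) : evol c s s x = x := by
  have h := hc.exists_global s x
  rw [evol, dif_pos h]
  exact h.choose_spec.1

lemma BddLipField.hasDerivAt_evol (hc : BddLipField c L) (s t : ℝ) (x : G) :
    HasDerivAt (fun t => evol c s t x) (c t (evol c s t x)) t := by
  have h := hc.exists_global s x
  have e : (fun t => evol c s t x) = h.choose := by
    ext t; rw [evol, dif_pos h]
  have e' : evol c s t x = h.choose t := congrFun e t
  rw [e, e']
  exact h.choose_spec.2 t

lemma BddLipField.continuous_evol_time (hc : BddLipField c L) (s : ℝ) (x : G) :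
    Continuous fun t => evol c s t x :=
  continuous_iff_continuousAt.2 fun t => (hc.hasDerivAt_evol s t x).continuousAt

/-- Uniqueness of integral curves; it turns the choice made in `evol` into a two-parameter group. -/
lemma BddLipField.eq_evol (hc : BddLipField c L) {w : ℝ → G}
    (hw : ∀ t, HasDerivAt w (c t (w t)) t) (s t : ℝ) : evol c s t (w s) = w t :=
  congrFun (ODE_solution_unique_univ (v := c) (s := fun _ => univ) (K := L) (t₀ := s)
    (fun t => (hc.lip t).lipschitzOnWith) (fun t => ⟨hc.hasDerivAt_evol s t _, trivial⟩)
    (fun t => ⟨hw t, trivial⟩) (hc.evol_self s _)) t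

lemma BddLipField.evol_evol (hc : BddLipField c L) (r s t : ℝ) (x : G) :
    evol c s t (evol c r s x) = evol c r t x :=
  hc.eq_evol (fun t => hc.hasDerivAt_evol r t x) s t

lemma BddLipField.dist_evol_le (hc : BddLipField c L) {s t : ℝ} (hst : s ≤ t) (x y : G) :
    dist (evol c s t x) (evol c s t y) ≤ Real.exp (L * (t - s)) * dist x y := by
  have := dist_le_of_trajectories_ODE (v := c) (K := L) (a := s) (b := t) (δ := dist x y) hc.lip
    (hc.continuous_evol_time s x).continuousOn
    (fun r _ => (hc.hasDerivAt_evol s r x).hasDerivWithinAt)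
    (hc.continuous_evol_time s y).continuousOn
    (fun r _ => (hc.hasDerivAt_evol s r y).hasDerivWithinAt)
    (by rw [hc.evol_self, hc.evol_self]) t ⟨hst, le_rfl⟩
  rwa [mul_comm]

lemma BddLipField.dist_evol_self_le (hc : BddLipField c L) (s t : ℝ) (x : G) :
    dist (evol c s t x) x ≤ L * |t - s| := by
  have := Convex.norm_image_sub_le_of_norm_hasDerivWithin_le (f := fun t => evol c s t x)
    (f' := fun t => c t (evol c s t x)) (s := univ) (C := L)
    (fun r _ => (hc.hasDerivAt_evol s r x).hasDerivWithinAt) (fun r _ => hc.bdd _ _)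
    convex_univ (mem_univ s) (mem_univ t)
  simpa [hc.evol_self, dist_eq_norm] using this

lemma BddLipField.continuous_evol (hc : BddLipField c L) {s t : ℝ} (hst : s ≤ t) :
    Continuous (evol c s t) :=
  (LipschitzWith.of_dist_le_mul (K := (Real.exp (L * (t - s))).toNNReal) fun x y => by
    rw [Real.coe_toNNReal _ (Real.exp_pos _).le]
    exact hc.dist_evol_le hst x y).continuous

end Evolution

/-! ### Force fields with the dispersive decay -/

/-- A force field on all of `ℝ × ℝ³`, continuous in time uniformly in space, with the decay of the
dispersion bound. -/
structure ForceField (α κ : ℝ) (E : ℝ → Space → Space) : Prop where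
  bound : ∀ t x, ‖E t x‖ ≤ κ * (1 + |t|) ^ (-(1 + α))
  lip : ∀ t x y, ‖E t x - E t y‖ ≤ κ * (1 + |t|) ^ (-(2 + α)) * ‖x - y‖
  unif : ∀ t ε, 0 < ε → ∀ᶠ s in 𝓝 t, ∀ x, ‖E s x - E t x‖ ≤ ε

/-- The characteristic field in the coordinates `(x - t v, v)`. -/
def twisted (E : ℝ → Space → Space) (t : ℝ) (W : Phase) : Phase :=
  (-(t • E t (W.1 + t • W.2)), E t (W.1 + t • W.2))

section

variable {α κ : ℝ} {E : ℝ → Space → Space}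

lemma ForceField.kappa_nonneg (hE : ForceField α κ E) : 0 ≤ κ := by
  simpa using (norm_nonneg _).trans (hE.bound 0 0)

lemma ForceField.continuous (hE : ForceField α κ E) :
    Continuous fun q : ℝ × Space => E q.1 q.2 := by
  rw [continuous_iff_continuousAt]
  rintro ⟨t, x⟩
  rw [Metric.continuousAt_iff']
  intro ε hε
  have h1 : ∀ᶠ q : ℝ × Space in 𝓝 (t, x), ∀ y, ‖E q.1 y - E t y‖ ≤ ε / 2 :=
    (continuous_fst.tendsto (t, x)).eventually (hE.unif t (ε / 2) (by positivity))
  have hc : Continuous (E t) := by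
    refine (LipschitzWith.of_dist_le_mul (K := (κ * (1 + |t|) ^ (-(2 + α))).toNNReal)
      fun x y => ?_).continuous
    rw [Real.coe_toNNReal _ (mul_nonneg hE.kappa_nonneg (by positivity)), dist_eq_norm,
      dist_eq_norm]
    exact hE.lip t x y
  have h3 : Tendsto (fun q : ℝ × Space => E t q.2) (𝓝 (t, x)) (𝓝 (E t x)) :=
    (hc.comp continuous_snd).tendsto (t, x)
  have h2 : ∀ᶠ q : ℝ × Space in 𝓝 (t, x), dist (E t q.2) (E t x) < ε / 2 :=
    Metric.tendsto_nhds.1 h3 (ε / 2) (by positivity)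
  filter_upwards [h1, h2] with q hq1 hq2
  have hq3 : dist (E q.1 q.2) (E t q.2) ≤ ε / 2 := by
    rw [dist_eq_norm]; exact hq1 q.2
  have hq4 := dist_triangle (E q.1 q.2) (E t q.2) (E t x)
  change dist (E q.1 q.2) (E t x) < ε
  linarith

lemma rpow_neg_le_one {r p : ℝ} (hr : 0 ≤ r) (hp : 0 ≤ p) : (1 + r) ^ (-p) ≤ 1 :=
  Real.rpow_le_one_of_one_le_of_nonpos (by linarith) (by linarith)

lemma one_add_mul_rpow {r : ℝ} (hr : 0 ≤ r) (p : ℝ) :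
    (1 + r) * (1 + r) ^ (-(p + 1)) = (1 + r) ^ (-p) := by
  nth_rw 1 [← Real.rpow_one (1 + r)]
  rw [← Real.rpow_add (by linarith)]
  congr 1; ring

/-- Twisting multiplies the force by at most `1 + |t|`, and differences of its argument by another
`1 + |t|`. Boundedness thus uses one power of decay and the Lipschitz bound two; the exponents `1 +
α` and `2 + α` leave `α` to spare. -/
lemma ForceField.bddLipField (hE : ForceField α κ E) (hα : 0 < α) :
    BddLipField (twisted E) κ.toNNReal := by
  have hκ := hE.kappa_nonneg
  have key : ∀ t : ℝ, max |t| 1 ≤ 1 + |t| := fun t =>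
    max_le (by linarith) (by linarith [abs_nonneg t])
  refine ⟨fun W => ?_, fun t => ?_, fun t W => ?_⟩
  · have h := hE.continuous
    have h1 : Continuous fun t : ℝ => E t (W.1 + t • W.2) :=
      h.comp (continuous_id.prodMk (by fun_prop))
    unfold twisted
    fun_prop
  · refine LipschitzWith.of_dist_le_mul fun W W' => ?_
    rw [Real.coe_toNNReal _ hκ, dist_eq_norm, dist_eq_norm]
    have e : twisted E t W - twisted E t W' =
        (-(t • (E t (W.1 + t • W.2) - E t (W'.1 + t • W'.2))),
          E t (W.1 + t • W.2) - E t (W'.1 + t • W'.2)) := by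
      ext1 <;> simp [twisted, smul_sub]
      abel
    set D := E t (W.1 + t • W.2) - E t (W'.1 + t • W'.2)
    have hD : ‖D‖ ≤ κ * (1 + |t|) ^ (-(2 + α)) * ((1 + |t|) * ‖W - W'‖) := by
      refine (hE.lip _ _ _).trans ?_
      have : 0 ≤ κ * (1 + |t|) ^ (-(2 + α)) := by positivity
      gcongr
      have : W.1 + t • W.2 - (W'.1 + t • W'.2) = (W - W').1 + t • (W - W').2 := by
        simp [smul_sub]; abel
      rw [this]
      refine (norm_add_le _ _).trans ?_
      rw [norm_smul, Real.norm_eq_abs]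
      have h1 := norm_fst_le (W - W')
      have h2 := norm_snd_le (W - W')
      have := mul_le_mul_of_nonneg_left h2 (abs_nonneg t)
      linarith
    rw [e, Prod.norm_def]
    simp only [norm_neg, norm_smul, Real.norm_eq_abs]
    have h0 := abs_nonneg t
    calc max (|t| * ‖D‖) ‖D‖ ≤ (1 + |t|) * ‖D‖ := by
          refine max_le ?_ ?_ <;> nlinarith [norm_nonneg D]
      _ ≤ (1 + |t|) * (κ * (1 + |t|) ^ (-(2 + α)) * ((1 + |t|) * ‖W - W'‖)) := by gcongr
      _ = κ * ((1 + |t|) * ((1 + |t|) * (1 + |t|) ^ (-((α + 1) + 1)))) * ‖W - W'‖ := by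
          rw [show (-(2 + α)) = -((α + 1) + 1) by ring]; ring
      _ ≤ κ * 1 * ‖W - W'‖ := by
          rw [one_add_mul_rpow h0, one_add_mul_rpow h0]
          gcongr
          exact rpow_neg_le_one h0 hα.le
      _ = _ := by ring
  · rw [Real.coe_toNNReal _ hκ, twisted, Prod.norm_def]
    simp only [norm_neg, norm_smul, Real.norm_eq_abs]
    have h0 := abs_nonneg t
    set D := E t (W.1 + t • W.2)
    calc max (|t| * ‖D‖) ‖D‖ ≤ (1 + |t|) * ‖D‖ := by
          refine max_le ?_ ?_ <;> nlinarith [norm_nonneg D]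
      _ ≤ (1 + |t|) * (κ * (1 + |t|) ^ (-(1 + α))) := by gcongr; exact hE.bound _ _
      _ = κ * ((1 + |t|) * (1 + |t|) ^ (-(α + 1))) := by
          rw [show (-(1 + α)) = -(α + 1) by ring]; ring
      _ ≤ κ * 1 := by
          rw [one_add_mul_rpow h0]
          gcongr
          exact rpow_neg_le_one h0 hα.le
      _ = κ := mul_one κ

end

/-! ### Conservation of volume -/

section Liouville

lemma BddLipField.continuous_uncurry {G : Type*} [NormedAddCommGroup G] {c : ℝ → G → G} {L : ℝ≥0} (hc : BddLipField c L) :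
    Continuous fun q : ℝ × G => c q.1 q.2 := by
  have := continuous_prod_of_continuous_lipschitzWith (fun q : G × ℝ => c q.2 q.1) L
    (fun x => hc.cont x) (fun t => hc.lip t)
  exact this.comp continuous_swap

variable {G : Type*} [NormedAddCommGroup G] [NormedSpace ℝ G]

/-- One explicit Euler step: the error is quadratic in the step, apart from the oscillation `δ` in
time of the field at the fixed point `W`. -/
lemma BddLipField.norm_evol_sub_euler_le [CompleteSpace G] {c : ℝ → G → G} {L : ℝ≥0}
    (hc : BddLipField c L) {t t' δ : ℝ} (htt' : t ≤ t') {W : G}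
    (h : ∀ s ∈ Icc t t', ‖c s W - c t W‖ ≤ δ) :
    ‖evol c t t' W - (W + (t' - t) • c t W)‖ ≤ (L * (L * (t' - t)) + δ) * (t' - t) := by
  have hd : ∀ s ∈ Icc t t', HasDerivWithinAt (fun s => evol c t s W - (s - t) • c t W)
      (c s (evol c t s W) - c t W) (Icc t t') s := by
    intro s _
    have h1 := (hc.hasDerivAt_evol t s W).hasDerivWithinAt (s := Icc t t')
    have h2 : HasDerivWithinAt (fun s => (s - t) • c t W) ((1 : ℝ) • c t W) (Icc t t') s :=
      (((hasDerivAt_id s).sub_const t).smul_const (c t W)).hasDerivWithinAt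
    have h3 := h1.sub h2
    rw [one_smul] at h3
    exact h3
  have hb : ∀ s ∈ Icc t t', ‖c s (evol c t s W) - c t W‖ ≤ L * (L * (t' - t)) + δ := by
    intro s hs
    have e : c s (evol c t s W) - c t W = (c s (evol c t s W) - c s W) + (c s W - c t W) := by abel
    rw [e]
    refine (norm_add_le _ _).trans (add_le_add ?_ (h s hs))
    rw [← dist_eq_norm]
    refine ((hc.lip s).dist_le_mul _ _).trans ?_
    gcongr
    refine (hc.dist_evol_self_le t s W).trans ?_
    rw [abs_of_nonneg (sub_nonneg.2 hs.1)]
    gcongr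
    exact hs.2
  have := Convex.norm_image_sub_le_of_norm_hasDerivWithin_le hd hb (convex_Icc t t')
    (left_mem_Icc.2 htt') (right_mem_Icc.2 htt')
  rw [Real.norm_of_nonneg (sub_nonneg.2 htt')] at this
  convert! this using 2
  simp [hc.evol_self]
  abel

variable [FiniteDimensional ℝ G] [MeasureSpace G] [BorelSpace G]

/-- The indicator of a bounded open set is the increasing limit of the Lipschitz functions `min 1 (n
· dist(W, Uᶜ))`, and bounded open sets determine the measure. -/
lemma measure_eq_of_integral_lipschitz_eq [Nontrivial G] {μ ν : Measure G}
    [IsFiniteMeasureOnCompacts μ] [IsFiniteMeasureOnCompacts ν]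
    (h : ∀ (ψ : G → ℝ) (L : ℝ≥0) (R : ℝ), LipschitzWith L ψ → (∀ W, R < ‖W‖ → ψ W = 0) →
      ∫ W, ψ W ∂μ = ∫ W, ψ W ∂ν) : μ = ν := by
  refine Measure.OuterRegular.ext_isOpen_isBounded fun U hU hUb => ?_
  -- `infDist` to the empty set is `0`, so the cutoffs would degenerate without a point outside `U`.
  have hne : (Uᶜ).Nonempty := by
    rw [nonempty_compl]
    rintro rfl
    exact NormedSpace.unbounded_univ ℝ G hUb
  obtain ⟨R, hR⟩ := hUb.exists_norm_le
  set g : ℕ → G → ℝ := fun n W => min 1 (n * Metric.infDist W Uᶜ) with hg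
  have hg0 : ∀ n W, 0 ≤ g n W := fun n W =>
    le_min zero_le_one (mul_nonneg n.cast_nonneg Metric.infDist_nonneg)
  have hgz : ∀ n W, W ∉ U → g n W = 0 := fun n W hW => by
    simp [hg, Metric.infDist_zero_of_mem (show W ∈ Uᶜ from hW)]
  have hgR : ∀ n W, R < ‖W‖ → g n W = 0 := fun n W hW =>
    hgz n W fun hWU => absurd (hR W hWU) (not_le.2 hW)
  have hgL : ∀ n : ℕ, LipschitzWith n (g n) := by
    intro n
    have h1 : LipschitzWith ((n : ℝ≥0) * 1) fun W => (n : ℝ) * Metric.infDist W Uᶜ := by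
      refine LipschitzWith.of_dist_le_mul fun x y => ?_
      have := (Metric.lipschitz_infDist_pt (Uᶜ)).dist_le_mul x y
      rw [Real.dist_eq] at this ⊢
      rw [← mul_sub, abs_mul, abs_of_nonneg (n.cast_nonneg)]
      push_cast at this ⊢
      rw [one_mul] at this
      rw [mul_one]
      gcongr
    rw [mul_one] at h1
    exact h1.const_min 1
  have key : ∀ (μ : Measure G) [IsFiniteMeasureOnCompacts μ],
      Tendsto (fun n => ENNReal.ofReal (∫ W, g n W ∂μ)) atTop (𝓝 (μ U)) := by
    intro μ _
    have e : ∀ n, ENNReal.ofReal (∫ W, g n W ∂μ) = ∫⁻ W, ENNReal.ofReal (g n W) ∂μ := by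
      intro n
      refine ofReal_integral_eq_lintegral_ofReal ?_ (Eventually.of_forall (hg0 n))
      exact (hgL n).continuous.integrable_of_hasCompactSupport
        (HasCompactSupport.intro (isCompact_closedBall 0 R) fun W hW => hgR n W (by simpa using hW))
    simp only [e]
    rw [← lintegral_indicator_one hU.measurableSet]
    refine lintegral_tendsto_of_tendsto_of_monotone
      (fun n => (hgL n).continuous.measurable.ennreal_ofReal.aemeasurable)
      (Eventually.of_forall fun W n m hnm => ?_) (Eventually.of_forall fun W => ?_)
    · refine ENNReal.ofReal_le_ofReal (min_le_min le_rfl ?_)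
      have : (n : ℝ) ≤ m := by exact_mod_cast hnm
      have := Metric.infDist_nonneg (x := W) (s := Uᶜ)
      gcongr
    · by_cases hW : W ∈ U
      · rw [indicator_of_mem hW]
        have hpos : 0 < Metric.infDist W Uᶜ :=
          (hU.isClosed_compl.notMem_iff_infDist_pos hne).1 (by simpa using hW)
        obtain ⟨N, hN⟩ := exists_nat_ge (1 / Metric.infDist W Uᶜ)
        refine tendsto_const_nhds.congr' ?_
        filter_upwards [eventually_ge_atTop N] with n hn
        have hn' : (N : ℝ) ≤ n := by exact_mod_cast hn
        have : 1 ≤ n * Metric.infDist W Uᶜ := by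
          rw [← div_le_iff₀ hpos]; linarith
        simp [hg, this]
      · rw [indicator_of_notMem hW]
        simp [hgz _ W hW]
  refine tendsto_nhds_unique (key μ) ?_
  simp only [fun n => h (g n) n R (hgL n) (hgR n)]
  exact key ν

variable [(volume : Measure G).IsAddHaarMeasure]

/-- The function `t ↦ ∫ ψ ∘ evol c t b` has right derivative zero: on a short interval the flow may
be replaced by an Euler step, which leaves the integral unchanged, with error `o(t' - t)`. Only the
Lipschitz dependence of the flow on its starting point enters, never a spatial derivative. -/
lemma BddLipField.integral_comp_evol [CompleteSpace G] {c : ℝ → G → G} {L : ℝ≥0}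
    (hc : BddLipField c L)
    (hmp : ∀ t h : ℝ, MeasurePreserving (fun W => W + h • c t W) (volume : Measure G) volume)
    {ψ : G → ℝ} {Lψ : ℝ≥0} (hψ : LipschitzWith Lψ ψ) {R : ℝ} (hR : ∀ W, R < ‖W‖ → ψ W = 0)
    {a b : ℝ} (hab : a ≤ b) : ∫ W, ψ (evol c a b W) = ∫ W, ψ W := by
  set F : ℝ → ℝ := fun t => ∫ W, ψ (evol c t b W) with hF
  -- One `L (b - a)` accounts for the flow and one for the Euler step, so both integrands vanish
  -- outside this ball.
  set R' := R + 2 * (L * (b - a)) with hR'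
  set C := Lψ * Real.exp (L * (b - a)) * (volume : Measure G).real (Metric.closedBall 0 R')
  have hLba : 0 ≤ L * (b - a) := mul_nonneg L.2 (sub_nonneg.2 hab)
  have hχz : ∀ t ∈ Icc a b, ∀ W, R + L * (b - a) < ‖W‖ → ψ (evol c t b W) = 0 := by
    intro t ht W hW
    refine hR _ ?_
    have h1 := hc.dist_evol_self_le t b W
    rw [abs_of_nonneg (sub_nonneg.2 ht.2), dist_comm, dist_eq_norm] at h1
    have h2 := norm_sub_norm_le W (evol c t b W)
    have h3 : L * (b - t) ≤ L * (b - a) := by have := ht.1; gcongr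
    linarith
  have hχc : ∀ t ∈ Icc a b, Continuous fun W => ψ (evol c t b W) := fun t ht =>
    hψ.continuous.comp (hc.continuous_evol ht.2)
  have hχs : ∀ t ∈ Icc a b, HasCompactSupport fun W => ψ (evol c t b W) := fun t ht =>
    HasCompactSupport.intro (isCompact_closedBall 0 (R + L * (b - a))) fun W hW =>
      hχz t ht W (by simpa using hW)
  have hest : ∀ t ∈ Icc a b, ∀ t' ∈ Icc a b, t ≤ t' → ∀ δ, 
      (∀ W, ‖W‖ ≤ R' → ‖evol c t t' W - (W + (t' - t) • c t W)‖ ≤ δ) →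
      ‖F t' - F t‖ ≤ C * δ := by
    intro t ht t' ht' htt' δ hδ
    set χ : G → ℝ := fun W => ψ (evol c t' b W) with hχ
    have hS := hmp t (t' - t)
    have hScont : Continuous fun W => W + (t' - t) • c t W := by
      have := (hc.lip t).continuous; fun_prop
    have hLtt : L * (t' - t) ≤ L * (b - a) := by
      have := ht.1; have := ht'.2; gcongr
    have e1 : F t' = ∫ W, χ (W + (t' - t) • c t W) := by
      rw [hF]
      have h1 := integral_map (μ := (volume : Measure G)) (f := χ) hS.measurable.aemeasurable
        (hχc t' ht').aestronglyMeasurable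
      rw [hS.map_eq] at h1
      exact h1
    have e2 : F t = ∫ W, χ (evol c t t' W) := by
      rw [hF, hχ]
      simp only [hc.evol_evol]
    have z1 : ∀ W, R' < ‖W‖ → χ (W + (t' - t) • c t W) = 0 := by
      intro W hW
      refine hχz t' ht' _ ?_
      have h1 : ‖(t' - t) • c t W‖ ≤ L * (b - a) := by
        rw [norm_smul, Real.norm_of_nonneg (sub_nonneg.2 htt'), mul_comm]
        exact (mul_le_mul_of_nonneg_right (hc.bdd t W) (sub_nonneg.2 htt')).trans hLtt
      have h2 := norm_sub_le (W + (t' - t) • c t W) ((t' - t) • c t W)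
      rw [add_sub_cancel_right] at h2
      linarith
    have z2 : ∀ W, R' < ‖W‖ → χ (evol c t t' W) = 0 := by
      intro W hW
      rw [hχ]
      simp only [hc.evol_evol]
      exact hχz t ht W (by linarith)
    have i1 : Integrable fun W => χ (W + (t' - t) • c t W) :=
      ((hχc t' ht').comp hScont).integrable_of_hasCompactSupport
        (HasCompactSupport.intro (isCompact_closedBall 0 R') fun W hW => z1 W (by simpa using hW))
    have i2 : Integrable fun W => χ (evol c t t' W) :=
      ((hχc t' ht').comp (hc.continuous_evol htt')).integrable_of_hasCompactSupport
        (HasCompactSupport.intro (isCompact_closedBall 0 R') fun W hW => z2 W (by simpa using hW))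
    rw [e1, e2, ← integral_sub i1 i2,
      ← setIntegral_eq_integral_of_forall_compl_eq_zero (s := Metric.closedBall 0 R')
        (fun W hW => by
          have hW' : R' < ‖W‖ := by simpa using hW
          rw [z1 W hW', z2 W hW', sub_zero])]
    refine (norm_setIntegral_le_of_norm_le_const (C := Lψ * Real.exp (L * (b - a)) * δ)
      (isCompact_closedBall _ _).measure_lt_top fun W hW => ?_).trans_eq (by ring)
    rw [← dist_eq_norm, dist_comm]
    calc dist (χ (evol c t t' W)) (χ (W + (t' - t) • c t W))
        ≤ Lψ * (Real.exp (L * (b - t')) * dist (evol c t t' W) (W + (t' - t) • c t W)) := by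
          refine (hψ.dist_le_mul _ _).trans ?_
          gcongr
          exact hc.dist_evol_le ht'.2 _ _
      _ ≤ Lψ * (Real.exp (L * (b - a)) * δ) := by
          rw [dist_eq_norm]
          have := hδ W (by simpa using hW)
          have := ht'.1
          gcongr
      _ = _ := by ring
  -- The crude bound `2 L` on the oscillation in time yields only Lipschitz continuity of `F`, which
  -- is needed alongside the vanishing right derivative.
  have hcoarse : ∀ t ∈ Icc a b, ∀ t' ∈ Icc a b, t ≤ t' →
      ‖F t' - F t‖ ≤ C * (L * (b - a) * L + 2 * L) * (t' - t) := by
    intro t ht t' ht' htt'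
    refine (hest t ht t' ht' htt' ((L * (L * (t' - t)) + 2 * L) * (t' - t)) fun W _ =>
      hc.norm_evol_sub_euler_le htt' fun s _ => ?_).trans ?_
    · exact (norm_sub_le _ _).trans (by linarith [hc.bdd s W, hc.bdd t W])
    · have hC : 0 ≤ C := by positivity
      have h1 : L * (t' - t) ≤ L * (b - a) := by have := ht.1; have := ht'.2; gcongr
      have h2 := mul_le_mul_of_nonneg_left h1 (NNReal.coe_nonneg L)
      have h3 : L * (L * (t' - t)) + 2 * L ≤ L * (b - a) * L + 2 * L := by linarith
      have h4 := mul_le_mul_of_nonneg_left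
        (mul_le_mul_of_nonneg_right h3 (sub_nonneg.2 htt')) hC
      linarith
  have hFc : ContinuousOn F (Icc a b) := by
    set M := C * (L * (b - a) * L + 2 * L)
    have hM : 0 ≤ M := by positivity
    refine LipschitzOnWith.continuousOn (K := M.toNNReal) ?_
    refine LipschitzOnWith.of_dist_le_mul fun t ht t' ht' => ?_
    rw [Real.coe_toNNReal _ hM]
    rcases le_total t t' with h | h
    · have := hcoarse t ht t' ht' h
      rwa [dist_comm, dist_comm t, dist_eq_norm, Real.dist_eq, abs_of_nonneg (sub_nonneg.2 h)]
    · have := hcoarse t' ht' t ht h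
      rwa [dist_eq_norm, Real.dist_eq, abs_of_nonneg (sub_nonneg.2 h)]
  have hFd : ∀ t ∈ Ico a b, HasDerivWithinAt F 0 (Ici t) t := by
    intro t ht
    rw [hasDerivWithinAt_iff_isLittleO, Asymptotics.isLittleO_iff]
    intro ε hε
    have hC : 0 ≤ C := by positivity
    obtain ⟨ε', hε', hεC⟩ : ∃ ε' > 0, C * (2 * ε') ≤ ε := by
      refine ⟨ε / (2 * (C + 1)), by positivity, ?_⟩
      have : C * (2 * (ε / (2 * (C + 1)))) = ε * (C / (C + 1)) := by field_simp
      rw [this]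
      exact mul_le_of_le_one_right hε.le ((div_le_one (by positivity)).2 (by linarith))
    -- Joint continuity on a compact ball makes the oscillation in time uniformly small, improving
    -- `O(t' - t)` to `o(t' - t)`.
    have hunif : ∀ᶠ s in 𝓝 t, ∀ W ∈ Metric.closedBall (0 : G) R', ‖c s W - c t W‖ ≤ ε' := by
      refine (isCompact_closedBall (0 : G) R').eventually_forall_of_forall_eventually fun W _ => ?_
      have hcont : Continuous fun q : ℝ × G => ‖c q.1 q.2 - c t q.2‖ :=
        (hc.continuous_uncurry.sub ((hc.lip t).continuous.comp continuous_snd)).norm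
      have := hcont.tendsto (t, W)
      simp only [sub_self, norm_zero] at this
      exact (this.eventually (gt_mem_nhds hε')).mono fun _ h => le_of_lt h
    obtain ⟨r, hr, hrt⟩ := Metric.eventually_nhds_iff.1 hunif
    have h1 : ∀ᶠ t' in 𝓝[≥] t, t' < b := mem_nhdsWithin_of_mem_nhds (Iio_mem_nhds ht.2)
    have h2 : ∀ᶠ t' in 𝓝[≥] t, dist t' t < r :=
      mem_nhdsWithin_of_mem_nhds (Metric.ball_mem_nhds t hr)
    have h3 : ∀ᶠ t' in 𝓝[≥] t, (L : ℝ) * (L * (t' - t)) ≤ ε' := by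
      have hcont : Continuous fun t' : ℝ => (L : ℝ) * (L * (t' - t)) := by fun_prop
      have := hcont.tendsto t
      simp only [sub_self, mul_zero] at this
      exact ((this.eventually (gt_mem_nhds hε')).mono fun _ h => le_of_lt h).filter_mono
        nhdsWithin_le_nhds
    filter_upwards [h1, h2, h3, self_mem_nhdsWithin] with t' ht1 ht2 ht3 ht4
    have ht4' : t ≤ t' := ht4
    simp only [smul_zero, sub_zero]
    refine (hest t ⟨ht.1, ht.2.le⟩ t' ⟨ht.1.trans ht4', ht1.le⟩ ht4' (2 * ε' * (t' - t))
      fun W hW => ?_).trans ?_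
    · refine (hc.norm_evol_sub_euler_le ht4' (δ := ε') fun s hs => ?_).trans ?_
      · refine hrt ?_ W (by simpa using hW)
        rw [Real.dist_eq, abs_of_nonneg (sub_nonneg.2 hs.1)]
        rw [Real.dist_eq, abs_of_nonneg (sub_nonneg.2 ht4')] at ht2
        linarith [hs.2]
      · have := sub_nonneg.2 ht4'
        gcongr
        linarith
    · rw [Real.norm_of_nonneg (sub_nonneg.2 ht4'), ← mul_assoc]
      have := sub_nonneg.2 ht4'
      gcongr
  have := constant_of_has_deriv_right_zero hFc hFd b (right_mem_Icc.2 hab)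
  rw [hF] at this
  simp only [hc.evol_self] at this
  exact this.symm

/-- **Liouville's theorem** for a bounded Lipschitz field whose explicit Euler steps preserve the
volume. -/
theorem BddLipField.measurePreserving_evol [CompleteSpace G] [Nontrivial G] {c : ℝ → G → G}
    {L : ℝ≥0} (hc : BddLipField c L)
    (hmp : ∀ t h : ℝ, MeasurePreserving (fun W => W + h • c t W) (volume : Measure G) volume)
    {a b : ℝ} (hab : a ≤ b) : MeasurePreserving (evol c a b) (volume : Measure G) volume := by
  have hm := (hc.continuous_evol hab).measurable
  refine ⟨hm, ?_⟩
  have : IsFiniteMeasureOnCompacts (Measure.map (evol c a b) (volume : Measure G)) := by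
    refine ⟨fun K hK => ?_⟩
    obtain ⟨R, hR⟩ := hK.isBounded.exists_norm_le
    rw [Measure.map_apply hm hK.measurableSet]
    refine lt_of_le_of_lt (measure_mono (t := Metric.closedBall 0 (R + L * (b - a)))
      fun W hW => ?_) (isCompact_closedBall _ _).measure_lt_top
    have h1 := hc.dist_evol_self_le a b W
    rw [abs_of_nonneg (sub_nonneg.2 hab), dist_comm, dist_eq_norm] at h1
    have h2 := norm_sub_norm_le W (evol c a b W)
    have h3 := hR _ hW
    simp only [mem_closedBall_zero_iff]
    linarith
  refine measure_eq_of_integral_lipschitz_eq fun ψ Lψ R hψ hR => ?_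
  rw [integral_map hm.aemeasurable hψ.continuous.aestronglyMeasurable]
  exact hc.integral_comp_evol hmp hψ hR hab

end Liouville

/-! ### Shears -/

lemma measurePreserving_shear_left {a : Space → Space} (ha : Measurable a) :
    MeasurePreserving (fun z : Phase => (z.1 + a z.2, z.2)) volume volume := by
  have h := (MeasurePreserving.id (volume : Measure Space)).skew_product
    (g := fun v x => x + a v) (μc := volume) (μd := volume) (by fun_prop)
    (Eventually.of_forall fun v => (measurePreserving_add_right volume (a v)).map_eq)
  have hs : MeasurePreserving (Prod.swap : Phase → Phase) volume volume :=
    Measure.measurePreserving_swap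
  exact (hs.comp (MeasurePreserving.comp h hs))

lemma measurePreserving_shear_right {a : Space → Space} (ha : Measurable a) :
    MeasurePreserving (fun z : Phase => (z.1, z.2 + a z.1)) volume volume :=
  (MeasurePreserving.id (volume : Measure Space)).skew_product
    (g := fun x v => v + a x) (μc := volume) (μd := volume) (by fun_prop)
    (Eventually.of_forall fun x => (measurePreserving_add_right volume (a x)).map_eq)

/-- The Euler step is the kick `v ↦ v + h E(x)` conjugated by the free transport `x ↦ x + t v`,
hence a composition of three shears. -/
lemma ForceField.measurePreserving_euler {α κ : ℝ} {E : ℝ → Space → Space}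
    (hE : ForceField α κ E) (t h : ℝ) :
    MeasurePreserving (fun W => W + h • twisted E t W) (volume : Measure Phase) volume := by
  have hm : Measurable (E t) :=
    (hE.continuous.comp (continuous_const.prodMk continuous_id)).measurable
  have h1 := measurePreserving_shear_left (a := fun v => t • v) (by fun_prop)
  have h2 := measurePreserving_shear_right (a := fun x => h • E t x) (by fun_prop)
  have h3 := measurePreserving_shear_left (a := fun v => -(t • v)) (by fun_prop)
  convert! h3.comp (h2.comp h1) using 1
  ext1 W
  ext1
  · simp [twisted, smul_smul, mul_comm]
    abel
  · simp [twisted]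

lemma ForceField.measurePreserving_evol {α κ : ℝ} {E : ℝ → Space → Space}
    (hE : ForceField α κ E) (hα : 0 < α) {T : ℝ} (hT : 0 ≤ T) :
    MeasurePreserving (evol (twisted E) 0 T) (volume : Measure Phase) volume := by
  have : (volume : Measure Phase).IsAddHaarMeasure :=
    inferInstanceAs (Measure.IsAddHaarMeasure ((volume : Measure Space).prod volume))
  exact (hE.bddLipField hα).measurePreserving_evol hE.measurePreserving_euler hT

section

open scoped Convolution

/-! ### Solutions are constant along characteristics -/

/-- The characteristic field `(x, v) ↦ (v, E(t, x))`. -/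
def charField (E : ℝ → Space → Space) (t : ℝ) (z : Phase) : Phase := (z.2, E t z.1)

instance : (volume : Measure Phase).IsAddHaarMeasure :=
  inferInstanceAs (Measure.IsAddHaarMeasure ((volume : Measure Space).prod volume))


instance : (volume : Measure Phase).IsNegInvariant :=
  Measure.IsAddHaarMeasure.isNegInvariant_of_regular _

/-! ### Divergence-free fields against a mollifier -/

section

variable {η : Phase → ℝ}

lemma integral_fderiv_eq_zero {ψ : Space → ℝ} (hψ : ContDiff ℝ ∞ ψ) (hc : HasCompactSupport ψ)
    (w : Space) : ∫ x, fderiv ℝ ψ x w = 0 := by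
  have hi : Integrable fun x => fderiv ℝ ψ x w :=
    ((hψ.continuous_fderiv (by simp)).clm_apply continuous_const).integrable_of_hasCompactSupport
      (hc.fderiv_apply ℝ w)
  have := integral_mul_fderiv_eq_neg_fderiv_mul_of_integrable (μ := (volume : Measure Space))
    (f := fun _ : Space => (1 : ℝ)) (g := ψ) (v := w) (by simp) (by simpa using hi)
    (by simpa using hψ.continuous.integrable_of_hasCompactSupport hc)
    (fun x _ => differentiableAt_const _)
    (fun x _ => (hψ.differentiable (by simp)).differentiableAt)
  simpa using this

/-- For fixed `v` the direction `g v` is constant in `x`, so the inner integral is that of a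
derivative of a compactly supported function. No regularity of `g` beyond continuity is needed. -/
lemma integral_fderiv_fst_eq_zero (hη : ContDiff ℝ ∞ η) (hc : HasCompactSupport η)
    {g : Space → Space} (hg : Continuous g) :
    ∫ y : Phase, fderiv ℝ η y (g y.2, 0) = 0 := by
  have hi : Integrable fun y : Phase => fderiv ℝ η y (g y.2, 0) :=
    ((hη.continuous_fderiv (by simp)).clm_apply
      (by fun_prop)).integrable_of_hasCompactSupport
      ((hc.fderiv ℝ).mono fun y hy => by
        contrapose! hy
        simp only [Function.mem_support, not_not] at hy ⊢
        simp [hy])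
  rw [Measure.volume_eq_prod] at hi ⊢
  rw [integral_prod_symm _ hi]
  refine integral_eq_zero_of_ae (Eventually.of_forall fun v => ?_)
  have hψ : ContDiff ℝ ∞ fun x : Space => η (x, v) := hη.comp (by fun_prop)
  have hψc : HasCompactSupport fun x : Space => η (x, v) := by
    obtain ⟨R, hR⟩ := hc.isCompact.isBounded.exists_norm_le
    refine HasCompactSupport.intro (isCompact_closedBall 0 R) fun x hx => ?_
    by_contra h
    have h1 := hR _ (subset_tsupport η h)
    exact hx (by simpa using (norm_fst_le _).trans h1)
  have h1 := integral_fderiv_eq_zero hψ hψc (g v)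
  convert! h1 using 3 with x
  have h2 := HasFDerivAt.comp (g := η) (f := fun x : Space => (x, v)) x
    ((hη.differentiable (by simp)) (x, v)).hasFDerivAt
    ((hasFDerivAt_id x).prodMk (hasFDerivAt_const v x))
  have h3 : HasFDerivAt (fun x : Space => η (x, v)) _ x := h2
  rw [h3.fderiv]
  simp

lemma integral_fderiv_snd_eq_zero (hη : ContDiff ℝ ∞ η) (hc : HasCompactSupport η)
    {g : Space → Space} (hg : Continuous g) :
    ∫ y : Phase, fderiv ℝ η y (0, g y.1) = 0 := by
  have hi : Integrable fun y : Phase => fderiv ℝ η y (0, g y.1) :=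
    ((hη.continuous_fderiv (by simp)).clm_apply
      (by fun_prop)).integrable_of_hasCompactSupport
      ((hc.fderiv ℝ).mono fun y hy => by
        contrapose! hy
        simp only [Function.mem_support, not_not] at hy ⊢
        simp [hy])
  rw [Measure.volume_eq_prod] at hi ⊢
  rw [integral_prod _ hi]
  refine integral_eq_zero_of_ae (Eventually.of_forall fun x => ?_)
  have hψ : ContDiff ℝ ∞ fun v : Space => η (x, v) := hη.comp (by fun_prop)
  have hψc : HasCompactSupport fun v : Space => η (x, v) := by
    obtain ⟨R, hR⟩ := hc.isCompact.isBounded.exists_norm_le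
    refine HasCompactSupport.intro (isCompact_closedBall 0 R) fun v hv => ?_
    by_contra h
    have h1 := hR _ (subset_tsupport η h)
    exact hv (by simpa using (norm_snd_le _).trans h1)
  have h1 := integral_fderiv_eq_zero hψ hψc (g x)
  convert! h1 using 3 with v
  have h2 := ((hη.differentiable (by simp)) (x, v)).hasFDerivAt.comp v
    ((hasFDerivAt_const x v).prodMk (hasFDerivAt_id v))
  have h3 : HasFDerivAt (fun v : Space => η (x, v)) _ v := h2
  rw [h3.fderiv]
  simp

end

/-- A jointly continuous weak solution of the transport equation with force field `E`. -/
structure TransportSolution (E : ℝ → Space → Space) (F : ℝ → Phase → ℝ) : Prop where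
  cont : Continuous fun q : ℝ × Phase => F q.1 q.2
  weak : ∀ φ : Phase → ℝ, ContDiff ℝ ∞ φ → HasCompactSupport φ → ∀ t, 0 ≤ t →
    ∫ z, F t z * φ z = (∫ z, F 0 z * φ z) +
      ∫ s in (0 : ℝ)..t, ∫ z, F s z * fderiv ℝ φ z (charField E s z)

/-! ### The mollified solution and its derivative along a characteristic -/

section Transport

variable {E : ℝ → Space → Space} {F : ℝ → Phase → ℝ} {η : Phase → ℝ}

/-- The mollification of `F(t)` at the point `Z`. -/
def mollified (F : ℝ → Phase → ℝ) (η : Phase → ℝ) (t : ℝ) (Z : Phase) : ℝ :=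
  ∫ y, η y * F t (Z - y)

/-- The time derivative of `mollified` for a solution of the transport equation. -/
def mollifiedTime (E : ℝ → Space → Space) (F : ℝ → Phase → ℝ) (η : Phase → ℝ) (t : ℝ)
    (Z : Phase) : ℝ :=
  -∫ y, F t (Z - y) * fderiv ℝ η y (charField E t (Z - y))

/-- The space derivative of `mollified`. -/
def mollifiedSpace (F : ℝ → Phase → ℝ) (η : Phase → ℝ) (t : ℝ) (Z : Phase) : Phase →L[ℝ] ℝ :=
  ∫ y, F t (Z - y) • fderiv ℝ η y

lemma continuous_charField (hE : Continuous fun q : ℝ × Space => E q.1 q.2) :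
    Continuous fun q : ℝ × Phase => charField E q.1 q.2 :=
  (continuous_snd.comp continuous_snd).prodMk
    (hE.comp (continuous_fst.prodMk (continuous_fst.comp continuous_snd)))

lemma continuous_mollifiedTime (hE : Continuous fun q : ℝ × Space => E q.1 q.2)
    (hF : Continuous fun q : ℝ × Phase => F q.1 q.2) (hη : ContDiff ℝ ∞ η)
    (hc : HasCompactSupport η) :
    Continuous fun q : ℝ × Phase => mollifiedTime E F η q.1 q.2 := by
  have hb := continuous_charField hE
  have hd := hη.continuous_fderiv (by simp)
  have h := continuous_parametric_integral_of_continuous (μ := (volume : Measure Phase))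
    (f := fun (q : ℝ × Phase) y => F q.1 (q.2 - y) * fderiv ℝ η y (charField E q.1 (q.2 - y)))
    (by
      refine Continuous.mul (hF.comp (by fun_prop :
        Continuous fun p : (ℝ × Phase) × Phase => (p.1.1, p.1.2 - p.2))) ?_
      exact (hd.comp continuous_snd).clm_apply (hb.comp (by fun_prop :
        Continuous fun p : (ℝ × Phase) × Phase => (p.1.1, p.1.2 - p.2)))) hc.isCompact
  have e : ∀ q : ℝ × Phase, ∫ y in tsupport η,
      F q.1 (q.2 - y) * fderiv ℝ η y (charField E q.1 (q.2 - y)) =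
      ∫ y, F q.1 (q.2 - y) * fderiv ℝ η y (charField E q.1 (q.2 - y)) := fun q =>
    setIntegral_eq_integral_of_forall_compl_eq_zero fun y hy => by
      rw [image_eq_zero_of_notMem_tsupport (f := fderiv ℝ η)
        (fun h => hy (tsupport_fderiv_subset ℝ h))]
      simp
  simp only [e] at h
  exact h.neg

lemma continuous_mollifiedSpace
    (hF : Continuous fun q : ℝ × Phase => F q.1 q.2) (hη : ContDiff ℝ ∞ η)
    (hc : HasCompactSupport η) :
    Continuous fun q : ℝ × Phase => mollifiedSpace F η q.1 q.2 := by
  have hd := hη.continuous_fderiv (by simp)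
  have h := continuous_parametric_integral_of_continuous (μ := (volume : Measure Phase))
    (f := fun (q : ℝ × Phase) y => F q.1 (q.2 - y) • fderiv ℝ η y)
    (by
      refine Continuous.smul (hF.comp (by fun_prop :
        Continuous fun p : (ℝ × Phase) × Phase => (p.1.1, p.1.2 - p.2))) ?_
      exact hd.comp continuous_snd) hc.isCompact
  have e : ∀ q : ℝ × Phase, ∫ y in tsupport η, F q.1 (q.2 - y) • fderiv ℝ η y =
      ∫ y, F q.1 (q.2 - y) • fderiv ℝ η y := fun q =>
    setIntegral_eq_integral_of_forall_compl_eq_zero fun y hy => by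
      rw [image_eq_zero_of_notMem_tsupport (f := fderiv ℝ η)
        (fun h => hy (tsupport_fderiv_subset ℝ h))]
      simp
  simp only [e] at h
  exact h

lemma hasFDerivAt_mollified (hF : Continuous fun q : ℝ × Phase => F q.1 q.2)
    (hη : ContDiff ℝ ∞ η) (hc : HasCompactSupport η) (t : ℝ) (Z : Phase) :
    HasFDerivAt (mollified F η t) (mollifiedSpace F η t Z) Z := by
  have hFt : LocallyIntegrable (F t) :=
    (hF.comp (continuous_const.prodMk continuous_id)).locallyIntegrable
  have h := hc.hasFDerivAt_convolution_left (μ := (volume : Measure Phase))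
    (ContinuousLinearMap.lsmul ℝ ℝ) (hη.of_le (by simp)) hFt Z
  convert! h using 1
  rw [mollifiedSpace, convolution_def]
  refine integral_congr_ae (Eventually.of_forall fun y => ?_)
  ext w <;> simp [ContinuousLinearMap.precompL_apply, mul_comm]

/-- The weak formulation tested with `z ↦ η(Z - z)`; the reflection produces the sign in
`mollifiedTime`. -/
lemma TransportSolution.mollified_eq (h : TransportSolution E F) (hη : ContDiff ℝ ∞ η)
    (hc : HasCompactSupport η) {t : ℝ} (ht : 0 ≤ t) (Z : Phase) :
    mollified F η t Z = mollified F η 0 Z + ∫ s in (0 : ℝ)..t, mollifiedTime E F η s Z := by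
  have hφ : ContDiff ℝ ∞ fun z => η (Z - z) := hη.comp (contDiff_const.sub contDiff_id)
  have hφc : HasCompactSupport fun z => η (Z - z) := hc.comp_homeomorph (Homeomorph.subLeft Z)
  have hd : ∀ z w, fderiv ℝ (fun z => η (Z - z)) z w = -fderiv ℝ η (Z - z) w := by
    intro z w
    have h2 := ((hη.differentiable (by simp)) (Z - z)).hasFDerivAt.comp z
      ((hasFDerivAt_const Z z).sub (hasFDerivAt_id z))
    have h3 : HasFDerivAt (fun z => η (Z - z)) _ z := h2
    rw [h3.fderiv]
    simp
  have hw := h.weak _ hφ hφc t ht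
  simp only [hd] at hw
  have e1 : ∀ s, ∫ z, F s z * η (Z - z) = mollified F η s Z := by
    intro s
    rw [mollified, ← integral_sub_left_eq_self _ volume Z]
    simp [mul_comm]
  have e2 : ∀ s, ∫ z, F s z * -fderiv ℝ η (Z - z) (charField E s z) =
      mollifiedTime E F η s Z := by
    intro s
    rw [mollifiedTime, ← integral_neg, ← integral_sub_left_eq_self _ volume Z]
    simp
  simpa only [e1, e2] using hw

/-- Continuous partial derivatives give joint differentiability, so the chain rule applies. The two
transport terms combine into a commutator which sees the field only through its differences over the
support of `η`. For `t > 0` the time derivative is two-sided. -/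
lemma TransportSolution.hasDerivAt_mollified (h : TransportSolution E F)
    (hE : Continuous fun q : ℝ × Space => E q.1 q.2) (hη : ContDiff ℝ ∞ η)
    (hc : HasCompactSupport η) {Z : ℝ → Phase} {t : ℝ} (ht : 0 < t)
    (hZ : HasDerivAt Z (charField E t (Z t)) t) :
    HasDerivAt (fun t => mollified F η t (Z t))
      (∫ y, F t (Z t - y) * fderiv ℝ η y (charField E t (Z t) - charField E t (Z t - y))) t := by
  have hcT := continuous_mollifiedTime hE h.cont hη hc
  have hcS := continuous_mollifiedSpace h.cont hη hc
  have hT : ∀ t, 0 < t → ∀ Z, HasDerivAt (fun t => mollified F η t Z) (mollifiedTime E F η t Z) t := by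
    intro t ht Z
    have hcs : Continuous fun s => mollifiedTime E F η s Z :=
      hcT.comp (continuous_id.prodMk continuous_const)
    have h1 := intervalIntegral.integral_hasDerivAt_right (hcs.intervalIntegrable 0 t)
      (hcs.stronglyMeasurableAtFilter _ _) hcs.continuousAt
    refine (h1.const_add (mollified F η 0 Z)).congr_of_eventuallyEq ?_
    filter_upwards [lt_mem_nhds ht] with s hs
    exact h.mollified_eq hη hc hs.le Z
  have hst := hasStrictFDerivAt_uncurry_coprod (𝕜 := ℝ) (u := (t, Z t)) (f := mollified F η)
    (f₁ := fun t Z => ContinuousLinearMap.toSpanSingleton ℝ (mollifiedTime E F η t Z))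
    (f₂ := mollifiedSpace F η)
    (by
      have : ∀ᶠ v : ℝ × Phase in 𝓝 (t, Z t), 0 < v.1 :=
        (continuous_fst.tendsto (t, Z t)).eventually (lt_mem_nhds ht)
      filter_upwards [this] with v hv
      exact (hT v.1 hv v.2).hasFDerivAt)
    (Eventually.of_forall fun v => hasFDerivAt_mollified h.cont hη hc v.1 v.2)
    (by
      have : Continuous fun q : ℝ × Phase =>
          ContinuousLinearMap.toSpanSingleton ℝ (mollifiedTime E F η q.1 q.2) :=
        (ContinuousLinearMap.toSpanSingletonCLE (𝕜 := ℝ) (E := ℝ)).continuous.comp hcT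
      exact this.continuousAt)
    hcS.continuousAt
  have hcomp := hst.hasFDerivAt.comp_hasDerivAt t ((hasDerivAt_id t).prodMk hZ)
  refine HasDerivAt.congr_deriv (f := fun t => mollified F η t (Z t)) hcomp ?_
  have hb := continuous_charField hE
  have hd := hη.continuous_fderiv (by simp)
  have hFc : Continuous fun y => F t (Z t - y) := h.cont.comp (continuous_const.prodMk (by fun_prop))
  have hbc : Continuous fun y => charField E t (Z t - y) :=
    hb.comp (continuous_const.prodMk (by fun_prop))
  have hsupp : ∀ g : Phase → Phase,
      HasCompactSupport fun y => F t (Z t - y) * fderiv ℝ η y (g y) := fun g =>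
    (hc.fderiv ℝ).mono fun y hy => by
      contrapose! hy
      simp only [Function.mem_support, not_not] at hy ⊢
      simp [hy]
  have i1 : Integrable fun y => F t (Z t - y) * fderiv ℝ η y (charField E t (Z t)) :=
    (hFc.mul (hd.clm_apply continuous_const)).integrable_of_hasCompactSupport (hsupp _)
  have i2 : Integrable fun y => F t (Z t - y) * fderiv ℝ η y (charField E t (Z t - y)) :=
    (hFc.mul (hd.clm_apply hbc)).integrable_of_hasCompactSupport (hsupp _)
  have i3 : Integrable fun y => F t (Z t - y) • fderiv ℝ η y :=
    (hFc.smul hd).integrable_of_hasCompactSupport ((hc.fderiv ℝ).mono fun y hy => by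
      contrapose! hy
      simp only [Function.mem_support, not_not] at hy ⊢
      simp [hy])
  simp only [map_sub, mul_sub]
  rw [integral_sub i1 i2]
  have e : mollifiedSpace F η t (Z t) (charField E t (Z t)) =
      ∫ y, F t (Z t - y) * fderiv ℝ η y (charField E t (Z t)) := by
    rw [mollifiedSpace, ContinuousLinearMap.integral_apply i3]
    simp
  change (1 : ℝ) * mollifiedTime E F η t (Z t) +
    mollifiedSpace F η t (Z t) (charField E t (Z t)) = _
  rw [e, mollifiedTime]
  ring

end Transport

end

section

open scoped Convolution

/-! ### The commutator estimate -/

section Transport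

variable {E : ℝ → Space → Space} {F : ℝ → Phase → ℝ} {η : Phase → ℝ}

/-- The difference of the fields is `(y.2, E(Z.1) - E(Z.1 - y.1))`: each slot depends only on the
other variable, so the field is divergence free. This allows a constant to be subtracted from `F` in
the commutator. -/
lemma integral_fderiv_charField_eq_zero (hE : Continuous fun q : ℝ × Space => E q.1 q.2)
    (hη : ContDiff ℝ ∞ η) (hc : HasCompactSupport η) (t : ℝ) (Z : Phase) :
    ∫ y, fderiv ℝ η y (charField E t Z - charField E t (Z - y)) = 0 := by
  have hd := hη.continuous_fderiv (by simp)
  have hEt : Continuous (E t) := hE.comp (continuous_const.prodMk continuous_id)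
  have hint : ∀ g : Phase → Phase, Continuous g → Integrable fun y => fderiv ℝ η y (g y) :=
    fun g hg => (hd.clm_apply hg).integrable_of_hasCompactSupport ((hc.fderiv ℝ).mono fun y hy => by
      contrapose! hy
      simp only [Function.mem_support, not_not] at hy ⊢
      simp [hy])
  have e : ∀ y : Phase, charField E t Z - charField E t (Z - y) =
      (y.2, (0 : Space)) + ((0 : Space), E t Z.1 - E t (Z.1 - y.1)) := by
    intro y
    ext1 <;> simp [charField]
  simp only [e, map_add]
  rw [integral_add (hint (fun y => (y.2, 0)) (by fun_prop))
    (hint (fun y => (0, E t Z.1 - E t (Z.1 - y.1))) (by fun_prop)),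
    integral_fderiv_fst_eq_zero hη hc (g := fun v => v) continuous_id,
    integral_fderiv_snd_eq_zero hη hc (g := fun x => E t Z.1 - E t (Z.1 - x)) (by fun_prop),
    add_zero]

/-- After `F s (Z s)` is subtracted, the commutator contains an oscillation of size `θ` and a field
difference of size `L ε`, so continuity of `F` is enough. The first term on the right pays for
replacing the mollification by the value of `F` at both endpoints. -/
lemma TransportSolution.mollified_oscillation (h : TransportSolution E F)
    (hE : Continuous fun q : ℝ × Space => E q.1 q.2) (hη : ContDiff ℝ ∞ η)
    (hη0 : ∀ y, 0 ≤ η y) (hc : HasCompactSupport η) {ε : ℝ} (hsupp : ∀ y, ε < ‖y‖ → η y = 0)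
    {L : ℝ} (hL0 : 0 ≤ L) (hL : ∀ s Z Z', ‖charField E s Z - charField E s Z'‖ ≤ L * ‖Z - Z'‖)
    {Z : ℝ → Phase} (hZ : ∀ t, 0 ≤ t → HasDerivWithinAt Z (charField E t (Z t)) (Ici 0) t)
    {a T θ : ℝ} (ha : 0 < a) (haT : a ≤ T) (hθ : 0 ≤ θ)
    (hosc : ∀ s ∈ Icc a T, ∀ y, ‖y‖ ≤ ε → |F s (Z s - y) - F s (Z s)| ≤ θ) :
    (∫ y, η y) * |F T (Z T) - F a (Z a)| ≤
      θ * (2 * ∫ y, η y) + θ * (L * ε * ∫ y, ‖fderiv ℝ η y‖) * (T - a) := by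
  have hd := hη.continuous_fderiv (by simp)
  have hηi : Integrable η := hη.continuous.integrable_of_hasCompactSupport hc
  have hdi : Integrable fun y => ‖fderiv ℝ η y‖ :=
    (hd.integrable_of_hasCompactSupport (hc.fderiv ℝ)).norm
  have hdz : ∀ y, ε < ‖y‖ → fderiv ℝ η y = 0 := by
    intro y hy
    have : η =ᶠ[𝓝 y] fun _ => 0 := by
      filter_upwards [continuous_norm.continuousAt.eventually (lt_mem_nhds hy)] with w hw
      exact hsupp w hw
    rw [this.fderiv_eq]; simp
  have hFc : ∀ s, Continuous (F s) := fun s => h.cont.comp (continuous_const.prodMk continuous_id)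
  have hbc : ∀ s, Continuous (charField E s) := fun s =>
    (continuous_charField hE).comp (continuous_const.prodMk continuous_id)
  have hcs : ∀ g : Phase → Phase, ∀ k : Phase → ℝ,
      HasCompactSupport fun y => k y * fderiv ℝ η y (g y) := fun g k =>
    (hc.fderiv ℝ).mono fun y hy => by
      contrapose! hy
      simp only [Function.mem_support, not_not] at hy ⊢
      simp [hy]
  have hder : ∀ t ∈ Icc a T, HasDerivWithinAt (fun t => mollified F η t (Z t))
      (∫ y, F t (Z t - y) * fderiv ℝ η y (charField E t (Z t) - charField E t (Z t - y)))
      (Icc a T) t := fun t ht =>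
    (h.hasDerivAt_mollified hE hη hc (ha.trans_le ht.1)
      ((hZ t (ha.le.trans ht.1)).hasDerivAt (Ici_mem_nhds (ha.trans_le ht.1)))).hasDerivWithinAt
  have hbd : ∀ t ∈ Icc a T,
      ‖∫ y, F t (Z t - y) * fderiv ℝ η y (charField E t (Z t) - charField E t (Z t - y))‖ ≤
      θ * (L * ε * ∫ y, ‖fderiv ℝ η y‖) := by
    intro t ht
    have e : ∫ y, F t (Z t - y) * fderiv ℝ η y (charField E t (Z t) - charField E t (Z t - y)) =
        ∫ y, (F t (Z t - y) - F t (Z t)) *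
          fderiv ℝ η y (charField E t (Z t) - charField E t (Z t - y)) := by
      have hg : Continuous fun y => charField E t (Z t) - charField E t (Z t - y) := by
        have := hbc t; fun_prop
      simp only [sub_mul]
      rw [integral_sub, integral_const_mul, integral_fderiv_charField_eq_zero hE hη hc, mul_zero,
        sub_zero]
      · exact (((hFc t).comp (by fun_prop)).mul (hd.clm_apply hg)).integrable_of_hasCompactSupport
          (hcs _ fun y => F t (Z t - y))
      · exact (continuous_const.mul (hd.clm_apply hg)).integrable_of_hasCompactSupport
          (hcs _ fun y => F t (Z t))
    rw [e]
    have : θ * (L * ε * ∫ y, ‖fderiv ℝ η y‖) = ∫ y, θ * (L * ε) * ‖fderiv ℝ η y‖ := by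
      rw [integral_const_mul]; ring
    rw [this]
    refine norm_integral_le_of_norm_le (hdi.const_mul _) (Eventually.of_forall fun y => ?_)
    by_cases hy : ε < ‖y‖
    · simp [hdz y hy]
    · rw [not_lt] at hy
      rw [norm_mul]
      have h1 := hosc t ht y hy
      have h2 : ‖fderiv ℝ η y (charField E t (Z t) - charField E t (Z t - y))‖ ≤
          ‖fderiv ℝ η y‖ * (L * ε) := by
        refine (ContinuousLinearMap.le_opNorm _ _).trans ?_
        gcongr
        refine (hL _ _ _).trans ?_
        gcongr
        simpa using hy
      calc _ ≤ θ * (‖fderiv ℝ η y‖ * (L * ε)) := by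
            rw [Real.norm_eq_abs]
            exact mul_le_mul h1 h2 (norm_nonneg _) hθ
        _ = _ := by ring
  have hmain := Convex.norm_image_sub_le_of_norm_hasDerivWithin_le hder hbd (convex_Icc a T)
    (left_mem_Icc.2 haT) (right_mem_Icc.2 haT)
  have happ : ∀ s ∈ Icc a T, |mollified F η s (Z s) - (∫ y, η y) * F s (Z s)| ≤
      θ * ∫ y, η y := by
    intro s hs
    have e : mollified F η s (Z s) - (∫ y, η y) * F s (Z s) =
        ∫ y, η y * (F s (Z s - y) - F s (Z s)) := by
      simp only [mul_sub]
      rw [integral_sub, integral_mul_const, mollified]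
      · exact (hη.continuous.mul ((hFc s).comp (by fun_prop))).integrable_of_hasCompactSupport
          hc.mul_right
      · exact hηi.mul_const _
    rw [e, ← integral_const_mul, ← Real.norm_eq_abs]
    refine norm_integral_le_of_norm_le (hηi.const_mul _) (Eventually.of_forall fun y => ?_)
    by_cases hy : ε < ‖y‖
    · simp [hsupp y hy]
    · rw [norm_mul, Real.norm_of_nonneg (hη0 y), mul_comm, Real.norm_eq_abs]
      exact mul_le_mul_of_nonneg_right (hosc s hs y (not_lt.1 hy)) (hη0 y)
  have h1 := abs_le.1 (happ T (right_mem_Icc.2 haT))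
  have h2 := abs_le.1 (happ a (left_mem_Icc.2 haT))
  rw [Real.norm_of_nonneg (sub_nonneg.2 haT), Real.norm_eq_abs] at hmain
  have h3 := abs_le.1 hmain
  have hm : 0 ≤ ∫ y, η y := integral_nonneg hη0
  rw [← abs_of_nonneg hm, ← abs_mul, abs_of_nonneg hm, abs_le]
  constructor <;> linarith

/-- For `η(y) = φ(y / ε)` both `∫ η` and `ε ∫ ‖dη‖` scale like `ε⁶`, so the scale cancels and the
bound is a constant times `θ`. By compactness of the time interval, `θ` can be made arbitrarily
small. -/
lemma TransportSolution.eq_of_pos (h : TransportSolution E F)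
    (hE : Continuous fun q : ℝ × Space => E q.1 q.2)
    {L : ℝ} (hL0 : 0 ≤ L) (hL : ∀ s Z Z', ‖charField E s Z - charField E s Z'‖ ≤ L * ‖Z - Z'‖)
    {Z : ℝ → Phase} (hZ : ∀ t, 0 ≤ t → HasDerivWithinAt Z (charField E t (Z t)) (Ici 0) t)
    {a T : ℝ} (ha : 0 < a) (haT : a ≤ T) : F T (Z T) = F a (Z a) := by
  let φ : ContDiffBump (0 : Phase) :=
    { rIn := 1 / 2, rOut := 1, rIn_pos := by norm_num, rIn_lt_rOut := by norm_num }
  have hφ : ContDiff ℝ ∞ (φ : Phase → ℝ) := φ.contDiff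
  have hφi : 0 < ∫ y, φ y := φ.integral_pos
  set m := ∫ y, φ y with hm
  set N := ∫ y, ‖fderiv ℝ φ y‖ with hN
  have hN0 : 0 ≤ N := integral_nonneg fun y => norm_nonneg _
  have hZc : ContinuousOn Z (Icc a T) := fun t ht =>
    ((hZ t (ha.le.trans ht.1)).continuousWithinAt).mono fun s hs => ha.le.trans hs.1
  have key : ∀ θ > 0, m * |F T (Z T) - F a (Z a)| ≤ θ * (2 * m) + θ * (L * N) * (T - a) := by
    intro θ hθ
    have hunif : ∀ᶠ y in 𝓝 (0 : Phase), ∀ s ∈ Icc a T, |F s (Z s - y) - F s (Z s)| < θ := by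
      have hcont : ContinuousOn (fun q : Phase × ℝ => |F q.2 (Z q.2 - q.1) - F q.2 (Z q.2)|)
          (univ ×ˢ Icc a T) := by
        have hz : ContinuousOn (fun q : Phase × ℝ => Z q.2) (univ ×ˢ Icc a T) :=
          hZc.comp continuous_snd.continuousOn fun q hq => hq.2
        have c1 : ContinuousOn (fun q : Phase × ℝ => F q.2 (Z q.2 - q.1)) (univ ×ˢ Icc a T) :=
          h.cont.comp_continuousOn (continuous_snd.continuousOn.prodMk
            (hz.sub continuous_fst.continuousOn))
        have c2 : ContinuousOn (fun q : Phase × ℝ => F q.2 (Z q.2)) (univ ×ˢ Icc a T) :=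
          h.cont.comp_continuousOn (continuous_snd.continuousOn.prodMk hz)
        exact (c1.sub c2).abs
      set P : Phase → Icc a T → Prop := fun y s => |F s (Z s - y) - F s (Z s)| < θ
      have hcont' : Continuous fun q : Phase × Icc a T =>
          |F q.2 (Z q.2 - q.1) - F q.2 (Z q.2)| := by
        refine hcont.comp_continuous (f := fun q : Phase × Icc a T => (q.1, (q.2 : ℝ)))
          (by fun_prop) fun q => ⟨trivial, q.2.2⟩
      have hPev : ∀ᶠ y in 𝓝 (0 : Phase), ∀ s ∈ (univ : Set (Icc a T)), P y s := by
        refine isCompact_univ.eventually_forall_of_forall_eventually fun s _ => ?_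
        have := hcont'.tendsto (0, s)
        simp only [sub_zero, sub_self, abs_zero] at this
        exact this.eventually (gt_mem_nhds hθ)
      exact hPev.mono fun y hy s hs => hy ⟨s, hs⟩ trivial
    obtain ⟨r, hr, hry⟩ := Metric.eventually_nhds_iff.1 hunif
    set ε := r / 2
    have hε : 0 < ε := by positivity
    set η : Phase → ℝ := fun y => φ (ε⁻¹ • y) with hη
    have hηs : ContDiff ℝ ∞ η := hφ.comp (contDiff_const_smul _)
    have hηc : HasCompactSupport η :=
      φ.hasCompactSupport.comp_smul (inv_ne_zero hε.ne')
    have hηz : ∀ y, ε < ‖y‖ → η y = 0 := by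
      intro y hy
      refine φ.zero_of_le_dist ?_
      rw [dist_zero_right, norm_smul, norm_inv, Real.norm_of_nonneg hε.le]
      change 1 ≤ _
      rw [inv_mul_eq_div, one_le_div hε]
      exact hy.le
    have hηi : ∫ y, η y = ε ^ 6 * m := by
      have := Measure.integral_comp_inv_smul (volume : Measure Phase) (φ : Phase → ℝ) ε
      rw [hη, this]
      have : Module.finrank ℝ Phase = 6 := by simp [Phase]
      rw [this, abs_of_pos (by positivity), smul_eq_mul]
    have hηd : ∫ y, ‖fderiv ℝ η y‖ = ε ^ 6 * (ε⁻¹ * N) := by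
      have e : ∀ y, ‖fderiv ℝ η y‖ = ε⁻¹ * ‖fderiv ℝ φ (ε⁻¹ • y)‖ := by
        intro y
        rw [hη]
        have h0 := HasFDerivAt.comp (g := φ) (f := fun y : Phase => ε⁻¹ • y) y
          ((hφ.differentiable (by simp)) (ε⁻¹ • y)).hasFDerivAt
          ((hasFDerivAt_id y).const_smul ε⁻¹)
        have h1 : HasFDerivAt (fun y => φ (ε⁻¹ • y)) _ y := h0
        rw [h1.fderiv, ContinuousLinearMap.comp_smul, norm_smul, norm_inv,
          Real.norm_of_nonneg hε.le, ContinuousLinearMap.comp_id]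
      simp only [e]
      rw [integral_const_mul]
      have := Measure.integral_comp_inv_smul (volume : Measure Phase)
        (fun y => ‖fderiv ℝ φ y‖) ε
      rw [this]
      have : Module.finrank ℝ Phase = 6 := by simp [Phase]
      rw [this, abs_of_pos (by positivity), smul_eq_mul]
      ring
    have := h.mollified_oscillation hE hηs (fun y => φ.nonneg) hηc hηz hL0 hL hZ ha haT hθ.le
      (fun s hs y hy => (hry (by
        rw [dist_zero_right]; exact lt_of_le_of_lt hy (by simp only [ε]; linarith)) s hs).le)
    rw [hηi, hηd] at this
    have h6 : 0 < ε ^ 6 := by positivity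
    have e2 : θ * (2 * (ε ^ 6 * m)) + θ * (L * ε * (ε ^ 6 * (ε⁻¹ * N))) * (T - a) =
        ε ^ 6 * (θ * (2 * m) + θ * (L * N) * (T - a)) := by
      field_simp
    rw [e2, mul_assoc] at this
    exact le_of_mul_le_mul_left this h6
  have hlim : Tendsto (fun θ : ℝ => θ * (2 * m) + θ * (L * N) * (T - a)) (𝓝[>] 0) (𝓝 0) := by
    have : Continuous fun θ : ℝ => θ * (2 * m) + θ * (L * N) * (T - a) := by fun_prop
    have := this.tendsto 0
    simp only [zero_mul, add_zero] at this
    exact this.mono_left nhdsWithin_le_nhds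
  have hle : m * |F T (Z T) - F a (Z a)| ≤ 0 :=
    ge_of_tendsto hlim (by filter_upwards [self_mem_nhdsWithin] with θ hθ using key θ hθ)
  have h0 : |F T (Z T) - F a (Z a)| ≤ 0 := by
    by_contra hcon
    have := mul_pos hφi (not_le.1 hcon)
    linarith
  exact sub_eq_zero.1 (abs_nonpos_iff.1 h0)

/-- A continuous weak solution is constant along the characteristics. -/
theorem TransportSolution.eq_initial (h : TransportSolution E F)
    (hE : Continuous fun q : ℝ × Space => E q.1 q.2)
    {L : ℝ} (hL0 : 0 ≤ L) (hL : ∀ s Z Z', ‖charField E s Z - charField E s Z'‖ ≤ L * ‖Z - Z'‖)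
    {Z : ℝ → Phase} (hZ : ∀ t, 0 ≤ t → HasDerivWithinAt Z (charField E t (Z t)) (Ici 0) t)
    {T : ℝ} (hT : 0 ≤ T) : F T (Z T) = F 0 (Z 0) := by
  rcases hT.eq_or_lt with rfl | hT
  · rfl
  have hcont : ContinuousWithinAt (fun t => F t (Z t)) (Ici 0) 0 :=
    h.cont.continuousAt.comp_continuousWithinAt
      (continuousWithinAt_id.prodMk (hZ 0 le_rfl).continuousWithinAt)
  have h1 : Tendsto (fun t => F t (Z t)) (𝓝[>] 0) (𝓝 (F 0 (Z 0))) :=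
    hcont.mono_left (nhdsWithin_mono _ Ioi_subset_Ici_self)
  refine tendsto_nhds_unique (tendsto_const_nhds.congr' ?_) h1
  filter_upwards [Ioc_mem_nhdsGT hT] with a ha
  exact h.eq_of_pos hE hL0 hL hZ ha.1 ha.2

end Transport

end

/-! ### Estimates along characteristics -/

lemma norm_sub_le_of_deriv_le {G : Type*} [NormedAddCommGroup G] [NormedSpace ℝ G]
    {f f' : ℝ → G} {g g' : ℝ → ℝ} {a b : ℝ} (hab : a ≤ b)
    (hf : ∀ s ∈ Icc a b, HasDerivAt f (f' s) s) (hg : ∀ s ∈ Icc a b, HasDerivAt g (g' s) s)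
    (h : ∀ s ∈ Icc a b, ‖f' s‖ ≤ g' s) : ‖f b - f a‖ ≤ g b - g a := by
  refine image_norm_le_of_norm_deriv_right_le_deriv_boundary' (f := fun s => f s - f a)
    (f' := f') (B := fun s => g s - g a) (B' := g') (a := a) (b := b) ?_ ?_ ?_ ?_ ?_ ?_
    (right_mem_Icc.2 hab)
  · exact fun s hs => ((hf s hs).continuousAt.sub continuousAt_const).continuousWithinAt
  · exact fun s hs => ((hf s (Ico_subset_Icc_self hs)).sub_const _).hasDerivWithinAt
  · simp
  · exact fun s hs => ((hg s hs).continuousAt.sub continuousAt_const).continuousWithinAt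
  · exact fun s hs => ((hg s (Ico_subset_Icc_self hs)).sub_const _).hasDerivWithinAt
  · exact fun s hs => h s (Ico_subset_Icc_self hs)

lemma hasDerivAt_one_add_rpow {q s : ℝ} (hq : q ≠ 0) (hs : 0 ≤ s) :
    HasDerivAt (fun s : ℝ => (1 + s) ^ q / q) ((1 + s) ^ (q - 1)) s := by
  have h := (((hasDerivAt_id s).const_add 1).rpow_const (p := q) (Or.inl (by simp; linarith)))
  convert! h.div_const q using 1
  simp; field_simp

/-- The position at time `t` of the characteristic issued from `z`. -/
def charX (E : ℝ → Space → Space) (t : ℝ) (z : Phase) : Space :=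
  (evol (twisted E) 0 t z).1 + t • (evol (twisted E) 0 t z).2

/-- The velocity at time `t` of the characteristic issued from `z`. -/
def charV (E : ℝ → Space → Space) (t : ℝ) (z : Phase) : Space := (evol (twisted E) 0 t z).2

/-- The asymptotic velocity of the characteristic issued from `z`. -/
def asymV (E : ℝ → Space → Space) (z : Phase) : Space := limUnder atTop fun t => charV E t z

section

variable {α κ : ℝ} {E : ℝ → Space → Space}

lemma ForceField.hasDerivAt_fst (hE : ForceField α κ E) (hα : 0 < α) (s t : ℝ) (W : Phase) :
    HasDerivAt (fun t => (evol (twisted E) s t W).1)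
      (-(t • E t ((evol (twisted E) s t W).1 + t • (evol (twisted E) s t W).2))) t := by
  have h := (hE.bddLipField hα).hasDerivAt_evol s t W
  exact (ContinuousLinearMap.fst ℝ Space Space).hasFDerivAt.comp_hasDerivAt t h

lemma ForceField.hasDerivAt_snd (hE : ForceField α κ E) (hα : 0 < α) (s t : ℝ) (W : Phase) :
    HasDerivAt (fun t => (evol (twisted E) s t W).2)
      (E t ((evol (twisted E) s t W).1 + t • (evol (twisted E) s t W).2)) t := by
  have h := (hE.bddLipField hα).hasDerivAt_evol s t W
  exact (ContinuousLinearMap.snd ℝ Space Space).hasFDerivAt.comp_hasDerivAt t h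

lemma ForceField.hasDerivAt_charV (hE : ForceField α κ E) (hα : 0 < α) (t : ℝ) (z : Phase) :
    HasDerivAt (fun t => charV E t z) (E t (charX E t z)) t := hE.hasDerivAt_snd hα 0 t z

lemma ForceField.hasDerivAt_charX (hE : ForceField α κ E) (hα : 0 < α) (t : ℝ) (z : Phase) :
    HasDerivAt (fun t => charX E t z) (charV E t z) t := by
  have h := (hE.hasDerivAt_fst hα 0 t z).add ((hasDerivAt_id t).smul (hE.hasDerivAt_snd hα 0 t z))
  convert! h using 1
  simp [charV]

lemma ForceField.charX_zero (hE : ForceField α κ E) (hα : 0 < α) (z : Phase) :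
    charX E 0 z = z.1 := by simp [charX, (hE.bddLipField hα).evol_self]

lemma ForceField.charV_zero (hE : ForceField α κ E) (hα : 0 < α) (z : Phase) :
    charV E 0 z = z.2 := by simp [charV, (hE.bddLipField hα).evol_self]

lemma ForceField.continuous_charX (hE : ForceField α κ E) (hα : 0 < α) {t : ℝ} (ht : 0 ≤ t) :
    Continuous (charX E t) := by
  have := (hE.bddLipField hα).continuous_evol ht
  unfold charX; fun_prop

lemma ForceField.continuous_charV (hE : ForceField α κ E) (hα : 0 < α) {t : ℝ} (ht : 0 ≤ t) :
    Continuous (charV E t) := by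
  have := (hE.bddLipField hα).continuous_evol ht
  unfold charV; fun_prop

lemma exists_norm_max {f : ℝ → Space} (hf : Continuous f) {T : ℝ} (hT : 0 ≤ T) :
    ∃ s₀ ∈ Icc 0 T, ∀ s ∈ Icc 0 T, ‖f s‖ ≤ ‖f s₀‖ :=
  isCompact_Icc.exists_isMaxOn (nonempty_Icc.2 hT) hf.norm.continuousOn

/-- The spreading of characteristics issued from the same position. -/
lemma ForceField.spread_v (hE : ForceField α κ E) (hα : 0 < α) (hκ : κ ≤ α / 3) (x v v' : Space)
    {t : ℝ} (ht : 0 ≤ t) :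
    ‖charV E t (x, v) - charV E t (x, v') - (v - v')‖ ≤ 1 / 2 * ‖v - v'‖ ∧
      ‖charX E t (x, v) - charX E t (x, v') - t • (v - v')‖ ≤ 1 / 2 * ‖v - v'‖ * t := by
  have hκ0 := hE.kappa_nonneg
  set u : ℝ → Space := fun s => charX E s (x, v) - charX E s (x, v') with hu
  set b : ℝ → Space := fun s => charV E s (x, v) - charV E s (x, v') with hb
  have hud : ∀ s, HasDerivAt u (b s) s := fun s =>
    (hE.hasDerivAt_charX hα s _).sub (hE.hasDerivAt_charX hα s _)
  have hbd : ∀ s, HasDerivAt b (E s (charX E s (x, v)) - E s (charX E s (x, v'))) s := fun s =>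
    (hE.hasDerivAt_charV hα s _).sub (hE.hasDerivAt_charV hα s _)
  have hu0 : u 0 = 0 := by simp [hu, hE.charX_zero hα]
  have hb0 : b 0 = v - v' := by simp [hb, hE.charV_zero hα]
  have hbc : Continuous b := continuous_iff_continuousAt.2 fun s => (hbd s).continuousAt
  -- Bootstrap on the largest velocity difference `M`: positions differ by at most `M s`, so the
  -- force changes the velocity difference by at most `κ M / α ≤ M / 3`. This gives `M ≤ 3/2 ‖v -
  -- v'‖`, and the deviation `M / 3` is then at most half of `‖v - v'‖`.
  obtain ⟨s₀, hs₀, hM⟩ := exists_norm_max hbc ht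
  set M := ‖b s₀‖ with hMdef
  have hus : ∀ s ∈ Icc 0 t, ‖u s‖ ≤ M * s := by
    intro s hs
    have := norm_sub_le_of_deriv_le (g := fun s => M * s) (g' := fun _ => M) hs.1
      (fun r _ => hud r) (fun r _ => by simpa using (hasDerivAt_id r).const_mul M)
      (fun r hr => hM r ⟨hr.1, hr.2.trans hs.2⟩)
    simpa [hu0] using this
  have hbs : ∀ s ∈ Icc 0 t, ‖b s - b 0‖ ≤ κ * M / α := by
    intro s hs
    have := norm_sub_le_of_deriv_le (g := fun s => κ * M * ((1 + s) ^ (-α) / (-α)))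
      (g' := fun s => κ * M * (1 + s) ^ (-α - 1)) hs.1
      (fun r _ => hbd r)
      (fun r hr => (hasDerivAt_one_add_rpow (by linarith) hr.1).const_mul _)
      (fun r hr => by
        have hr0 : 0 ≤ r := hr.1
        refine (hE.lip _ _ _).trans ?_
        rw [abs_of_nonneg hr0]
        have h1 := hus r ⟨hr0, hr.2.trans hs.2⟩
        calc κ * (1 + r) ^ (-(2 + α)) * ‖u r‖ ≤ κ * (1 + r) ^ (-(2 + α)) * (M * (1 + r)) := by
              have hM0 : 0 ≤ M := norm_nonneg _
              gcongr
              exact h1.trans (by nlinarith)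
          _ = κ * M * ((1 + r) * (1 + r) ^ (-((1 + α) + 1))) := by
              rw [show -(2 + α) = -((1 + α) + 1) by ring]; ring
          _ = κ * M * (1 + r) ^ (-α - 1) := by
              rw [one_add_mul_rpow hr0, show -(1 + α) = -α - 1 by ring])
    refine this.trans ?_
    have hp : 0 ≤ (1 + s) ^ (-α) := Real.rpow_nonneg (by linarith [hs.1]) _
    have hM0 : 0 ≤ M := norm_nonneg _
    have e : κ * M * ((1 + s) ^ (-α) / (-α)) - κ * M * ((1 + 0) ^ (-α) / (-α)) =
        κ * M / α - κ * M / α * (1 + s) ^ (-α) := by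
      rw [add_zero, Real.one_rpow]; field_simp; ring
    rw [e]
    have : 0 ≤ κ * M / α * (1 + s) ^ (-α) := by positivity
    linarith
  have hM0 : 0 ≤ M := norm_nonneg _
  have hκM : κ * M / α ≤ M / 3 := by
    rw [div_le_iff₀ hα]; nlinarith
  have hM2 : M ≤ 3 / 2 * ‖v - v'‖ := by
    have h1 := hbs s₀ hs₀
    have h2 := norm_sub_norm_le (b s₀) (b 0)
    rw [hb0] at h2 h1
    linarith
  have hfin : ∀ s ∈ Icc 0 t, ‖b s - (v - v')‖ ≤ 1 / 2 * ‖v - v'‖ := by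
    intro s hs
    have h1 := hbs s hs
    rw [hb0] at h1
    linarith
  refine ⟨hfin t ⟨ht, le_rfl⟩, ?_⟩
  have := norm_sub_le_of_deriv_le (f := fun s => u s - s • (v - v'))
    (f' := fun s => b s - (v - v'))
    (g := fun s => 1 / 2 * ‖v - v'‖ * s) (g' := fun _ => 1 / 2 * ‖v - v'‖) ht
    (fun r _ => by
      have := (hud r).sub ((hasDerivAt_id r).smul_const (v - v'))
      rw [one_smul] at this
      exact this)
    (fun r _ => by simpa using (hasDerivAt_id r).const_mul (1 / 2 * ‖v - v'‖))
    (fun r hr => hfin r hr)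
  simpa [hu0] using this

lemma antilipschitz_of_near_id {g : Space → Space}
    (h : ∀ v v', ‖g v - g v' - (v - v')‖ ≤ 1 / 2 * ‖v - v'‖) : AntilipschitzWith 2 g := by
  refine AntilipschitzWith.of_le_mul_dist fun v v' => ?_
  rw [dist_eq_norm, dist_eq_norm]
  have h1 := h v v'
  have h2 := norm_sub_norm_le (v - v') (g v - g v')
  rw [norm_sub_rev (v - v')] at h2
  push_cast
  linarith

lemma ForceField.antilipschitz_charX_v (hE : ForceField α κ E) (hα : 0 < α) (hκ : κ ≤ α / 3)
    {t : ℝ} (ht : 0 < t) (x : Space) :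
    AntilipschitzWith 2 fun v => t⁻¹ • charX E t (x, v) := by
  refine antilipschitz_of_near_id fun v v' => ?_
  have h := (hE.spread_v hα hκ x v v' ht.le).2
  have e : t⁻¹ • charX E t (x, v) - t⁻¹ • charX E t (x, v') - (v - v') =
      t⁻¹ • (charX E t (x, v) - charX E t (x, v') - t • (v - v')) := by
    rw [smul_sub, smul_sub, smul_smul, inv_mul_cancel₀ ht.ne', one_smul]
  rw [e, norm_smul, norm_inv, Real.norm_of_nonneg ht.le, inv_mul_le_iff₀ ht]
  linarith

/-! ### Asymptotic velocity -/

lemma ForceField.norm_snd_sub_le (hE : ForceField α κ E) (hα : 0 < α) (W : Phase) (r : ℝ)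
    {s t : ℝ} (hs : 0 ≤ s) (hst : s ≤ t) :
    ‖(evol (twisted E) r t W).2 - (evol (twisted E) r s W).2‖ ≤ κ / α * (1 + s) ^ (-α) := by
  have hκ0 := hE.kappa_nonneg
  have := norm_sub_le_of_deriv_le (g := fun s => κ * ((1 + s) ^ (-α) / (-α)))
    (g' := fun s => κ * (1 + s) ^ (-α - 1)) hst (fun q _ => hE.hasDerivAt_snd hα r q W)
    (fun q hq => (hasDerivAt_one_add_rpow (by linarith) (hs.trans hq.1)).const_mul _)
    (fun q hq => by
      have := hE.bound q ((evol (twisted E) r q W).1 + q • (evol (twisted E) r q W).2)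
      rwa [abs_of_nonneg (hs.trans hq.1), show -(1 + α) = -α - 1 by ring] at this)
  refine this.trans ?_
  have hp : 0 ≤ (1 + t) ^ (-α) := Real.rpow_nonneg (by linarith) _
  have e : κ * ((1 + t) ^ (-α) / (-α)) - κ * ((1 + s) ^ (-α) / (-α)) =
      κ / α * (1 + s) ^ (-α) - κ / α * (1 + t) ^ (-α) := by
    field_simp; ring
  rw [e]
  have : 0 ≤ κ / α * (1 + t) ^ (-α) := by positivity
  linarith

/-- The first component of the twisted field decays only like `t^{-α}`, whence the growth `t^{1-α}`.
The base time `r` is free because the bound is also needed for curves prescribed at a late time and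
followed back to `0`. -/
lemma ForceField.norm_fst_sub_le (hE : ForceField α κ E) (hα : 0 < α) (hα' : α < 1) (W : Phase)
    (r : ℝ) {t : ℝ} (ht : 0 ≤ t) :
    ‖(evol (twisted E) r t W).1 - (evol (twisted E) r 0 W).1‖ ≤
      κ / (1 - α) * (1 + t) ^ (1 - α) := by
  have hκ0 := hE.kappa_nonneg
  have h1α : 0 < 1 - α := by linarith
  have := norm_sub_le_of_deriv_le (g := fun s => κ * ((1 + s) ^ (1 - α) / (1 - α)))
    (g' := fun s => κ * (1 + s) ^ (1 - α - 1)) ht (fun q _ => hE.hasDerivAt_fst hα r q W)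
    (fun q hq => (hasDerivAt_one_add_rpow h1α.ne' hq.1).const_mul _)
    (fun q hq => by
      have hq0 : 0 ≤ q := hq.1
      have := hE.bound q ((evol (twisted E) r q W).1 + q • (evol (twisted E) r q W).2)
      rw [abs_of_nonneg hq0] at this
      rw [norm_neg, norm_smul, Real.norm_of_nonneg hq0]
      calc _ ≤ (1 + q) * (κ * (1 + q) ^ (-(1 + α))) := by
            gcongr; linarith
        _ = κ * ((1 + q) * (1 + q) ^ (-(α + 1))) := by
            rw [show -(1 + α) = -(α + 1) by ring]; ring
        _ = _ := by rw [one_add_mul_rpow hq0, show 1 - α - 1 = -α by ring])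
  refine this.trans ?_
  have : 0 ≤ κ * ((1 + 0) ^ (1 - α) / (1 - α)) := by
    rw [add_zero, Real.one_rpow]; positivity
  have e : κ * ((1 + t) ^ (1 - α) / (1 - α)) = κ / (1 - α) * (1 + t) ^ (1 - α) := by ring
  linarith

lemma tendsto_one_add_rpow_neg (hα : 0 < α) (C : ℝ) :
    Tendsto (fun t : ℝ => C * (1 + t) ^ (-α)) atTop (𝓝 0) := by
  have h1 : Tendsto (fun t : ℝ => 1 + t) atTop atTop := tendsto_atTop_add_const_left _ _ tendsto_id
  have := ((tendsto_rpow_neg_atTop hα).comp h1).const_mul C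
  simpa using this

lemma ForceField.tendsto_charV (hE : ForceField α κ E) (hα : 0 < α) (z : Phase) :
    Tendsto (fun t => charV E t z) atTop (𝓝 (asymV E z)) := by
  refine tendsto_nhds_limUnder ?_
  refine cauchySeq_tendsto_of_complete (Metric.cauchySeq_iff'.2 fun ε hε => ?_)
  obtain ⟨N, hN, hN0⟩ := (((tendsto_one_add_rpow_neg hα (κ / α)).eventually
    (gt_mem_nhds hε)).and (eventually_ge_atTop 0)).exists
  refine ⟨N, fun t ht => ?_⟩
  rw [dist_eq_norm]
  exact (hE.norm_snd_sub_le hα z 0 hN0 ht).trans_lt hN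

lemma ForceField.norm_asymV_sub_le (hE : ForceField α κ E) (hα : 0 < α) (z : Phase) {t : ℝ}
    (ht : 0 ≤ t) : ‖asymV E z - charV E t z‖ ≤ κ / α * (1 + t) ^ (-α) := by
  refine le_of_tendsto ((hE.tendsto_charV hα z).sub_const (charV E t z)).norm ?_
  filter_upwards [eventually_ge_atTop t] with s hs
  exact hE.norm_snd_sub_le hα z 0 ht hs

lemma ForceField.antilipschitz_asymV (hE : ForceField α κ E) (hα : 0 < α) (hκ : κ ≤ α / 3)
    (x : Space) : AntilipschitzWith 2 fun v => asymV E (x, v) := by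
  refine antilipschitz_of_near_id fun v v' => ?_
  refine le_of_tendsto (((hE.tendsto_charV hα (x, v)).sub (hE.tendsto_charV hα (x, v'))).sub_const
    (v - v')).norm ?_
  filter_upwards [eventually_ge_atTop 0] with t ht
  exact (hE.spread_v hα hκ x v v' ht).1

lemma ForceField.measurable_asymV (hE : ForceField α κ E) (hα : 0 < α) : Measurable (asymV E) := by
  refine measurable_of_tendsto_metrizable (f := fun (n : ℕ) z => charV E n z)
    (fun n => (hE.continuous_charV hα n.cast_nonneg).measurable) ?_
  rw [tendsto_pi_nhds]
  exact fun z => (hE.tendsto_charV hα z).comp tendsto_natCast_atTop_atTop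

lemma one_le_bracket {G : Type*} [NormedAddCommGroup G] (a : G) : 1 ≤ bracket a := by
  rw [bracket, Real.one_le_sqrt]; nlinarith [sq_nonneg ‖a‖]

lemma norm_le_bracket {G : Type*} [NormedAddCommGroup G] (a : G) : ‖a‖ ≤ bracket a :=
  Real.le_sqrt_of_sq_le (by linarith)

lemma one_add_rpow_le {t : ℝ} (ht : 1 ≤ t) (hα : 0 < α) (hα' : α < 1) :
    (1 + t) ^ (1 - α) ≤ 2 * t ^ (1 - α) := by
  calc (1 + t) ^ (1 - α) ≤ (2 * t) ^ (1 - α) := by (gcongr; linarith)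
    _ = 2 ^ (1 - α) * t ^ (1 - α) := Real.mul_rpow (by norm_num) (by linarith)
    _ ≤ 2 ^ (1 : ℝ) * t ^ (1 - α) := by
        gcongr
        · norm_num
        · linarith
    _ = _ := by simp

/-- Since `X = ξ + t V` with `ξ` the twisted position, the error is the tail `V⁺ - V(t)` minus `ξ /
t`. The drift in `ξ` contributes `t^{-α}`, and the initial position, of size `|x| / t`, is the
source of the bracket. -/
lemma ForceField.norm_asymV_sub_charX_le (hE : ForceField α κ E) (hα : 0 < α) (hα' : α < 1)
    (hκ : κ ≤ 1) (z : Phase) {t : ℝ} (ht : 1 ≤ t) :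
    ‖asymV E z - t⁻¹ • charX E t z‖ ≤ (1 + 2 / (1 - α) + 1 / α) * bracket z.1 * t ^ (-α) := by
  have hκ0 := hE.kappa_nonneg
  have ht0 : 0 < t := by linarith
  have h1α : 0 < 1 - α := by linarith
  have h1 := hE.norm_asymV_sub_le hα z ht0.le
  have h2 := hE.norm_fst_sub_le hα hα' z 0 ht0.le
  rw [(hE.bddLipField hα).evol_self] at h2
  set ξ := (evol (twisted E) 0 t z).1
  have hb := one_le_bracket z.1
  have hb' := norm_le_bracket z.1
  have hξ : ‖ξ‖ ≤ ‖z.1‖ + κ / (1 - α) * (1 + t) ^ (1 - α) := by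
    have := norm_sub_norm_le ξ z.1; linarith
  have e : asymV E z - t⁻¹ • charX E t z = (asymV E z - charV E t z) - t⁻¹ • ξ := by
    rw [charX, smul_add, smul_smul, inv_mul_cancel₀ ht0.ne', one_smul, charV]; abel
  rw [e]
  have hT : t⁻¹ ≤ t ^ (-α) := by
    rw [← Real.rpow_neg_one]
    exact Real.rpow_le_rpow_of_exponent_le ht (by linarith)
  have hT2 : t⁻¹ * t ^ (1 - α) = t ^ (-α) := by
    rw [← Real.rpow_neg_one, ← Real.rpow_add ht0]; congr 1; ring
  have hT3 : (1 + t) ^ (-α) ≤ t ^ (-α) :=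
    Real.rpow_le_rpow_of_nonpos ht0 (by linarith) (by linarith)
  have hTp : 0 ≤ t ^ (-α) := Real.rpow_nonneg ht0.le _
  have hX : t⁻¹ * (κ / (1 - α) * (1 + t) ^ (1 - α)) ≤ 2 / (1 - α) * t ^ (-α) := by
    calc t⁻¹ * (κ / (1 - α) * (1 + t) ^ (1 - α)) ≤ t⁻¹ * (1 / (1 - α) * (2 * t ^ (1 - α))) := by
          gcongr
          exact one_add_rpow_le ht hα hα'
      _ = 2 / (1 - α) * (t⁻¹ * t ^ (1 - α)) := by ring
      _ = _ := by rw [hT2]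
  calc ‖(asymV E z - charV E t z) - t⁻¹ • ξ‖
      ≤ κ / α * (1 + t) ^ (-α) + t⁻¹ * (‖z.1‖ + κ / (1 - α) * (1 + t) ^ (1 - α)) := by
        refine (norm_sub_le _ _).trans (add_le_add h1 ?_)
        rw [norm_smul, norm_inv, Real.norm_of_nonneg ht0.le]
        gcongr
    _ ≤ 1 / α * t ^ (-α) + (t ^ (-α) * bracket z.1 + 2 / (1 - α) * t ^ (-α)) := by
        rw [mul_add]
        gcongr
    _ ≤ _ := by
        have h3 : 0 ≤ (2 / (1 - α) + 1 / α) * t ^ (-α) := by positivity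
        nlinarith
end

/-! ### Backward stability of characteristics -/

/-- A smooth version of the norm. -/
def smoothNorm (ε : ℝ) (x : Space) : ℝ := Real.sqrt (‖x‖ ^ 2 + ε ^ 2)

lemma norm_le_smoothNorm (ε : ℝ) (x : Space) : ‖x‖ ≤ smoothNorm ε x :=
  Real.le_sqrt_of_sq_le (by nlinarith [sq_nonneg ε])

lemma smoothNorm_le {ε : ℝ} (hε : 0 ≤ ε) (x : Space) : smoothNorm ε x ≤ ‖x‖ + ε := by
  rw [smoothNorm, Real.sqrt_le_left (by positivity)]
  nlinarith [mul_nonneg (norm_nonneg x) hε]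

lemma exists_hasDerivAt_smoothNorm {ε : ℝ} (hε : 0 < ε) {f : ℝ → Space} {f' : Space} {t : ℝ}
    (hf : HasDerivAt f f' t) :
    ∃ d, HasDerivAt (fun t => smoothNorm ε (f t)) d t ∧ |d| ≤ ‖f'‖ := by
  have h1 := (hf.norm_sq).add_const (ε ^ 2)
  have hpos : 0 < ‖f t‖ ^ 2 + ε ^ 2 := by positivity
  have h2 := h1.sqrt hpos.ne'
  refine ⟨_, h2, ?_⟩
  have hs : 0 < Real.sqrt (‖f t‖ ^ 2 + ε ^ 2) := Real.sqrt_pos.2 hpos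
  rw [mul_div_mul_left _ _ two_ne_zero, abs_div, abs_of_pos hs, div_le_iff₀ hs, mul_comm]
  exact (abs_real_inner_le_norm _ _).trans
    (mul_le_mul_of_nonneg_right (norm_le_smoothNorm ε (f t)) (norm_nonneg _))

section

variable {α κ : ℝ} {E : ℝ → Space → Space}

/-- The rate of growth of differences of twisted characteristics. -/
lemma ForceField.norm_diff_le (hE : ForceField α κ E) {s : ℝ} (hs : 0 ≤ s) (W W' : Phase) :
    ‖E s (W.1 + s • W.2) - E s (W'.1 + s • W'.2)‖ ≤
      κ * (1 + s) ^ (-(2 + α)) * (‖W.1 - W'.1‖ + s * ‖W.2 - W'.2‖) := by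
  have h := hE.lip s (W.1 + s • W.2) (W'.1 + s • W'.2)
  rw [abs_of_nonneg hs] at h
  refine h.trans ?_
  have := hE.kappa_nonneg
  gcongr
  have e : W.1 + s • W.2 - (W'.1 + s • W'.2) = (W.1 - W'.1) + s • (W.2 - W'.2) := by
    rw [smul_sub]; abel
  rw [e]
  refine (norm_add_le _ _).trans ?_
  rw [norm_smul, Real.norm_of_nonneg hs]

/-- Run backward, a velocity difference `b` feeds the position difference `a` at rate `κ (1 +
s)^{-α}`. The quantity `|a| + (1 + s)^{1-α} |b|` is adapted to this: up to an integrating factor it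
is nondecreasing in time. The smooth norm makes it differentiable where the differences vanish. -/
lemma ForceField.backward_aux (hE : ForceField α κ E) (hα : 0 < α) (hα' : α < 1)
    (hκ : κ ≤ 1 - α) (hκ' : κ ≤ α / 4) (r : ℝ) (W W' : Phase) {t ε : ℝ} (ht : 0 ≤ t) (hε : 0 < ε) :
    let a := fun s => (evol (twisted E) r s W).1 - (evol (twisted E) r s W').1
    let b := fun s => (evol (twisted E) r s W).2 - (evol (twisted E) r s W').2
    smoothNorm ε (a 0) + smoothNorm ε (b 0) ≤
      2 * (smoothNorm ε (a t) + (1 + t) ^ (1 - α) * smoothNorm ε (b t)) := by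
  intro a b
  have hκ0 := hE.kappa_nonneg
  set D : ℝ → Space := fun s =>
    E s ((evol (twisted E) r s W).1 + s • (evol (twisted E) r s W).2) -
    E s ((evol (twisted E) r s W').1 + s • (evol (twisted E) r s W').2) with hD
  have had : ∀ s, HasDerivAt a (-(s • D s)) s := fun s => by
    have := (hE.hasDerivAt_fst hα r s W).sub (hE.hasDerivAt_fst hα r s W')
    convert! this using 1
    rw [hD, smul_sub]; abel
  have hbd : ∀ s, HasDerivAt b (D s) s := fun s =>
    (hE.hasDerivAt_snd hα r s W).sub (hE.hasDerivAt_snd hα r s W')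
  have hDle : ∀ s, 0 ≤ s → ‖D s‖ ≤ κ * (1 + s) ^ (-(2 + α)) * (‖a s‖ + s * ‖b s‖) :=
    fun s hs => hE.norm_diff_le hs _ _
  choose A' hA' hA'le using fun s => exists_hasDerivAt_smoothNorm hε (had s)
  choose B' hB' hB'le using fun s => exists_hasDerivAt_smoothNorm hε (hbd s)
  set q : ℝ → ℝ := fun s => smoothNorm ε (a s) + (1 + s) ^ (1 - α) * smoothNorm ε (b s) with hq
  set m : ℝ → ℝ := fun s => 2 * κ * ((1 + s) ^ (-α) / (-α)) with hm
  have hmd : ∀ s, 0 ≤ s → HasDerivAt m (2 * κ * (1 + s) ^ (-α - 1)) s := fun s hs =>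
    (hasDerivAt_one_add_rpow (by linarith) hs).const_mul _
  have h1α : 0 < 1 - α := by linarith
  have hwd : ∀ s, 0 ≤ s → HasDerivAt (fun s : ℝ => (1 + s) ^ (1 - α)) ((1 - α) * (1 + s) ^ (-α)) s := by
    intro s hs
    have := (hasDerivAt_one_add_rpow h1α.ne' hs).const_mul (1 - α)
    rw [show 1 - α - 1 = -α by ring] at this
    convert! this using 1
    ext s; field_simp
  have hqd : ∀ s, 0 ≤ s → HasDerivAt q (A' s + ((1 - α) * (1 + s) ^ (-α) * smoothNorm ε (b s) +
      (1 + s) ^ (1 - α) * B' s)) s := fun s hs => (hA' s).add ((hwd s hs).mul (hB' s))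
  set Q : ℝ → ℝ := fun s => q s * Real.exp (m s)
  have hQd : ∀ s, 0 ≤ s → HasDerivAt Q ((A' s + ((1 - α) * (1 + s) ^ (-α) * smoothNorm ε (b s) +
      (1 + s) ^ (1 - α) * B' s)) * Real.exp (m s) +
      q s * (Real.exp (m s) * (2 * κ * (1 + s) ^ (-α - 1)))) s := fun s hs =>
    (hqd s hs).mul (hmd s hs).exp
  have hmono : MonotoneOn Q (Icc 0 t) := by
    refine monotoneOn_of_deriv_nonneg (convex_Icc 0 t)
      (fun s hs => (hQd s hs.1).continuousAt.continuousWithinAt)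
      (fun s hs => ?_) (fun s hs => ?_)
    · rw [interior_Icc] at hs
      exact (hQd s hs.1.le).differentiableAt.differentiableWithinAt
    · rw [interior_Icc] at hs
      have hs0 := hs.1.le
      rw [(hQd s hs0).deriv]
      have hpos : 0 < 1 + s := by linarith
      have he := Real.exp_pos (m s)
      suffices hsuff : 0 ≤ A' s + ((1 - α) * (1 + s) ^ (-α) * smoothNorm ε (b s) +
          (1 + s) ^ (1 - α) * B' s) + q s * (2 * κ * (1 + s) ^ (-α - 1)) by
        have := mul_nonneg hsuff he.le
        linarith
      set A := smoothNorm ε (a s)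
      set B := smoothNorm ε (b s)
      have hA := norm_le_smoothNorm ε (a s)
      have hB := norm_le_smoothNorm ε (b s)
      have hA0 : 0 ≤ A := (norm_nonneg _).trans hA
      have hB0 : 0 ≤ B := (norm_nonneg _).trans hB
      set p := (1 + s) ^ (-(1 + α)) with hp
      have hp0 : 0 ≤ p := Real.rpow_nonneg hpos.le _
      have e1 : (1 + s) * (1 + s) ^ (-(2 + α)) = p := by
        rw [show -(2 + α) = -((1 + α) + 1) by ring, one_add_mul_rpow hs0]
      have e2 : (1 + s) * p = (1 + s) ^ (-α) := by
        rw [hp, show -(1 + α) = -(α + 1) by ring, one_add_mul_rpow hs0]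
      have e3 : (1 + s) ^ (-α - 1) = p := by rw [hp]; congr 1; ring
      have e4 : (1 + s) ^ (1 - α) = (1 + s) * ((1 + s) * p) := by
        rw [e2]
        nth_rw 2 [← Real.rpow_one (1 + s)]
        rw [← Real.rpow_add hpos]; congr 1
      have hP2 : 0 ≤ (1 + s) ^ (-(2 + α)) := Real.rpow_nonneg hpos.le _
      set p2 := (1 + s) ^ (-(2 + α))
      have hDs : ‖D s‖ ≤ κ * p2 * (A + s * B) := by
        refine (hDle s hs0).trans ?_
        gcongr
      have hDs' : (1 + s) * ‖D s‖ ≤ κ * p * (A + s * B) := by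
        calc (1 + s) * ‖D s‖ ≤ (1 + s) * (κ * p2 * (A + s * B)) := by gcongr
          _ = κ * ((1 + s) * p2) * (A + s * B) := by ring
          _ = _ := by rw [e1]
      have hA'' : -(κ * p * (A + s * B)) ≤ A' s := by
        have h1 := (abs_le.1 (hA'le s)).1
        rw [norm_neg, norm_smul, Real.norm_of_nonneg hs0] at h1
        have : s * ‖D s‖ ≤ (1 + s) * ‖D s‖ := by gcongr; linarith
        linarith
      have hle1 : (1 + s) * p ≤ 1 := by rw [e2]; exact rpow_neg_le_one hs0 hα.le
      have hB'' : -(κ * p * (A + (1 + s) * ((1 + s) * p) * B)) ≤ (1 + s) ^ (1 - α) * B' s := by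
        have h1 := (abs_le.1 (hB'le s)).1
        rw [e4]
        have h2 : (1 + s) * ((1 + s) * p) * ‖D s‖ ≤ κ * p * (A + (1 + s) * ((1 + s) * p) * B) := by
          calc (1 + s) * ((1 + s) * p) * ‖D s‖ = ((1 + s) * p) * ((1 + s) * ‖D s‖) := by ring
            _ ≤ ((1 + s) * p) * (κ * p * (A + s * B)) := by gcongr
            _ = κ * p * (((1 + s) * p) * A + s * ((1 + s) * p) * B) := by ring
            _ ≤ κ * p * (1 * A + (1 + s) * ((1 + s) * p) * B) := by
                gcongr
                linarith
            _ = _ := by ring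
        have h3 : 0 ≤ (1 + s) * ((1 + s) * p) := by positivity
        nlinarith
      rw [e3, ← e2]
      change 0 ≤ A' s + _ + (A + (1 + s) ^ (1 - α) * B) * _
      rw [e4] at hB'' ⊢
      -- The derivative of the weight `(1 + s)^{1-α}` absorbs the influence of the velocity
      -- difference on the position; this is the use of `κ ≤ 1 - α`.
      have h5 : κ * (((1 + s) * p) * B) ≤ (1 - α) * (((1 + s) * p) * B) := by gcongr
      have h6 : 0 ≤ κ * p * ((1 + s) * ((1 + s) * p) * B) := by positivity
      have h7 : 0 ≤ κ * p * B := by positivity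
      nlinarith
  have hfin := hmono (left_mem_Icc.2 ht) (right_mem_Icc.2 ht) ht
  have hq0 : ∀ s, 0 ≤ s → 0 ≤ q s := fun s hs => by
    have : 0 ≤ (1 + s) ^ (1 - α) := Real.rpow_nonneg (by linarith) _
    exact add_nonneg (Real.sqrt_nonneg _) (mul_nonneg this (Real.sqrt_nonneg _))
  -- The accumulated loss is at most `exp(2κ/α)`, and `κ ≤ α/4` bounds it by `exp(1/2) ≤ 2`.
  have hexp : Real.exp (m t - m 0) ≤ 2 := by
    have h1 : m t - m 0 ≤ 1 / 2 := by
      have hpt : 0 ≤ (1 + t) ^ (-α) := Real.rpow_nonneg (by linarith) _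
      have e : m t - m 0 = 2 * κ / α * (1 - (1 + t) ^ (-α)) := by
        rw [hm]
        simp only [add_zero, Real.one_rpow]
        field_simp
        ring
      rw [e]
      have h2 : 2 * κ / α ≤ 1 / 2 := by rw [div_le_iff₀ hα]; linarith
      have h3 : 0 ≤ 2 * κ / α := by positivity
      nlinarith
    have h2 : Real.exp (1 / 2) ≤ 2 := by
      have h3 : Real.exp (1 / 2) ^ 2 = Real.exp 1 := by rw [← Real.exp_nat_mul]; norm_num
      have h4 := Real.exp_one_lt_d9
      nlinarith [Real.exp_pos (1 / 2)]
    exact (Real.exp_le_exp.2 h1).trans h2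
  have e0 : smoothNorm ε (a 0) + smoothNorm ε (b 0) = q 0 := by simp [hq]
  rw [e0]
  change q 0 ≤ 2 * q t
  have h1 : q 0 ≤ q t * Real.exp (m t - m 0) := by
    rw [Real.exp_sub, ← mul_div_assoc, le_div_iff₀ (Real.exp_pos _)]
    exact hfin
  have := mul_le_mul_of_nonneg_left hexp (hq0 t ht)
  linarith

/-- Two twisted characteristics that are close at time `t` are close at time `0`, with a loss of
`(1 + t)^{1-α}` in the velocity. -/
lemma ForceField.backward_stability (hE : ForceField α κ E) (hα : 0 < α) (hα' : α < 1)
    (hκ : κ ≤ 1 - α) (hκ' : κ ≤ α / 4) {t : ℝ} (ht : 0 ≤ t) (W W' : Phase) :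
    ‖evol (twisted E) t 0 W - evol (twisted E) t 0 W'‖ ≤
      2 * (‖W.1 - W'.1‖ + (1 + t) ^ (1 - α) * ‖W.2 - W'.2‖) := by
  have key : ∀ ε > 0, ‖evol (twisted E) t 0 W - evol (twisted E) t 0 W'‖ ≤
      2 * ((‖W.1 - W'.1‖ + ε) + (1 + t) ^ (1 - α) * (‖W.2 - W'.2‖ + ε)) := by
    intro ε hε
    have h := hE.backward_aux hα hα' hκ hκ' t W W' ht hε
    simp only [(hE.bddLipField hα).evol_self] at h
    have hpt : 0 ≤ (1 + t) ^ (1 - α) := Real.rpow_nonneg (by linarith) _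
    have h1 := smoothNorm_le hε.le (W.1 - W'.1)
    have h2 := mul_le_mul_of_nonneg_left (smoothNorm_le hε.le (W.2 - W'.2)) hpt
    have h3 := norm_le_smoothNorm ε (evol (twisted E) t 0 W - evol (twisted E) t 0 W').1
    have h4 := norm_le_smoothNorm ε (evol (twisted E) t 0 W - evol (twisted E) t 0 W').2
    have h5 : ‖evol (twisted E) t 0 W - evol (twisted E) t 0 W'‖ ≤
        ‖(evol (twisted E) t 0 W - evol (twisted E) t 0 W').1‖ +
        ‖(evol (twisted E) t 0 W - evol (twisted E) t 0 W').2‖ := by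
      rw [Prod.norm_def]
      exact max_le_add_of_nonneg (norm_nonneg _) (norm_nonneg _)
    simp only [Prod.fst_sub, Prod.snd_sub] at h3 h4 h5
    linarith
  have hlim : Tendsto (fun ε : ℝ => 2 * ((‖W.1 - W'.1‖ + ε) +
      (1 + t) ^ (1 - α) * (‖W.2 - W'.2‖ + ε))) (𝓝[>] 0)
      (𝓝 (2 * (‖W.1 - W'.1‖ + (1 + t) ^ (1 - α) * ‖W.2 - W'.2‖))) := by
    have : Continuous fun ε : ℝ => 2 * ((‖W.1 - W'.1‖ + ε) +
      (1 + t) ^ (1 - α) * (‖W.2 - W'.2‖ + ε)) := by fun_prop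
    have := this.tendsto 0
    simp only [add_zero] at this
    exact this.mono_left nhdsWithin_le_nhds
  exact ge_of_tendsto hlim (by filter_upwards [self_mem_nhdsWithin] with ε hε using key ε hε)

end

/-! ### Interaction integrals -/

section Interaction

variable {α lam : ℝ} {F₀ : Phase → ℝ} {p p' : Phase → Space}

lemma integrable_interaction (hα : 0 < α) (hF : Measurable F₀) (hp : Measurable p) (a : Space)
    (h : ∫⁻ z, ENNReal.ofReal (‖a - p z‖ ^ (-(α + 1))) * ‖F₀ z‖ₑ ≠ ⊤) :
    Integrable fun z => F₀ z • kernel α lam (a - p z) := by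
  have hm : Measurable fun z => F₀ z • kernel α lam (a - p z) :=
    hF.smul ((measurable_kernel α lam).comp (measurable_const.sub hp))
  refine ⟨hm.aestronglyMeasurable, ?_⟩
  rw [hasFiniteIntegral_iff_enorm]
  calc ∫⁻ z, ‖F₀ z • kernel α lam (a - p z)‖ₑ
      = ∫⁻ z, ENNReal.ofReal |α * lam| *
          (ENNReal.ofReal (‖a - p z‖ ^ (-(α + 1))) * ‖F₀ z‖ₑ) := by
        refine lintegral_congr fun z => ?_
        rw [enorm_smul, ← ofReal_norm (kernel α lam _), norm_kernel hα,
          ENNReal.ofReal_mul (abs_nonneg _)]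
        ring
    _ = ENNReal.ofReal |α * lam| *
          ∫⁻ z, ENNReal.ofReal (‖a - p z‖ ^ (-(α + 1))) * ‖F₀ z‖ₑ :=
        lintegral_const_mul' _ _ ENNReal.ofReal_ne_top
    _ < ⊤ := ENNReal.mul_lt_top ENNReal.ofReal_lt_top h.lt_top

/-- Differencing the kernel raises the singularity from `α + 1` to `α + 2`. The density `u`
dominates `F₀` times the displacement, so a displacement growing with `x` can be charged to a weight
in `u`. -/
lemma norm_interaction_sub_le (hα : 0 < α) {u : Phase → ℝ} (hu : Measurable u)
    (hp : Measurable p) {M δ : ℝ} (hM : 0 ≤ M) (hδ : 0 ≤ δ) {a a' : Space}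
    (hi : Integrable fun z => F₀ z • kernel α lam (a - p z))
    (hi' : Integrable fun z => F₀ z • kernel α lam (a' - p' z))
    (h : ∫⁻ z, ENNReal.ofReal (‖a - p z‖ ^ (-(α + 2))) * ‖u z‖ₑ ≤ ENNReal.ofReal M)
    (h' : ∫⁻ z, ENNReal.ofReal (‖a' - p' z‖ ^ (-(α + 2))) * ‖u z‖ₑ ≤ ENNReal.ofReal M)
    (hdiff : ∀ z, |F₀ z| * ‖(a - p z) - (a' - p' z)‖ ≤ δ * |u z|) :
    ‖(∫ z, F₀ z • kernel α lam (a - p z)) - ∫ z, F₀ z • kernel α lam (a' - p' z)‖ ≤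
      |α * lam| * (α + 3) * (2 * M) * δ := by
  have hc : 0 ≤ |α * lam| * (α + 3) * δ := by positivity
  rw [← integral_sub hi hi']
  refine (ENNReal.ofReal_le_ofReal_iff (by positivity)).1 ?_
  rw [ofReal_norm]
  refine (enorm_integral_le_lintegral_enorm _).trans ?_
  calc ∫⁻ z, ‖F₀ z • kernel α lam (a - p z) - F₀ z • kernel α lam (a' - p' z)‖ₑ
      ≤ ∫⁻ z, ENNReal.ofReal (|α * lam| * (α + 3) * δ) *
          (ENNReal.ofReal (‖a - p z‖ ^ (-(α + 2))) * ‖u z‖ₑ +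
            ENNReal.ofReal (‖a' - p' z‖ ^ (-(α + 2))) * ‖u z‖ₑ) := by
        refine lintegral_mono fun z => ?_
        have hP : 0 ≤ ‖a - p z‖ ^ (-(α + 2)) := by positivity
        have hP' : 0 ≤ ‖a' - p' z‖ ^ (-(α + 2)) := by positivity
        rw [← smul_sub, ← ofReal_norm, ← add_mul, ← ENNReal.ofReal_add hP hP', ← ofReal_norm (u z),
          ← ENNReal.ofReal_mul (by positivity), ← ENNReal.ofReal_mul hc]
        refine ENNReal.ofReal_le_ofReal ?_
        rw [norm_smul, Real.norm_eq_abs, Real.norm_eq_abs]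
        have hk := norm_kernel_sub_le hα lam (a - p z) (a' - p' z)
        set d := ‖(a - p z) - (a' - p' z)‖
        set S := ‖a - p z‖ ^ (-(α + 2)) + ‖a' - p' z‖ ^ (-(α + 2))
        have hS : 0 ≤ S := add_nonneg hP hP'
        calc |F₀ z| * ‖kernel α lam (a - p z) - kernel α lam (a' - p' z)‖
            ≤ |F₀ z| * (|α * lam| * (α + 3) * (d * S)) := by gcongr
          _ = |α * lam| * (α + 3) * (|F₀ z| * d) * S := by ring
          _ ≤ |α * lam| * (α + 3) * (δ * |u z|) * S :=
              mul_le_mul_of_nonneg_right (mul_le_mul_of_nonneg_left (hdiff z) (by positivity)) hS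
          _ = _ := by ring
    _ = ENNReal.ofReal (|α * lam| * (α + 3) * δ) *
          ((∫⁻ z, ENNReal.ofReal (‖a - p z‖ ^ (-(α + 2))) * ‖u z‖ₑ) +
            ∫⁻ z, ENNReal.ofReal (‖a' - p' z‖ ^ (-(α + 2))) * ‖u z‖ₑ) := by
        rw [lintegral_const_mul' _ _ ENNReal.ofReal_ne_top, lintegral_add_left]
        exact ((((measurable_const.sub hp).norm).pow_const _).ennreal_ofReal).mul hu.enorm
    _ ≤ ENNReal.ofReal (|α * lam| * (α + 3) * δ) * (ENNReal.ofReal M + ENNReal.ofReal M) := by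
        gcongr
    _ = ENNReal.ofReal (|α * lam| * (α + 3) * (2 * M) * δ) := by
        rw [← ENNReal.ofReal_add hM hM, ← ENNReal.ofReal_mul hc]
        congr 1; ring

end Interaction

/-! ### The scattering argument -/

/-- The interaction constant. -/
def interactionConst (α lam : ℝ) : ℝ :=
  |α * lam| * (α + 3) * (2 * (1 + 8 * (singMass (α + 2)).toReal))

/-- A force field generated by the transport of the density `F₀`, with weighted bounds of size `η`
on `F₀`. -/
structure ScatteringData (α lam κ η B : ℝ) (E : ℝ → Space → Space) (F₀ : Phase → ℝ) : Prop where
  field : ForceField α κ E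
  alpha_pos : 0 < α
  alpha_lt : α < 1
  kappa_le : κ ≤ α / 4
  kappa_le' : κ ≤ 1 - α
  eta_pos : 0 < η
  kappa_le_eta : κ ≤ B * η
  cont : Continuous F₀
  norm_one : eLpNorm (fun z => bracket z.1 * F₀ z) 1 volume ≤ ENNReal.ofReal η
  norm_xv : normXV 1 ⊤ (fun z => bracket z.1 * F₀ z) ≤ ENNReal.ofReal η
  lip : ∀ z z', |F₀ z - F₀ z'| ≤ B * η * ‖z - z'‖ / bracket z.1
  repr : ∀ t, 0 ≤ t → ∀ x, E t x = -∫ z, F₀ z • kernel α lam (x - charX E t z)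

lemma continuous_bracket {G : Type*} [NormedAddCommGroup G] :
    Continuous (bracket : G → ℝ) := by unfold bracket; fun_prop

lemma abs_le_abs_weighted (F₀ : Phase → ℝ) (z : Phase) : |F₀ z| ≤ |bracket z.1 * F₀ z| := by
  rw [abs_mul, abs_of_nonneg (zero_le_one.trans (one_le_bracket z.1))]
  exact le_mul_of_one_le_left (abs_nonneg _) (one_le_bracket _)

/-- The velocity correction generated by `F₀`. -/
def corr (α lam : ℝ) (E : ℝ → Space → Space) (F₀ : Phase → ℝ) (v : Space) : Space :=
  -∫ z, F₀ z • kernel α lam (v - asymV E z)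

namespace ScatteringData

variable {α lam κ η B : ℝ} {E : ℝ → Space → Space} {F₀ : Phase → ℝ}

lemma measurable_weighted (h : ScatteringData α lam κ η B E F₀) :
    Measurable fun z : Phase => bracket z.1 * F₀ z :=
  ((continuous_bracket.comp continuous_fst).mul h.cont).measurable

lemma sing_le (h : ScatteringData α lam κ η B E F₀) {β : ℝ} (hβ : 0 < β) (hβ' : β < 3)
    {p : Phase → Space} (hp : Measurable p) (hanti : ∀ x, AntilipschitzWith 2 fun v => p (x, v))
    (a : Space) :
    ∫⁻ z, ENNReal.ofReal (‖a - p z‖ ^ (-β)) * ‖bracket z.1 * F₀ z‖ₑ ≤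
      ENNReal.ofReal (η * (1 + 8 * (singMass β).toReal)) := by
  refine (lintegral_singular_le hβ hβ' hp hanti h.measurable_weighted a).trans ?_
  have hη := h.eta_pos.le
  have e : ENNReal.ofReal (η * (1 + 8 * (singMass β).toReal)) =
      ENNReal.ofReal η + 8 * singMass β * ENNReal.ofReal η := by
    have h8 : 8 * singMass β = ENNReal.ofReal (8 * (singMass β).toReal) := by
      rw [ENNReal.ofReal_mul (by norm_num), ENNReal.ofReal_toReal (singMass_ne_top hβ')]
      norm_num
    rw [h8, ← ENNReal.ofReal_mul (by positivity), ← ENNReal.ofReal_add hη (by positivity)]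
    congr 1; ring
  rw [e]
  gcongr
  · exact h.norm_one
  · exact h.norm_xv

lemma integrable (h : ScatteringData α lam κ η B E F₀) {p : Phase → Space} (hp : Measurable p)
    (hanti : ∀ x, AntilipschitzWith 2 fun v => p (x, v)) (a : Space) :
    Integrable fun z => F₀ z • kernel α lam (a - p z) := by
  have hα := h.alpha_pos
  have hα' := h.alpha_lt
  refine integrable_interaction hα h.cont.measurable hp a (ne_top_of_le_ne_top
    ENNReal.ofReal_ne_top ((lintegral_mono fun z => ?_).trans
    (h.sing_le (β := α + 1) (by linarith) (by linarith) hp hanti a)))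
  gcongr
  rw [← ofReal_norm, ← ofReal_norm]
  exact ENNReal.ofReal_le_ofReal (abs_le_abs_weighted _ z)

/-- The weight in the data pays for displacements of size `δ ⟨x⟩`, and `α + 2 < 3` keeps the
differenced kernel integrable. -/
lemma interaction_sub_le (h : ScatteringData α lam κ η B E F₀) {p p' : Phase → Space}
    (hp : Measurable p) (hanti : ∀ x, AntilipschitzWith 2 fun v => p (x, v))
    (hp' : Measurable p') (hanti' : ∀ x, AntilipschitzWith 2 fun v => p' (x, v)) {δ : ℝ}
    (hδ : 0 ≤ δ) {a a' : Space} (hd : ∀ z, ‖(a - p z) - (a' - p' z)‖ ≤ δ * bracket z.1) :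
    ‖(∫ z, F₀ z • kernel α lam (a - p z)) - ∫ z, F₀ z • kernel α lam (a' - p' z)‖ ≤
      interactionConst α lam * η * δ := by
  have hα := h.alpha_pos
  have hα' := h.alpha_lt
  have hη := h.eta_pos
  have := norm_interaction_sub_le (lam := lam) hα h.measurable_weighted hp
    (M := η * (1 + 8 * (singMass (α + 2)).toReal)) (by positivity) hδ
    (h.integrable hp hanti a) (h.integrable hp' hanti' a')
    (h.sing_le (by linarith) (by linarith) hp hanti a)
    (h.sing_le (by linarith) (by linarith) hp' hanti' a') (fun z => by
      rw [abs_mul, abs_of_nonneg (zero_le_one.trans (one_le_bracket z.1))]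
      have := mul_le_mul_of_nonneg_left (hd z) (abs_nonneg (F₀ z))
      linarith)
  refine this.trans_eq ?_
  rw [interactionConst]; ring

lemma interactionConst_nonneg (h : ScatteringData α lam κ η B E F₀) :
    0 ≤ interactionConst α lam := by
  have := h.alpha_pos
  unfold interactionConst; positivity

lemma kappa_le_third (h : ScatteringData α lam κ η B E F₀) : κ ≤ α / 3 := by
  have := h.alpha_pos; linarith [h.kappa_le]

lemma kappa_le_one (h : ScatteringData α lam κ η B E F₀) : κ ≤ 1 := by
  have := h.alpha_pos; linarith [h.kappa_le']

lemma corr_lip (h : ScatteringData α lam κ η B E F₀) (a a' : Space) :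
    ‖corr α lam E F₀ a - corr α lam E F₀ a'‖ ≤ interactionConst α lam * η * ‖a - a'‖ := by
  have hm := h.field.measurable_asymV h.alpha_pos
  have hanti := h.field.antilipschitz_asymV h.alpha_pos h.kappa_le_third
  have := h.interaction_sub_le (a := a) (a' := a') hm hanti hm hanti (norm_nonneg (a - a'))
    (fun z => by
      rw [sub_sub_sub_cancel_right]
      exact le_mul_of_one_le_right (norm_nonneg _) (one_le_bracket _))
  rw [corr, corr, neg_sub_neg, norm_sub_rev]
  exact this

/-- The force along rays is asymptotically given by the velocity correction. -/
lemma force_asymptotics (h : ScatteringData α lam κ η B E F₀) {t : ℝ} (ht : 1 ≤ t) (a : Space) :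
    ‖E t (t • a) - t ^ (-(1 + α)) • corr α lam E F₀ a‖ ≤
      interactionConst α lam * (1 + 2 / (1 - α) + 1 / α) * η * t ^ (-(1 + 2 * α)) := by
  have hα := h.alpha_pos
  have hα' := h.alpha_lt
  have h1α : 0 < 1 - α := by linarith
  have ht0 : 0 < t := by linarith
  have hm := h.field.measurable_asymV hα
  have hanti := h.field.antilipschitz_asymV hα h.kappa_le_third
  have hm' : Measurable fun z => t⁻¹ • charX E t z :=
    ((h.field.continuous_charX hα ht0.le).const_smul t⁻¹).measurable
  have hanti' := h.field.antilipschitz_charX_v hα h.kappa_le_third ht0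
  have key := h.interaction_sub_le (a := a) (a' := a) hm hanti hm' hanti'
    (δ := (1 + 2 / (1 - α) + 1 / α) * t ^ (-α)) (by positivity) (fun z => by
      rw [sub_sub_sub_cancel_left, norm_sub_rev]
      refine (h.field.norm_asymV_sub_charX_le hα hα' h.kappa_le_one z ht).trans_eq (by ring))
  -- Homogeneity of the kernel turns positions at time `t` into average velocities, extracting the
  -- factor `t^{-(1+α)}`.
  have e : E t (t • a) = -(t ^ (-(1 + α)) • ∫ z, F₀ z • kernel α lam (a - t⁻¹ • charX E t z)) := by
    rw [h.repr t ht0.le, ← integral_smul]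
    congr 1
    refine integral_congr_ae (Eventually.of_forall fun z => ?_)
    have : t • a - charX E t z = t • (a - t⁻¹ • charX E t z) := by
      rw [smul_sub, smul_smul, mul_inv_cancel₀ ht0.ne', one_smul]
    simp only
    rw [this, kernel_smul α lam ht0, smul_comm]
  rw [e, corr, smul_neg, neg_sub_neg, ← smul_sub, norm_smul,
    Real.norm_of_nonneg (Real.rpow_nonneg ht0.le _)]
  calc _ ≤ t ^ (-(1 + α)) *
        (interactionConst α lam * η * ((1 + 2 / (1 - α) + 1 / α) * t ^ (-α))) := by gcongr
    _ = interactionConst α lam * (1 + 2 / (1 - α) + 1 / α) * η *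
          (t ^ (-(1 + α)) * t ^ (-α)) := by ring
    _ = _ := by rw [← Real.rpow_add ht0]; congr 2; ring

/-- The reference trajectory in the twisted coordinates. -/
def refTwisted (α : ℝ) (A : Space → Space) (t : ℝ) (z : Phase) : Phase :=
  (z.1 - ((t ^ (1 - α) - 1) / (1 - α)) • A z.2, z.2)

/-- The constant of `pullback_step`. -/
def stepConst (α lam B : ℝ) : ℝ :=
  2 * (interactionConst α lam * ((1 + 2 / (1 - α) + 1 / α) + (3 + 2 / (1 - α))) + 3 * B)

/-- The true curve through the reference point at time `t` pulls back from time `t + d` to the same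
initial point. It therefore suffices to compare this curve with the reference point at time `t + d`
and apply backward stability once. Finite steps are used because the flow is only known to be
Lipschitz in its starting point. -/
lemma pullback_step (h : ScatteringData α lam κ η B E F₀) {t d : ℝ} (ht : 1 ≤ t) (hd : 0 ≤ d)
    (hd1 : d ≤ 1) (z : Phase) :
    ‖evol (twisted E) t 0 (refTwisted α (corr α lam E F₀) t z) -
      evol (twisted E) (t + d) 0 (refTwisted α (corr α lam E F₀) (t + d) z)‖ ≤
      stepConst α lam B * η * d * t ^ (-(2 * α)) *
        bracket (evol (twisted E) t 0 (refTwisted α (corr α lam E F₀) t z)).1 := by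
  have hα := h.alpha_pos
  have hα' := h.alpha_lt
  have h1α : 0 < 1 - α := by linarith
  have ht0 : 0 < t := by linarith
  have hκ0 := h.field.kappa_nonneg
  have hc := h.field.bddLipField hα
  have hη := h.eta_pos
  have hI := h.interactionConst_nonneg
  set A := corr α lam E F₀ with hA
  set W := refTwisted α A t z with hW
  set Z := evol (twisted E) t 0 W with hZ
  set w : ℝ → Phase := fun s => evol (twisted E) t s W with hw
  have hwt : w t = W := hc.evol_self t W
  -- The weight is taken at the pulled-back point, where the Lipschitz bound on `F₀` will be
  -- applied.
  set b := bracket Z.1 with hbdef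
  have hb := one_le_bracket Z.1
  have hbn := norm_le_bracket Z.1
  set T := t ^ (-α) with hT
  have hT0 : 0 ≤ T := Real.rpow_nonneg ht0.le _
  have hTinv : t⁻¹ ≤ T := by
    rw [← Real.rpow_neg_one]
    exact Real.rpow_le_rpow_of_exponent_le ht (by linarith)
  have hTt : t⁻¹ * t ^ (1 - α) = T := by
    rw [← Real.rpow_neg_one, ← Real.rpow_add ht0]; congr 1; ring
  have hTT : T * T = t ^ (-(2 * α)) := by rw [hT, ← Real.rpow_add ht0]; congr 1; ring
  have hbound : ∀ s, t ≤ s → ∀ x, ‖E s x‖ ≤ κ * (t⁻¹ * T) := by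
    intro s hs x
    refine (h.field.bound s x).trans ?_
    rw [abs_of_nonneg (by linarith)]
    have : (1 + s) ^ (-(1 + α)) ≤ t ^ (-(1 + α)) :=
      Real.rpow_le_rpow_of_nonpos ht0 (by linarith) (by linarith)
    have e : t ^ (-(1 + α)) = t⁻¹ * T := by
      rw [← Real.rpow_neg_one, ← Real.rpow_add ht0]; congr 1; ring
    rw [← e]
    gcongr
  have hV : ∀ s ∈ Icc t (t + 1), ‖(w s).2 - z.2‖ ≤ κ * (t⁻¹ * T) * (s - t) := by
    intro s hs
    have := norm_sub_le_of_deriv_le (g := fun s => κ * (t⁻¹ * T) * s)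
      (g' := fun _ => κ * (t⁻¹ * T)) hs.1 (fun q _ => h.field.hasDerivAt_snd hα t q W)
      (fun q _ => by simpa using (hasDerivAt_id q).const_mul (κ * (t⁻¹ * T)))
      (fun q hq => hbound q hq.1 _)
    rw [hc.evol_self] at this
    refine this.trans_eq (by ring)
  have hξ : ∀ s ∈ Icc t (t + 1), ‖(w s).1 - W.1‖ ≤ 1 := by
    intro s hs
    have := norm_sub_le_of_deriv_le (g := fun s => s)
      (g' := fun _ => 1) hs.1 (fun q _ => h.field.hasDerivAt_fst hα t q W)
      (fun q _ => hasDerivAt_id q)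
      (fun q hq => by
        have hq0 : 0 ≤ q := ht0.le.trans hq.1
        rw [norm_neg, norm_smul, Real.norm_of_nonneg hq0]
        have h1 := h.field.bound q ((evol (twisted E) t q W).1 + q • (evol (twisted E) t q W).2)
        rw [abs_of_nonneg hq0] at h1
        calc _ ≤ (1 + q) * (κ * (1 + q) ^ (-(1 + α))) := by gcongr; linarith
          _ = κ * ((1 + q) * (1 + q) ^ (-(α + 1))) := by
              rw [show -(1 + α) = -(α + 1) by ring]; ring
          _ ≤ 1 * 1 := by
              rw [one_add_mul_rpow hq0]
              have := rpow_neg_le_one hq0 hα.le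
              have : 0 ≤ (1 + q) ^ (-α) := Real.rpow_nonneg (by linarith) _
              gcongr
              exact h.kappa_le_one
          _ = 1 := one_mul 1)
    rw [hc.evol_self] at this
    linarith [hs.2]
  have hWn : ‖W.1‖ ≤ b + 2 / (1 - α) * t ^ (1 - α) := by
    have h1 := h.field.norm_fst_sub_le hα hα' W t ht0.le
    rw [hc.evol_self] at h1
    have h2 := norm_sub_norm_le W.1 Z.1
    have h3 : κ / (1 - α) * (1 + t) ^ (1 - α) ≤ 1 / (1 - α) * (2 * t ^ (1 - α)) := by
      have := h.kappa_le_one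
      gcongr
      exact one_add_rpow_le ht hα hα'
    have e : 1 / (1 - α) * (2 * t ^ (1 - α)) = 2 / (1 - α) * t ^ (1 - α) := by ring
    linarith
  -- The point at which the force acts is `s` times a direction within `O(b t^{-α})` of `z.2`: the
  -- drift bound controls the reference position by `b + O(t^{1-α})`, which is then divided by `s`.
  have hdir : ∀ s ∈ Icc t (t + 1), ‖s⁻¹ • ((w s).1 + s • (w s).2) - z.2‖ ≤
      (3 + 2 / (1 - α)) * b * T := by
    intro s hs
    have hs0 : 0 < s := ht0.trans_le hs.1
    have e : s⁻¹ • ((w s).1 + s • (w s).2) - z.2 = s⁻¹ • (w s).1 + ((w s).2 - z.2) := by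
      rw [smul_add, smul_smul, inv_mul_cancel₀ hs0.ne', one_smul]; abel
    rw [e]
    refine (norm_add_le _ _).trans ?_
    rw [norm_smul, norm_inv, Real.norm_of_nonneg hs0.le]
    have h1 : ‖(w s).1‖ ≤ 1 + ‖W.1‖ := by
      have := norm_sub_norm_le (w s).1 W.1
      linarith [hξ s hs]
    have h2 : ‖(w s).2 - z.2‖ ≤ T := by
      refine (hV s hs).trans ?_
      have h3 : κ * (t⁻¹ * T) * (s - t) ≤ 1 * (1 * T) * 1 := by
        have := h.kappa_le_one
        have : t⁻¹ ≤ 1 := inv_le_one_of_one_le₀ ht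
        have := hs.1
        have := hs.2
        gcongr
        linarith
      linarith
    have hsi : s⁻¹ ≤ t⁻¹ := inv_anti₀ ht0 hs.1
    calc s⁻¹ * ‖(w s).1‖ + ‖(w s).2 - z.2‖
        ≤ t⁻¹ * (1 + (b + 2 / (1 - α) * t ^ (1 - α))) + T := by
          gcongr
          linarith
      _ = t⁻¹ * (1 + b) + 2 / (1 - α) * (t⁻¹ * t ^ (1 - α)) + T := by ring
      _ ≤ T * (1 + b) + 2 / (1 - α) * T + T := by
          rw [hTt]; gcongr
      _ ≤ (3 + 2 / (1 - α)) * b * T := by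
          have h3 : 0 ≤ (2 / (1 - α)) * T := by positivity
          nlinarith
  set P := interactionConst α lam * ((1 + 2 / (1 - α) + 1 / α) + (3 + 2 / (1 - α))) with hP
  have hder : ∀ s ∈ Icc t (t + d), ‖-(s • E s ((w s).1 + s • (w s).2)) +
      s ^ (-α) • A z.2‖ ≤ P * η * b * (T * T) := by
    intro s hs
    have hs' : s ∈ Icc t (t + 1) := ⟨hs.1, hs.2.trans (by linarith)⟩
    have hs1 : 1 ≤ s := ht.trans hs.1
    have hs0 : 0 < s := by linarith
    set a := s⁻¹ • ((w s).1 + s • (w s).2) with ha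
    have hsa : (w s).1 + s • (w s).2 = s • a := by
      rw [ha, smul_smul, mul_inv_cancel₀ hs0.ne', one_smul]
    have hsT : s ^ (-α) ≤ T := Real.rpow_le_rpow_of_nonpos ht0 hs.1 (by linarith)
    have hsT0 : 0 ≤ s ^ (-α) := Real.rpow_nonneg hs0.le _
    have e1 : s * s ^ (-(1 + α)) = s ^ (-α) := by
      nth_rw 1 [← Real.rpow_one s]
      rw [← Real.rpow_add hs0]; congr 1; ring
    have e2 : s * s ^ (-(1 + 2 * α)) = s ^ (-α) * s ^ (-α) := by
      nth_rw 1 [← Real.rpow_one s]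
      rw [← Real.rpow_add hs0, ← Real.rpow_add hs0]; congr 1; ring
    -- Two errors of size `η t^{-2α}`, up to the weight: the force against its asymptotic profile at
    -- the actual direction `a`, and the profile at `a` against its value at `z.2`.
    have e : -(s • E s ((w s).1 + s • (w s).2)) + s ^ (-α) • A z.2 =
        -(s • (E s (s • a) - s ^ (-(1 + α)) • A a)) - s ^ (-α) • (A a - A z.2) := by
      rw [hsa]
      generalize a = q
      rw [smul_sub, smul_smul s (s ^ (-(1 + α))), e1, smul_sub]; abel
    rw [e]
    refine (norm_sub_le _ _).trans ?_
    rw [norm_neg, norm_smul, norm_smul, Real.norm_of_nonneg hs0.le, Real.norm_of_nonneg hsT0]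
    have h1 := h.force_asymptotics hs1 a
    have h2 := h.corr_lip a z.2
    have h3 := hdir s hs'
    have hsTT : s ^ (-α) * s ^ (-α) ≤ T * T := by gcongr
    set I := interactionConst α lam
    set c2 := 1 + 2 / (1 - α) + 1 / α
    set c4 := 3 + 2 / (1 - α)
    have hc2 : 0 ≤ c2 := by positivity
    have hc4 : 0 ≤ c4 := by positivity
    calc s * ‖E s (s • a) - s ^ (-(1 + α)) • A a‖ + s ^ (-α) * ‖A a - A z.2‖
        ≤ s * (I * c2 * η * s ^ (-(1 + 2 * α))) + T * (I * η * (c4 * b * T)) := by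
          gcongr
          refine h2.trans ?_
          gcongr
      _ = I * c2 * η * (s * s ^ (-(1 + 2 * α))) + I * η * c4 * b * (T * T) := by ring
      _ ≤ I * c2 * η * (b * (T * T)) + I * η * c4 * b * (T * T) := by
          rw [e2]
          have : s ^ (-α) * s ^ (-α) ≤ b * (T * T) :=
            hsTT.trans (le_mul_of_one_le_left (mul_nonneg hT0 hT0) hb)
          have hIc : 0 ≤ I * c2 * η := by positivity
          linarith [mul_le_mul_of_nonneg_left this hIc]
      _ = _ := by rw [hP]; ring
  have hθ : ∀ s ∈ Icc t (t + d), HasDerivAt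
      (fun s : ℝ => ((s ^ (1 - α) - 1) / (1 - α)) • A z.2) (s ^ (-α) • A z.2) s := by
    intro s hs
    have hs0 : 0 < s := ht0.trans_le hs.1
    have h1 := ((((hasDerivAt_id s).rpow_const (p := 1 - α) (Or.inl hs0.ne')).sub_const 1).div_const
      (1 - α)).smul_const (A z.2)
    convert! h1 using 2
    simp only [id, one_mul]
    rw [show 1 - α - 1 = -α by ring]
    field_simp
  have hξd : ‖(w (t + d)).1 - (refTwisted α A (t + d) z).1‖ ≤ P * η * b * (T * T) * d := by
    have := norm_sub_le_of_deriv_le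
      (f := fun s => (w s).1 + ((s ^ (1 - α) - 1) / (1 - α)) • A z.2)
      (g := fun s => P * η * b * (T * T) * s) (g' := fun _ => P * η * b * (T * T))
      (by linarith : t ≤ t + d)
      (fun s hs => (h.field.hasDerivAt_fst hα t s W).add (hθ s hs))
      (fun s _ => by simpa using (hasDerivAt_id s).const_mul (P * η * b * (T * T)))
      hder
    rw [hwt] at this
    have e : (w (t + d)).1 - (refTwisted α A (t + d) z).1 =
        (w (t + d)).1 + (((t + d) ^ (1 - α) - 1) / (1 - α)) • A z.2 -
          (W.1 + ((t ^ (1 - α) - 1) / (1 - α)) • A z.2) := by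
      simp only [hW, refTwisted]; abel
    rw [e]
    refine this.trans_eq (by ring)
  have hVd : ‖(w (t + d)).2 - (refTwisted α A (t + d) z).2‖ ≤ κ * (t⁻¹ * T) * d := by
    have := hV (t + d) ⟨by linarith, by linarith⟩
    simpa [refTwisted] using this
  have hback := h.field.backward_stability hα hα' h.kappa_le' h.kappa_le
    (by linarith : 0 ≤ t + d) (w (t + d)) (refTwisted α A (t + d) z)
  rw [show evol (twisted E) (t + d) 0 (w (t + d)) = Z from hc.evol_evol t (t + d) 0 W] at hback
  refine hback.trans ?_
  -- The velocity error `κ t^{-1-α} d` times this loss is again of order `t^{-2α} d`.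
  have h3t : (1 + (t + d)) ^ (1 - α) ≤ 3 * t ^ (1 - α) := by
    calc (1 + (t + d)) ^ (1 - α) ≤ (3 * t) ^ (1 - α) := by
          have : 1 + (t + d) ≤ 3 * t := by linarith
          gcongr
      _ = 3 ^ (1 - α) * t ^ (1 - α) := Real.mul_rpow (by norm_num) ht0.le
      _ ≤ 3 ^ (1 : ℝ) * t ^ (1 - α) := by
          gcongr
          · norm_num
          · linarith
      _ = _ := by simp
  have hBη := h.kappa_le_eta
  have hP0 : 0 ≤ P := by positivity
  calc 2 * (‖(w (t + d)).1 - (refTwisted α A (t + d) z).1‖ + (1 + (t + d)) ^ (1 - α) *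
        ‖(w (t + d)).2 - (refTwisted α A (t + d) z).2‖)
      ≤ 2 * (P * η * b * (T * T) * d + 3 * t ^ (1 - α) * (κ * (t⁻¹ * T) * d)) := by gcongr
    _ = 2 * (P * η * b * (T * T) * d + 3 * κ * d * ((t⁻¹ * t ^ (1 - α)) * T)) := by ring
    _ = 2 * (P * η * b * (T * T) * d + 3 * κ * d * (T * T)) := by rw [hTt]
    _ ≤ 2 * (P * η * b * (T * T) * d + 3 * (B * η) * d * (b * (T * T))) := by
        have hBη0 : 0 ≤ B * η := hκ0.trans hBη
        have : T * T ≤ b * (T * T) := le_mul_of_one_le_left (mul_nonneg hT0 hT0) hb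
        gcongr
    _ = _ := by rw [← hTT, stepConst]; ring

end ScatteringData

/-! ### Convergence from short steps -/

/-- Mean value theorem for `s^{1-p}`; the intermediate point is at most `2 t`, which costs `2 ^ p`.
The right side telescopes over successive steps. -/
lemma step_le_rpow_sub {p t d : ℝ} (hp : 1 < p) (ht : 1 ≤ t) (hd : 0 ≤ d) (hd1 : d ≤ 1) :
    d * t ^ (-p) ≤ 2 ^ p / (p - 1) * (t ^ (1 - p) - (t + d) ^ (1 - p)) := by
  rcases hd.eq_or_lt with rfl | hd
  · simp
  have ht0 : 0 < t := by linarith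
  have hp1 : 0 < p - 1 := by linarith
  obtain ⟨c, hc, hc'⟩ := exists_hasDerivAt_eq_slope (fun s : ℝ => s ^ (1 - p))
    (fun s => (1 - p) * s ^ (1 - p - 1)) (by linarith : t < t + d)
    (fun s hs => (Real.continuousAt_rpow_const _ _ (Or.inl (ht0.trans_le hs.1).ne')).continuousWithinAt)
    (fun s hs => Real.hasDerivAt_rpow_const (Or.inl (ht0.trans hs.1).ne'))
  have hc0 : 0 < c := ht0.trans hc.1
  rw [add_sub_cancel_left, eq_div_iff hd.ne', show 1 - p - 1 = -p by ring] at hc'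
  have e : t ^ (1 - p) - (t + d) ^ (1 - p) = (p - 1) * (c ^ (-p) * d) := by
    linear_combination hc'
  have h2 : t ^ (-p) ≤ 2 ^ p * c ^ (-p) := by
    have h3 : (2 * t) ^ (-p) ≤ c ^ (-p) :=
      Real.rpow_le_rpow_of_nonpos hc0 (by linarith [hc.2]) (by linarith)
    rw [Real.mul_rpow (by norm_num) ht0.le, Real.rpow_neg (by norm_num) p] at h3
    have h4 : (0 : ℝ) < 2 ^ p := by positivity
    calc t ^ (-p) = 2 ^ p * ((2 ^ p)⁻¹ * t ^ (-p)) := by field_simp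
      _ ≤ _ := by gcongr
  rw [e]
  calc d * t ^ (-p) ≤ d * (2 ^ p * c ^ (-p)) := by gcongr
    _ = _ := by field_simp

/-- Increments are dominated by decrements of `c t^{1-p}`. Induction over steps of length at most
one removes the restriction on `d`, and the remaining tail gives both the Cauchy property and the
rate. -/
lemma exists_limit_of_steps {G : ℝ → ℝ} {C p : ℝ} (hp : 1 < p) (hC : 0 ≤ C)
    (hG : ∀ t, 1 ≤ t → ∀ d, 0 ≤ d → d ≤ 1 → |G (t + d) - G t| ≤ C * (d * t ^ (-p))) :
    ∃ L, Tendsto G atTop (𝓝 L) ∧ ∀ t, 1 ≤ t → |G t - L| ≤ C * (2 ^ p / (p - 1)) * t ^ (1 - p) := by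
  set c := C * (2 ^ p / (p - 1)) with hc
  have hc0 : 0 ≤ c := by have : 0 < p - 1 := by linarith
                         positivity
  have hstep : ∀ t, 1 ≤ t → ∀ d, 0 ≤ d → d ≤ 1 →
      |G (t + d) - G t| ≤ c * t ^ (1 - p) - c * (t + d) ^ (1 - p) := by
    intro t ht d hd hd1
    refine (hG t ht d hd hd1).trans ?_
    refine (mul_le_mul_of_nonneg_left (step_le_rpow_sub hp ht hd hd1) hC).trans_eq ?_
    rw [hc]; ring
  have hind : ∀ n : ℕ, ∀ t, 1 ≤ t → ∀ d : ℝ, 0 ≤ d → d ≤ n →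
      |G (t + d) - G t| ≤ c * t ^ (1 - p) - c * (t + d) ^ (1 - p) := by
    intro n
    induction n with
    | zero =>
      intro t ht d hd hd1
      have : d = 0 := le_antisymm (by simpa using hd1) hd
      simp [this]
    | succ n ih =>
      intro t ht d hd hd1
      push_cast at hd1
      rcases le_total d 1 with h1 | h1
      · exact hstep t ht d hd h1
      have h2 := ih t ht (d - 1) (by linarith) (by linarith)
      have h3 := hstep (t + (d - 1)) (by linarith) 1 zero_le_one le_rfl
      rw [show t + (d - 1) + 1 = t + d by ring] at h3
      have := abs_sub_le (G (t + d)) (G (t + (d - 1))) (G t)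
      linarith
  have hfar : ∀ t, 1 ≤ t → ∀ s, t ≤ s → |G s - G t| ≤ c * t ^ (1 - p) := by
    intro t ht s hs
    obtain ⟨n, hn⟩ := exists_nat_ge (s - t)
    have := hind n t ht (s - t) (by linarith) hn
    rw [add_sub_cancel] at this
    have h0 : 0 ≤ c * s ^ (1 - p) := mul_nonneg hc0 (Real.rpow_nonneg (by linarith) _)
    linarith
  have hlim0 : Tendsto (fun t : ℝ => c * t ^ (1 - p)) atTop (𝓝 0) := by
    have := (tendsto_rpow_neg_atTop (show 0 < p - 1 by linarith)).const_mul c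
    simpa [neg_sub] using this
  have hcau : CauchySeq G := by
    refine Metric.cauchySeq_iff'.2 fun ε hε => ?_
    obtain ⟨N, hN, hN1⟩ := ((hlim0.eventually (gt_mem_nhds hε)).and (eventually_ge_atTop 1)).exists
    refine ⟨N, fun s hs => ?_⟩
    rw [Real.dist_eq]
    exact (hfar N hN1 s hs).trans_lt hN
  obtain ⟨L, hL⟩ := cauchySeq_tendsto_of_complete hcau
  refine ⟨L, hL, fun t ht => ?_⟩
  rw [abs_sub_comm]
  refine le_of_tendsto ((hL.sub_const (G t)).abs) ?_
  filter_upwards [eventually_ge_atTop t] with s hs using hfar t ht s hs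

/-- Convergence of the density along the reference flow. -/
lemma ScatteringData.exists_scattering_state {α lam κ η B : ℝ} {E : ℝ → Space → Space}
    {F₀ : Phase → ℝ} (h : ScatteringData α lam κ η B E F₀) (hα : 1 / 2 < α) (hB : 0 ≤ B)
    (z : Phase) :
    ∃ L, Tendsto (fun t => F₀ (evol (twisted E) t 0
        (ScatteringData.refTwisted α (corr α lam E F₀) t z))) atTop (𝓝 L) ∧
      ∀ t, 1 ≤ t → |F₀ (evol (twisted E) t 0
        (ScatteringData.refTwisted α (corr α lam E F₀) t z)) - L| ≤
          B * ScatteringData.stepConst α lam B * (2 ^ (2 * α) / (2 * α - 1)) * η ^ 2 /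
            t ^ (2 * α - 1) := by
  have hη := h.eta_pos
  have hα1 := h.alpha_lt
  have h1α : 0 < 1 - α := by linarith
  have hI := h.interactionConst_nonneg
  have hS : 0 ≤ ScatteringData.stepConst α lam B := by
    have := h.alpha_pos
    unfold ScatteringData.stepConst; positivity
  obtain ⟨L, hL, hL'⟩ := exists_limit_of_steps (p := 2 * α)
    (C := B * ScatteringData.stepConst α lam B * η ^ 2)
    (G := fun t => F₀ (evol (twisted E) t 0
      (ScatteringData.refTwisted α (corr α lam E F₀) t z))) (by linarith) (by positivity)
    (fun t ht d hd hd1 => by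
      -- The pulled-back point of time `t` must come first, so that the bracket dividing the
      -- Lipschitz bound cancels the one in `pullback_step`.
      rw [abs_sub_comm]
      refine (h.lip _ _).trans ?_
      have hb := one_le_bracket (evol (twisted E) t 0
        (ScatteringData.refTwisted α (corr α lam E F₀) t z)).1
      rw [div_le_iff₀ (by linarith)]
      refine (mul_le_mul_of_nonneg_left (h.pullback_step ht hd hd1 z) (by positivity)).trans_eq ?_
      ring)
  refine ⟨L, hL, fun t ht => (hL' t ht).trans_eq ?_⟩
  rw [show 1 - 2 * α = -(2 * α - 1) by ring, Real.rpow_neg (by linarith)]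
  ring

/-! ### Consequences of finite weak norms -/

lemma IsWeakDeriv.ae_eq {u g : Phase → ℝ} (h : IsWeakDeriv [] u g) : u =ᵐ[volume] g :=
  ae_eq_of_integral_contDiff_smul_eq h.1 h.2.1 fun φ hφ hc => by
    simpa [dirDeriv] using h.2.2 φ hφ hc

/-- A weak derivative of order zero is the function itself up to a null set, so every competitor in
the infimum has the same norm. -/
lemma le_weakNorm_nil {N : (Phase → ℝ) → ℝ≥0∞}
    (hN : ∀ u g : Phase → ℝ, u =ᵐ[volume] g → N u = N g) (u : Phase → ℝ) :
    N u ≤ weakNorm N [] u :=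
  le_iInf₂ fun g hg => (hN u g hg.ae_eq).le

lemma locallyIntegrable_of_weakNorm_lt_top {N : (Phase → ℝ) → ℝ≥0∞} {l : List Phase}
    {u : Phase → ℝ} (h : weakNorm N l u < ⊤) : LocallyIntegrable u := by
  obtain ⟨g, hg, -⟩ := exists_weakDeriv_of_weakNorm_lt h
  exact hg.1

lemma weakNorm_eLpNorm_nil_le (p : ℝ≥0∞) (u : Phase → ℝ) :
    weakNorm (fun g => eLpNorm g p volume) [] u ≤ sobolevNorm p u :=
  le_self_add.trans le_self_add

lemma eLpNorm_le_sobolevNorm (p : ℝ≥0∞) (u : Phase → ℝ) :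
    eLpNorm u p volume ≤ sobolevNorm p u :=
  (le_weakNorm_nil (fun _ _ h => eLpNorm_congr_ae h) u).trans (weakNorm_eLpNorm_nil_le p u)

lemma memLp_of_sobolevNorm_lt_top {p : ℝ≥0∞} {u : Phase → ℝ} (h : sobolevNorm p u < ⊤) :
    MemLp u p volume :=
  ⟨(locallyIntegrable_of_weakNorm_lt_top
    ((weakNorm_eLpNorm_nil_le p u).trans_lt h)).aestronglyMeasurable,
    (eLpNorm_le_sobolevNorm p u).trans_lt h⟩

lemma weakNorm_x_le_sobolevNorm (p : ℝ≥0∞) (u : Phase → ℝ) (i : Fin 3) :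
    weakNorm (fun g => eLpNorm g p volume) [(basisVec i, 0)] u ≤ sobolevNorm p u :=
  (Finset.single_le_sum (f := fun i : Fin 3 =>
    weakNorm (fun g => eLpNorm g p volume) [((basisVec i, 0) : Phase)] u)
    (fun _ _ => zero_le) (Finset.mem_univ i)).trans (le_add_self.trans le_self_add)

lemma weakNorm_v_le_sobolevNorm (p : ℝ≥0∞) (u : Phase → ℝ) (i : Fin 3) :
    weakNorm (fun g => eLpNorm g p volume) [(0, basisVec i)] u ≤ sobolevNorm p u :=
  (Finset.single_le_sum (f := fun i : Fin 3 =>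
    weakNorm (fun g => eLpNorm g p volume) [((0, basisVec i) : Phase)] u)
    (fun _ _ => zero_le) (Finset.mem_univ i)).trans le_add_self

lemma norm_le_of_eLpNorm_top_le {G H : Type*} [TopologicalSpace G] [MeasurableSpace G]
    [NormedAddCommGroup H] {μ : Measure G} [μ.IsOpenPosMeasure] {g : G → H} (hg : Continuous g)
    {c : ℝ} (hc : 0 ≤ c) (h : eLpNorm g ⊤ μ ≤ ENNReal.ofReal c) (x : G) : ‖g x‖ ≤ c := by
  have hae : ∀ᵐ x ∂μ, ‖g x‖ ≤ c := by
    rw [eLpNorm_exponent_top] at h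
    filter_upwards [enorm_ae_le_eLpNormEssSup g μ] with x hx
    have := hx.trans h
    rwa [← ofReal_norm, ENNReal.ofReal_le_ofReal_iff hc] at this
  have hd := Measure.dense_of_ae hae
  have hcl : IsClosed {x | ‖g x‖ ≤ c} := isClosed_le hg.norm continuous_const
  exact hcl.closure_subset (hd x)

/-! ### Lipschitz representatives of the force -/

lemma one_add_le_bracket (t : ℝ) : (1 + t) / 2 ≤ bracket t :=
  Real.le_sqrt_of_sq_le (by rw [Real.norm_eq_abs, sq_abs]; nlinarith [sq_nonneg (t - 1), sq_nonneg t])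

lemma bracket_rpow_neg_le {t p : ℝ} (ht : 0 ≤ t) (hp : 0 ≤ p) (hp3 : p ≤ 3) :
    bracket t ^ (-p) ≤ 8 * (1 + t) ^ (-p) := by
  have h1 : bracket t ^ (-p) ≤ ((1 + t) / 2) ^ (-p) :=
    Real.rpow_le_rpow_of_nonpos (by linarith) (one_add_le_bracket t) (by linarith)
  refine h1.trans ?_
  rw [Real.div_rpow (by linarith) (by norm_num), Real.rpow_neg (by norm_num : (0 : ℝ) ≤ 2),
    div_inv_eq_mul, mul_comm]
  have h2 : (2 : ℝ) ^ p ≤ 2 ^ (3 : ℝ) := Real.rpow_le_rpow_of_exponent_le (by norm_num) hp3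
  have h3 : (2 : ℝ) ^ (3 : ℝ) = 8 := by norm_num
  have : 0 ≤ (1 + t) ^ (-p) := Real.rpow_nonneg (by linarith) _
  gcongr
  linarith

lemma le_of_bracket_mul_le {t p B : ℝ} {N : ℝ≥0∞} (ht : 0 ≤ t) (hp : 0 ≤ p) (hp3 : p ≤ 3)
    (hB : 0 ≤ B) (h : ENNReal.ofReal (bracket t ^ p) * N ≤ ENNReal.ofReal B) :
    N ≤ ENNReal.ofReal (8 * B * (1 + t) ^ (-p)) := by
  have hb : 0 < bracket t := zero_lt_one.trans_le (one_le_bracket t)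
  have e : N = ENNReal.ofReal (bracket t ^ (-p)) * (ENNReal.ofReal (bracket t ^ p) * N) := by
    rw [← mul_assoc, ← ENNReal.ofReal_mul (by positivity), ← Real.rpow_add hb, neg_add_cancel,
      Real.rpow_zero, ENNReal.ofReal_one, one_mul]
  rw [e]
  calc _ ≤ ENNReal.ofReal (bracket t ^ (-p)) * ENNReal.ofReal B := by gcongr
    _ ≤ _ := by
        rw [← ENNReal.ofReal_mul (by positivity)]
        refine ENNReal.ofReal_le_ofReal ?_
        have := mul_le_mul_of_nonneg_right (bracket_rpow_neg_le ht hp hp3) hB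
        linarith

/-- The loss in passing from the dispersion bound to Lipschitz bounds. -/
def forceConst : ℝ := 8 + 48 * lipschitzExtensionConstant Space

lemma exists_force_representative {α lam B : ℝ} {f : ℝ → Phase → ℝ}
    (h : DispersionBound α lam f B) (hB : 0 < B) (hα : 0 < α) (hα' : α < 1) {t : ℝ} (ht : 0 ≤ t) :
    ∃ w : Space → Space, w =ᵐ[volume] force α lam (f t) ∧
      (∀ x, ‖w x‖ ≤ forceConst * B * (1 + t) ^ (-(1 + α))) ∧
      ∀ x y, ‖w x - w y‖ ≤ forceConst * B * (1 + t) ^ (-(2 + α)) * ‖x - y‖ := by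
  have ht' : 0 < 1 + t := by linarith
  have h1 := le_of_bracket_mul_le ht (by linarith : 0 ≤ 1 + α) (by linarith) hB.le
    (le_self_add.trans (le_self_add.trans (h t ht)))
  have h2 := le_of_bracket_mul_le ht (by linarith : 0 ≤ 2 + α) (by linarith) hB.le
    (le_add_self.trans (le_self_add.trans (h t ht)))
  set q := (1 + t) ^ (-(2 + α)) with hq
  have hq0 : 0 < q := by positivity
  obtain ⟨w, hw, hwe⟩ := exists_lipschitz_representative_space (u := force α lam (f t))
    -- Doubling `8 B q` gives the strict inequality needed to pick a weak derivative from the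
    -- infimum; with three directions this is the `48` in `forceConst`.
    (B := (16 * B * q).toNNReal) (fun i => by
      refine ((Finset.single_le_sum (f := fun i : Fin 3 =>
        weakNorm (fun g => eLpNorm g ⊤ volume) [basisVec i] (force α lam (f t)))
        (fun _ _ => zero_le) (Finset.mem_univ i)).trans h2).trans_lt ?_
      change ENNReal.ofReal _ < ENNReal.ofReal _
      rw [ENNReal.ofReal_lt_ofReal_iff (by positivity)]
      have : 0 < B * q := by positivity
      linarith)
  refine ⟨w, hwe, fun x => ?_, fun x y => ?_⟩
  · have h3 := norm_le_of_eLpNorm_top_le (μ := volume) hw.continuous (by positivity)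
      ((eLpNorm_congr_ae hwe).trans_le h1) x
    refine h3.trans ?_
    have : 8 ≤ forceConst := by
      rw [forceConst]; linarith [(lipschitzExtensionConstant Space).coe_nonneg]
    gcongr
  · have h3 := hw.dist_le_mul x y
    rw [dist_eq_norm, dist_eq_norm] at h3
    refine h3.trans ?_
    push_cast
    rw [Real.coe_toNNReal _ (by positivity)]
    have : 0 ≤ 8 * B * q * ‖x - y‖ := by positivity
    rw [forceConst]
    linarith

/-! ### Continuity of the force with respect to the density -/

lemma integrable_density {g : Phase → ℝ} (hg : Integrable g) : Integrable (density g) :=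
  Integrable.integral_prod_left (f := g) hg

lemma density_congr {g g' : Phase → ℝ} (h : g =ᵐ[volume] g') :
    density g =ᵐ[volume] density g' := by
  filter_upwards [Measure.ae_ae_of_ae_prod (μ := (volume : Measure Space))
    (ν := (volume : Measure Space)) h] with x hx using integral_congr_ae hx

lemma force_congr (α lam : ℝ) {g g' : Phase → ℝ} (h : g =ᵐ[volume] g') :
    force α lam g = force α lam g' := by
  ext1 x
  rw [force, force, integral_congr_ae]
  filter_upwards [density_congr h] with y hy
  rw [hy]

lemma lintegral_density_sub_le {g g' : Phase → ℝ} (hg : Integrable g) (hg' : Integrable g') :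
    ∫⁻ y, ‖density g y - density g' y‖ₑ ≤ eLpNorm (g - g') 1 volume := by
  rw [eLpNorm_one_eq_lintegral_enorm, Measure.volume_eq_prod,
    lintegral_prod _ (hg.sub hg').aestronglyMeasurable.enorm]
  refine lintegral_mono_ae ?_
  have h1 : ∀ᵐ y : Space, Integrable fun v : Space => g (y, v) :=
    Integrable.prod_right_ae (f := g) hg
  have h2 : ∀ᵐ y : Space, Integrable fun v : Space => g' (y, v) :=
    Integrable.prod_right_ae (f := g') hg'
  filter_upwards [h1, h2] with y hy hy'
  rw [density, density, ← integral_sub hy hy']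
  exact enorm_integral_le_lintegral_enorm _

/-- The local mass of the interaction kernel. -/
def kernelMass (α lam r : ℝ) : ℝ≥0∞ :=
  ENNReal.ofReal |α * lam| * (volume (Metric.ball (0 : Space) r) + singMass (α + 1))

lemma kernelMass_ne_top {α : ℝ} (hα : α < 2) (lam r : ℝ) : kernelMass α lam r ≠ ⊤ :=
  ENNReal.mul_ne_top ENNReal.ofReal_ne_top
    (ENNReal.add_ne_top.2 ⟨measure_ball_lt_top.ne, singMass_ne_top (by linarith)⟩)

lemma lintegral_ball_kernel_le {α : ℝ} (hα : 0 < α) (lam : ℝ) (x₀ y : Space) (r : ℝ) :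
    ∫⁻ x in Metric.ball x₀ r, ‖kernel α lam (x - y)‖ₑ ≤ kernelMass α lam r := by
  set φ : Space → ℝ≥0∞ :=
    (Metric.ball (0 : Space) 1).indicator (fun y => ENNReal.ofReal (‖y‖ ^ (-(α + 1)))) with hφ
  have hφi : ∫⁻ y, φ y = singMass (α + 1) := by
    rw [hφ, lintegral_indicator Metric.isOpen_ball.measurableSet]; rfl
  calc ∫⁻ x in Metric.ball x₀ r, ‖kernel α lam (x - y)‖ₑ
      ≤ ∫⁻ x in Metric.ball x₀ r, ENNReal.ofReal |α * lam| * (1 + φ (x - y)) := by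
        refine lintegral_mono fun x => ?_
        rw [← ofReal_norm, norm_kernel hα, ENNReal.ofReal_mul (abs_nonneg _)]
        gcongr
        exact ofReal_rpow_le (by linarith) _
    _ = ENNReal.ofReal |α * lam| * ((∫⁻ _ in Metric.ball x₀ r, 1) +
          ∫⁻ x in Metric.ball x₀ r, φ (x - y)) := by
        rw [lintegral_const_mul' _ _ ENNReal.ofReal_ne_top, lintegral_add_left measurable_const]
    _ ≤ ENNReal.ofReal |α * lam| * (volume (Metric.ball x₀ r) + ∫⁻ x, φ (x - y)) := by
        gcongr
        · simp
        · exact Measure.restrict_le_self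
    _ = _ := by
        rw [lintegral_sub_right_eq_self φ y, hφi, Measure.addHaar_ball_center, kernelMass]

/-- By Tonelli, since the mass of the kernel over a ball is bounded uniformly in the centre of the
singularity. -/
lemma lintegral_ball_convolution_le {α : ℝ} (hα : 0 < α) (hα' : α < 2) (lam : ℝ) {ρ : Space → ℝ}
    (hρ : AEStronglyMeasurable ρ) (x₀ : Space) (r : ℝ) :
    ∫⁻ x in Metric.ball x₀ r, ∫⁻ y, ‖ρ y • kernel α lam (x - y)‖ₑ ≤
      kernelMass α lam r * ∫⁻ y, ‖ρ y‖ₑ := by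
  have hm : AEMeasurable (Function.uncurry fun x y => ‖ρ y • kernel α lam (x - y)‖ₑ)
      ((volume.restrict (Metric.ball x₀ r)).prod (volume : Measure Space)) := by
    refine AEStronglyMeasurable.enorm ?_
    refine AEStronglyMeasurable.smul (f := fun q : Space × Space => ρ q.2)
      (g := fun q : Space × Space => kernel α lam (q.1 - q.2)) hρ.comp_snd ?_
    exact ((measurable_kernel α lam).comp
      (measurable_fst.sub measurable_snd)).aestronglyMeasurable
  rw [lintegral_lintegral_swap hm]
  calc ∫⁻ y, ∫⁻ x in Metric.ball x₀ r, ‖ρ y • kernel α lam (x - y)‖ₑ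
      ≤ ∫⁻ y, kernelMass α lam r * ‖ρ y‖ₑ := by
        refine lintegral_mono fun y => ?_
        simp only [enorm_smul]
        rw [lintegral_const_mul' _ _ enorm_ne_top, mul_comm]
        gcongr
        exact lintegral_ball_kernel_le hα lam x₀ y r
    _ = _ := lintegral_const_mul' _ _ (kernelMass_ne_top hα' lam r)

lemma lintegral_ball_force_sub_le {α : ℝ} (hα : 0 < α) (hα' : α < 2) (lam : ℝ) {g g' : Phase → ℝ}
    (hg : Integrable g) (hg' : Integrable g') (x₀ : Space) (r : ℝ) :
    ∫⁻ x in Metric.ball x₀ r, ‖force α lam g x - force α lam g' x‖ₑ ≤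
      kernelMass α lam r * eLpNorm (g - g') 1 volume := by
  have hi : ∀ {g : Phase → ℝ}, Integrable g → ∀ᵐ x ∂volume.restrict (Metric.ball x₀ r),
      Integrable fun y => density g y • kernel α lam (x - y) := by
    intro g hg
    have hd := integrable_density hg
    have hlt : ∫⁻ x in Metric.ball x₀ r, ∫⁻ y, ‖density g y • kernel α lam (x - y)‖ₑ ≠ ⊤ :=
      ne_top_of_le_ne_top (ENNReal.mul_ne_top (kernelMass_ne_top hα' lam r) hd.2.ne)
        (lintegral_ball_convolution_le hα hα' lam hd.1 x₀ r)
    have hm : AEMeasurable (fun x => ∫⁻ y, ‖density g y • kernel α lam (x - y)‖ₑ)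
        (volume.restrict (Metric.ball x₀ r)) := by
      refine AEMeasurable.lintegral_prod_right'
        (f := fun q : Space × Space => ‖density g q.2 • kernel α lam (q.1 - q.2)‖ₑ) ?_
      refine AEStronglyMeasurable.enorm ?_
      refine AEStronglyMeasurable.smul (f := fun q : Space × Space => density g q.2)
        (g := fun q : Space × Space => kernel α lam (q.1 - q.2)) hd.1.comp_snd ?_
      exact ((measurable_kernel α lam).comp
        (measurable_fst.sub measurable_snd)).aestronglyMeasurable
    filter_upwards [ae_lt_top' hm hlt] with x hx
    refine ⟨?_, hx⟩
    exact hd.1.smul ((measurable_kernel α lam).comp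
      (measurable_const.sub measurable_id)).aestronglyMeasurable
  calc ∫⁻ x in Metric.ball x₀ r, ‖force α lam g x - force α lam g' x‖ₑ
      ≤ ∫⁻ x in Metric.ball x₀ r, ∫⁻ y, ‖(density g y - density g' y) • kernel α lam (x - y)‖ₑ := by
        refine lintegral_mono_ae ?_
        filter_upwards [hi hg, hi hg'] with x hx hx'
        simp only [force, gradient_potential]
        rw [neg_sub_neg, ← integral_sub hx' hx]
        refine (enorm_integral_le_lintegral_enorm _).trans (lintegral_mono fun y => ?_)
        rw [← sub_smul, ← neg_sub, neg_smul, enorm_neg]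
    _ ≤ kernelMass α lam r * ∫⁻ y, ‖density g y - density g' y‖ₑ :=
        lintegral_ball_convolution_le hα hα' lam
          ((integrable_density hg).1.sub (integrable_density hg').1) x₀ r
    _ ≤ _ := by gcongr; exact lintegral_density_sub_le hg hg'

/-- Uniform closeness of Lipschitz representatives of forces. -/
lemma norm_force_representative_sub_le {α : ℝ} (hα : 0 < α) (hα' : α < 2) (lam : ℝ)
    {g g' : Phase → ℝ} (hg : Integrable g) (hg' : Integrable g') {w w' : Space → Space}
    (hw : w =ᵐ[volume] force α lam g) (hw' : w' =ᵐ[volume] force α lam g') {L : ℝ} (hL : 0 ≤ L)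
    (hwL : ∀ x y, ‖w x - w y‖ ≤ L * ‖x - y‖) (hwL' : ∀ x y, ‖w' x - w' y‖ ≤ L * ‖x - y‖)
    {ε : ℝ} (hε : 0 < ε)
    (hsmall : kernelMass α lam (ε / (4 * (L + 1))) * eLpNorm (g - g') 1 volume <
      ENNReal.ofReal (ε / 2) * volume (Metric.ball (0 : Space) (ε / (4 * (L + 1))))) (x : Space) :
    ‖w x - w' x‖ ≤ ε := by
  -- A gap larger than `ε` at `x` would remain at least `ε / 2` on a ball of radius `ε / (4 (L +
  -- 1))`, as each representative varies there by at most `ε / 4`. This contradicts closeness of the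
  -- forces in local `L¹`.
  by_contra! hlt
  set r := ε / (4 * (L + 1)) with hr
  have hLr : L * r ≤ ε / 4 := by
    rw [hr, mul_div_assoc', div_le_div_iff₀ (by positivity) (by norm_num)]
    nlinarith
  refine hsmall.not_ge ?_
  calc ENNReal.ofReal (ε / 2) * volume (Metric.ball (0 : Space) r)
      = ∫⁻ _ in Metric.ball x r, ENNReal.ofReal (ε / 2) := by
        rw [setLIntegral_const, Measure.addHaar_ball_center _ x]
    _ ≤ ∫⁻ y in Metric.ball x r, ‖w y - w' y‖ₑ := by
        refine setLIntegral_mono' Metric.isOpen_ball.measurableSet fun y hy => ?_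
        rw [← ofReal_norm]
        refine ENNReal.ofReal_le_ofReal ?_
        have hy' : ‖x - y‖ ≤ r := by
          rw [← dist_eq_norm, dist_comm]; exact (Metric.mem_ball.1 hy).le
        have h1 := (hwL x y).trans (mul_le_mul_of_nonneg_left hy' hL)
        have h2 := (hwL' x y).trans (mul_le_mul_of_nonneg_left hy' hL)
        have h3 : w x - w' x = (w x - w y) - (w' x - w' y) + (w y - w' y) := by abel
        have h4 := norm_add_le ((w x - w y) - (w' x - w' y)) (w y - w' y)
        have h5 := norm_sub_le (w x - w y) (w' x - w' y)
        rw [← h3] at h4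
        linarith
    _ = ∫⁻ y in Metric.ball x r, ‖force α lam g y - force α lam g' y‖ₑ := by
        refine lintegral_congr_ae (ae_restrict_of_ae ?_)
        filter_upwards [hw, hw'] with y hy hy'
        rw [hy, hy']
    _ ≤ _ := lintegral_ball_force_sub_le hα hα' lam hg hg' x r

/-! ### Regular representatives of a global solution -/

lemma tendsto_abs_nhdsWithin (t : ℝ) : Tendsto (fun s : ℝ => |s|) (𝓝 t) (𝓝[Ici 0] |t|) :=
  tendsto_nhdsWithin_iff.2 ⟨continuous_abs.tendsto t, Eventually.of_forall fun s => abs_nonneg s⟩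

lemma IsGlobalSolution.integrable {α lam : ℝ} {f₀ : Phase → ℝ} {f : ℝ → Phase → ℝ}
    (h : IsGlobalSolution α lam f₀ f) {t : ℝ} (ht : 0 ≤ t) : Integrable (f t) :=
  memLp_one_iff_integrable.1 (memLp_of_sobolevNorm_lt_top (h.sobolev_one t ht))

lemma forceConst_pos : 0 < forceConst := by
  rw [forceConst]; linarith [(lipschitzExtensionConstant Space).coe_nonneg]

/-- Negative times are filled in by reflection, `t ↦ |t|`. Continuity in time is inherited from the
`L¹` continuity of the solution, since the common Lipschitz constant turns local `L¹` closeness of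
forces into uniform closeness. -/
lemma IsGlobalSolution.exists_forceField {α lam B : ℝ} {f₀ : Phase → ℝ} {f : ℝ → Phase → ℝ}
    (h : IsGlobalSolution α lam f₀ f) (hd : DispersionBound α lam f B) (hB : 0 < B) (hα : 0 < α)
    (hα' : α < 1) :
    ∃ E : ℝ → Space → Space, ForceField α (forceConst * B) E ∧
      ∀ t, 0 ≤ t → E t =ᵐ[volume] force α lam (f t) := by
  choose w hw hb hl using fun t : ℝ => exists_force_representative hd hB hα hα' (abs_nonneg t)
  have hκ : 0 ≤ forceConst * B := mul_nonneg forceConst_pos.le hB.le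
  have hL : ∀ t x y, ‖w t x - w t y‖ ≤ forceConst * B * ‖x - y‖ := by
    intro t x y
    refine (hl t x y).trans ?_
    have := rpow_neg_le_one (abs_nonneg t) (by linarith : 0 ≤ 2 + α)
    have := mul_le_mul_of_nonneg_left this hκ
    rw [mul_one] at this
    exact mul_le_mul_of_nonneg_right this (norm_nonneg _)
  refine ⟨w, ⟨hb, hl, fun t ε hε => ?_⟩, fun t ht => by simpa only [abs_of_nonneg ht] using hw t⟩
  set r := ε / (4 * (forceConst * B + 1)) with hr
  have hr0 : 0 < r := by positivity
  have h0 : Tendsto (fun s => kernelMass α lam r * eLpNorm (f |s| - f |t|) 1 volume) (𝓝 t)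
      (𝓝 0) := by
    have := ENNReal.Tendsto.const_mul
      ((h.continuous_one |t| (abs_nonneg t)).comp (tendsto_abs_nhdsWithin t))
      (Or.inr (kernelMass_ne_top (by linarith : α < 2) lam r))
    simpa using this
  have hpos : 0 < ENNReal.ofReal (ε / 2) * volume (Metric.ball (0 : Space) r) :=
    ENNReal.mul_pos (by simpa using hε) (Metric.measure_ball_pos _ _ hr0).ne'
  filter_upwards [h0.eventually (gt_mem_nhds hpos)] with s hs x
  exact norm_force_representative_sub_le hα (by linarith) lam (h.integrable (abs_nonneg s))
    (h.integrable (abs_nonneg t)) (hw s) (hw t) hκ (hL s) (hL t) hε hs x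

/-- For continuous representatives the essential supremum is the supremum, so `L^∞` continuity in
time becomes uniform convergence and hence joint continuity. -/
lemma IsGlobalSolution.exists_transportSolution {α lam : ℝ} {f₀ : Phase → ℝ}
    {f : ℝ → Phase → ℝ} (h : IsGlobalSolution α lam f₀ f) {E : ℝ → Space → Space}
    (hE : ∀ t, 0 ≤ t → E t =ᵐ[volume] force α lam (f t)) :
    ∃ F : ℝ → Phase → ℝ, TransportSolution E F ∧ ∀ t, 0 ≤ t → F t =ᵐ[volume] f t := by
  have hrep : ∀ t : ℝ, ∃ w : Phase → ℝ, Continuous w ∧ w =ᵐ[volume] f |t| := by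
    intro t
    have hlt := h.sobolev_top |t| (abs_nonneg t)
    have hB : sobolevNorm ⊤ (f |t|) < ((sobolevNorm ⊤ (f |t|)).toNNReal + 1 : ℝ≥0) := by
      rw [ENNReal.coe_add, ENNReal.coe_toNNReal hlt.ne]
      exact ENNReal.lt_add_right hlt.ne (by simp)
    obtain ⟨w, hw, hwe⟩ := exists_lipschitz_representative_phase
      (fun i => (weakNorm_x_le_sobolevNorm ⊤ (f |t|) i).trans_lt hB)
      (fun i => (weakNorm_v_le_sobolevNorm ⊤ (f |t|) i).trans_lt hB)
    exact ⟨w, hw.continuous, hwe⟩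
  choose F hFc hFe using hrep
  have hFe' : ∀ t, 0 ≤ t → F t =ᵐ[volume] f t := fun t ht => by
    simpa only [abs_of_nonneg ht] using hFe t
  have hunif : ∀ t ε, 0 < ε → ∀ᶠ s in 𝓝 t, ∀ z, ‖F s z - F t z‖ ≤ ε := by
    intro t ε hε
    have h0 := (h.continuous_top |t| (abs_nonneg t)).comp (tendsto_abs_nhdsWithin t)
    filter_upwards [h0.eventually (gt_mem_nhds (ENNReal.ofReal_pos.2 hε))] with s hs z
    refine norm_le_of_eLpNorm_top_le (μ := volume) (g := F s - F t) ((hFc s).sub (hFc t)) hε.le ?_ z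
    rw [eLpNorm_congr_ae ((hFe s).sub (hFe t))]
    exact hs.le
  refine ⟨F, ⟨?_, fun φ hφ hc t ht => ?_⟩, hFe'⟩
  · rw [continuous_iff_continuousAt]
    rintro ⟨t, z⟩
    rw [Metric.continuousAt_iff']
    intro ε hε
    have h1 : ∀ᶠ q : ℝ × Phase in 𝓝 (t, z), ∀ y, ‖F q.1 y - F t y‖ ≤ ε / 2 :=
      (continuous_fst.tendsto (t, z)).eventually (hunif t (ε / 2) (by positivity))
    have h3 : Tendsto (fun q : ℝ × Phase => F t q.2) (𝓝 (t, z)) (𝓝 (F t z)) :=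
      ((hFc t).comp continuous_snd).tendsto (t, z)
    have h2 : ∀ᶠ q : ℝ × Phase in 𝓝 (t, z), dist (F t q.2) (F t z) < ε / 2 :=
      Metric.tendsto_nhds.1 h3 (ε / 2) (by positivity)
    filter_upwards [h1, h2] with q hq1 hq2
    have hq3 : dist (F q.1 q.2) (F t q.2) ≤ ε / 2 := by
      rw [dist_eq_norm]; exact hq1 q.2
    have hq4 := dist_triangle (F q.1 q.2) (F t q.2) (F t z)
    change dist (F q.1 q.2) (F t z) < ε
    linarith
  · have e : ∀ s, 0 ≤ s → ∀ ψ : Phase → ℝ, ∫ z, F s z * ψ z = ∫ z, f s z * ψ z := by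
      intro s hs ψ
      refine integral_congr_ae ?_
      filter_upwards [hFe' s hs] with z hz
      rw [hz]
    rw [e t ht, e 0 le_rfl, h.equation φ hφ hc t ht]
    congr 1
    refine intervalIntegral.integral_congr fun s hs => ?_
    rw [uIcc_of_le ht] at hs
    refine (e s hs.1 _).symm.trans ?_
    refine integral_congr_ae ?_
    filter_upwards [Measure.quasiMeasurePreserving_fst.ae (hE s hs.1)] with z hz
    rw [charField, hz]

/-! ### Representation along characteristics -/

/-- The characteristic flow. -/
def charFlow (E : ℝ → Space → Space) (t : ℝ) (z : Phase) : Phase := (charX E t z, charV E t z)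

section

variable {α κ : ℝ} {E : ℝ → Space → Space}

lemma ForceField.measurePreserving_charFlow (hE : ForceField α κ E) (hα : 0 < α) {t : ℝ}
    (ht : 0 ≤ t) : MeasurePreserving (charFlow E t) volume volume :=
  (measurePreserving_shear_left (a := fun v => t • v) (by fun_prop)).comp
    (hE.measurePreserving_evol hα ht)

lemma ForceField.hasDerivAt_charFlow (hE : ForceField α κ E) (hα : 0 < α) (t : ℝ) (z : Phase) :
    HasDerivAt (fun t => charFlow E t z) (charField E t (charFlow E t z)) t :=
  (hE.hasDerivAt_charX hα t z).prodMk (hE.hasDerivAt_charV hα t z)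

lemma ForceField.charFlow_zero (hE : ForceField α κ E) (hα : 0 < α) (z : Phase) :
    charFlow E 0 z = z := by rw [charFlow, hE.charX_zero hα, hE.charV_zero hα]

lemma ForceField.charField_lip (hE : ForceField α κ E) (hα : 0 < α) (s : ℝ) (Z Z' : Phase) :
    ‖charField E s Z - charField E s Z'‖ ≤ (1 + κ) * ‖Z - Z'‖ := by
  have hκ := hE.kappa_nonneg
  have h1 := norm_fst_le (Z - Z')
  have h2 := norm_snd_le (Z - Z')
  rw [charField, charField, Prod.mk_sub_mk, Prod.norm_mk]
  refine max_le ?_ ?_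
  · rw [← Prod.snd_sub]
    nlinarith [norm_nonneg (Z - Z')]
  · refine (hE.lip s _ _).trans ?_
    have := rpow_neg_le_one (abs_nonneg s) (by linarith : 0 ≤ 2 + α)
    rw [← Prod.fst_sub]
    calc κ * (1 + |s|) ^ (-(2 + α)) * ‖(Z - Z').1‖ ≤ κ * 1 * ‖Z - Z'‖ := by gcongr
      _ ≤ _ := by nlinarith [norm_nonneg (Z - Z')]

lemma TransportSolution.apply_charFlow {F : ℝ → Phase → ℝ} (h : TransportSolution E F)
    (hE : ForceField α κ E) (hα : 0 < α) {t : ℝ} (ht : 0 ≤ t) (z : Phase) :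
    F t (charFlow E t z) = F 0 z := by
  have := h.eq_initial hE.continuous (L := 1 + κ) (by linarith [hE.kappa_nonneg])
    (hE.charField_lip hα) (Z := fun t => charFlow E t z)
    (fun t _ => (hE.hasDerivAt_charFlow hα t z).hasDerivWithinAt) ht
  simpa only [hE.charFlow_zero hα] using this

/-- Singular integrals along characteristics, uniformly in the base point. -/
lemma ForceField.lintegral_singular_charX_le (hE : ForceField α κ E) (hα : 0 < α)
    (hκ : κ ≤ α / 3) {F₀ : Phase → ℝ} (hF : Measurable F₀) (h1 : eLpNorm F₀ 1 volume ≠ ⊤)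
    (hxv : normXV 1 ⊤ F₀ ≠ ⊤) (hvx : normVX 1 ⊤ F₀ ≠ ⊤) {β : ℝ} (hβ : 0 < β) (hβ' : β < 3)
    {t : ℝ} (ht : 0 ≤ t) :
    ∃ M : ℝ, 0 ≤ M ∧ ∀ a, ∫⁻ z, ENNReal.ofReal (‖a - charX E t z‖ ^ (-β)) * ‖F₀ z‖ₑ ≤
      ENNReal.ofReal M := by
  suffices hM : ∃ M : ℝ≥0∞, M ≠ ⊤ ∧ ∀ a,
      ∫⁻ z, ENNReal.ofReal (‖a - charX E t z‖ ^ (-β)) * ‖F₀ z‖ₑ ≤ M by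
    obtain ⟨M, hM, h⟩ := hM
    exact ⟨M.toReal, ENNReal.toReal_nonneg, fun a => by rw [ENNReal.ofReal_toReal hM]; exact h a⟩
  have hS := ENNReal.mul_ne_top (by norm_num : (8 : ℝ≥0∞) ≠ ⊤) (singMass_ne_top hβ')
  have hm := (hE.continuous_charX hα ht).measurable
  -- At time `0` the position does not depend on `v`, so the singularity is integrated in `x` using
  -- the norm `normVX`. At positive times division by `t` yields a map expanding in `v`; the factor
  -- `t^{-β}` is harmless because `M` may depend on `t`.
  rcases ht.eq_or_lt with rfl | ht0
  · refine ⟨_, ENNReal.add_ne_top.2 ⟨h1, ENNReal.mul_ne_top hS hvx⟩, fun a =>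
      lintegral_singular_le_swap hβ hβ' hm (fun v => ?_) hF a⟩
    refine antilipschitz_of_near_id fun x x' => ?_
    rw [hE.charX_zero hα, hE.charX_zero hα, sub_self, norm_zero]
    positivity
  · have hm' : Measurable fun z => t⁻¹ • charX E t z :=
      ((hE.continuous_charX hα ht).const_smul t⁻¹).measurable
    refine ⟨ENNReal.ofReal (t ^ (-β)) * (eLpNorm F₀ 1 volume + 8 * singMass β * normXV 1 ⊤ F₀),
      ENNReal.mul_ne_top ENNReal.ofReal_ne_top
        (ENNReal.add_ne_top.2 ⟨h1, ENNReal.mul_ne_top hS hxv⟩), fun a => ?_⟩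
    calc ∫⁻ z, ENNReal.ofReal (‖a - charX E t z‖ ^ (-β)) * ‖F₀ z‖ₑ
        = ∫⁻ z, ENNReal.ofReal (t ^ (-β)) *
            (ENNReal.ofReal (‖t⁻¹ • a - t⁻¹ • charX E t z‖ ^ (-β)) * ‖F₀ z‖ₑ) := by
          refine lintegral_congr fun z => ?_
          have e : a - charX E t z = t • (t⁻¹ • a - t⁻¹ • charX E t z) := by
            rw [← smul_sub, smul_smul, mul_inv_cancel₀ ht0.ne', one_smul]
          rw [← mul_assoc, ← ENNReal.ofReal_mul (by positivity),
            ← Real.mul_rpow ht0.le (norm_nonneg _)]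
          nth_rw 1 [e]
          rw [norm_smul, Real.norm_of_nonneg ht0.le]
      _ = ENNReal.ofReal (t ^ (-β)) *
            ∫⁻ z, ENNReal.ofReal (‖t⁻¹ • a - t⁻¹ • charX E t z‖ ^ (-β)) * ‖F₀ z‖ₑ :=
          lintegral_const_mul' _ _ ENNReal.ofReal_ne_top
      _ ≤ _ := by
          gcongr
          exact lintegral_singular_le hβ hβ' hm' (hE.antilipschitz_charX_v hα hκ ht0) hF _

/-- The force is generated by the transport of the initial density, at every point. -/
lemma TransportSolution.force_eq {lam : ℝ} {F : ℝ → Phase → ℝ} (h : TransportSolution E F)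
    (hE : ForceField α κ E) (hα : 0 < α) (hα' : α < 1) (hκ : κ ≤ α / 3)
    (h1 : eLpNorm (F 0) 1 volume ≠ ⊤) (hxv : normXV 1 ⊤ (F 0) ≠ ⊤) (hvx : normVX 1 ⊤ (F 0) ≠ ⊤)
    {t : ℝ} (ht : 0 ≤ t) (x : Space) :
    force α lam (F t) x = -∫ z, F 0 z • kernel α lam (x - charX E t z) := by
  have hFc : ∀ t, Continuous (F t) := fun t => h.cont.comp (Continuous.prodMk_right t)
  have hm := (hE.continuous_charX hα ht).measurable
  obtain ⟨M, -, hM⟩ := hE.lintegral_singular_charX_le hα hκ (hFc 0).measurable h1 hxv hvx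
    (β := α + 1) (by linarith) (by linarith) ht
  have hi : Integrable fun z => F 0 z • kernel α lam (x - charX E t z) :=
    integrable_interaction hα (hFc 0).measurable hm x
      (ne_top_of_le_ne_top ENNReal.ofReal_ne_top (hM x))
  have hmp := hE.measurePreserving_charFlow hα ht
  have hmeas : Measurable fun z : Phase => F t z • kernel α lam (x - z.1) :=
    (hFc t).measurable.smul ((measurable_kernel α lam).comp (measurable_const.sub measurable_fst))
  have e : (fun z => F 0 z • kernel α lam (x - charX E t z)) =
      (fun z : Phase => F t z • kernel α lam (x - z.1)) ∘ charFlow E t := by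
    ext1 z
    simp only [Function.comp_apply]
    rw [h.apply_charFlow hE hα ht]
    rfl
  have hi' : Integrable fun z : Phase => F t z • kernel α lam (x - z.1) := by
    rw [e] at hi
    exact (hmp.integrable_comp hmeas.aestronglyMeasurable).1 hi
  have e2 : ∫ z, F 0 z • kernel α lam (x - charX E t z) =
      ∫ z : Phase, F t z • kernel α lam (x - z.1) := by
    rw [e]
    nth_rw 2 [← hmp.map_eq]
    rw [integral_map hmp.measurable.aemeasurable hmeas.aestronglyMeasurable]
    rfl
  rw [e2, force, Measure.volume_eq_prod, integral_prod _ hi']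
  congr 1
  refine integral_congr_ae (Eventually.of_forall fun y => ?_)
  simp only [density, gradient_potential]
  rw [integral_smul_const]

/-- The singular integral bound of order `α + 2` makes the force of `F t` Lipschitz. Two continuous
functions that agree almost everywhere agree everywhere. -/
lemma TransportSolution.repr {lam : ℝ} {F : ℝ → Phase → ℝ} (h : TransportSolution E F)
    (hE : ForceField α κ E) (hα : 0 < α) (hα' : α < 1) (hκ : κ ≤ α / 3)
    (h1 : eLpNorm (F 0) 1 volume ≠ ⊤) (hxv : normXV 1 ⊤ (F 0) ≠ ⊤) (hvx : normVX 1 ⊤ (F 0) ≠ ⊤)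
    {t : ℝ} (ht : 0 ≤ t) (hEF : E t =ᵐ[volume] force α lam (F t)) :
    E t = force α lam (F t) := by
  have hm := (hE.continuous_charX hα ht).measurable
  have hF : Measurable (F 0) := (h.cont.comp (Continuous.prodMk_right 0)).measurable
  obtain ⟨M, -, hM⟩ := hE.lintegral_singular_charX_le hα hκ hF h1 hxv hvx
    (β := α + 1) (by linarith) (by linarith) ht
  obtain ⟨M', hM0', hM'⟩ := hE.lintegral_singular_charX_le hα hκ hF h1 hxv hvx
    (β := α + 2) (by linarith) (by linarith) ht
  have hi : ∀ x, Integrable fun z => F 0 z • kernel α lam (x - charX E t z) := fun x =>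
    integrable_interaction hα hF hm x (ne_top_of_le_ne_top ENNReal.ofReal_ne_top (hM x))
  have hcont : Continuous (force α lam (F t)) := by
    refine (LipschitzWith.of_dist_le_mul
      (K := (|α * lam| * (α + 3) * (2 * M')).toNNReal) fun x x' => ?_).continuous
    rw [Real.coe_toNNReal _ (by positivity), dist_eq_norm, dist_eq_norm,
      h.force_eq hE hα hα' hκ h1 hxv hvx ht, h.force_eq hE hα hα' hκ h1 hxv hvx ht, neg_sub_neg,
      norm_sub_rev]
    refine norm_interaction_sub_le hα hF hm hM0' (norm_nonneg _) (hi x) (hi x') (hM' x) (hM' x')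
      fun z => ?_
    rw [sub_sub_sub_cancel_right, mul_comm]
  exact (Continuous.ae_eq_iff_eq volume (hE.continuous.comp (Continuous.prodMk_right t)) hcont).1 hEF

end

/-! ### Consequences of the bound on the initial data -/

lemma normXV_congr (p q : ℝ≥0∞) {u g : Phase → ℝ} (h : u =ᵐ[volume] g) :
    normXV p q u = normXV p q g := by
  refine eLpNorm_congr_ae ?_
  filter_upwards [Measure.ae_ae_of_ae_prod (μ := (volume : Measure Space))
    (ν := (volume : Measure Space)) h] with x hx using eLpNorm_congr_ae hx

lemma normVX_congr (p q : ℝ≥0∞) {u g : Phase → ℝ} (h : u =ᵐ[volume] g) :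
    normVX p q u = normVX p q g := by
  have hs : (u ∘ Prod.swap) =ᵐ[volume] (g ∘ Prod.swap : Phase → ℝ) :=
    (Measure.measurePreserving_swap (μ := (volume : Measure Space))
      (ν := (volume : Measure Space))).quasiMeasurePreserving.ae_eq_comp h
  have e : ∀ u : Phase → ℝ, normVX p q u = normXV p q (u ∘ Prod.swap) := fun u => by
    simp only [normVX, normXV, Function.comp_apply, Prod.swap_prod_mk]
  rw [e, e, normXV_congr p q hs]

lemma normXV_le_mixedNormXV (p q : ℝ≥0∞) (u : Phase → ℝ) : normXV p q u ≤ mixedNormXV p q u :=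
  (le_weakNorm_nil (fun _ _ h => normXV_congr p q h) u).trans
    ((Finset.single_le_sum (f := fun m' : Option (Fin 3) =>
      weakNorm (normXV p q) (xIndex none ++ vIndex m') u) (fun _ _ => zero_le)
      (Finset.mem_univ none)).trans
    (Finset.single_le_sum (f := fun m : Option (Fin 3) => ∑ m' : Option (Fin 3),
      weakNorm (normXV p q) (xIndex m ++ vIndex m') u) (fun _ _ => zero_le)
      (Finset.mem_univ none)))

lemma normVX_le_mixedNormVX (p q : ℝ≥0∞) (u : Phase → ℝ) : normVX p q u ≤ mixedNormVX p q u :=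
  (le_weakNorm_nil (fun _ _ h => normVX_congr p q h) u).trans
    ((Finset.single_le_sum (f := fun m' : Option (Fin 3) =>
      weakNorm (normVX p q) (xIndex none ++ vIndex m') u) (fun _ _ => zero_le)
      (Finset.mem_univ none)).trans
    (Finset.single_le_sum (f := fun m : Option (Fin 3) => ∑ m' : Option (Fin 3),
      weakNorm (normVX p q) (xIndex m ++ vIndex m') u) (fun _ _ => zero_le)
      (Finset.mem_univ none)))

lemma bracket_sub_le (x y : Space) : |bracket y - bracket x| ≤ ‖x - y‖ := by
  have key : ∀ x y : Space, bracket y ≤ bracket x + ‖x - y‖ := by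
    intro x y
    have hx := norm_le_bracket x
    have hx1 : bracket x ^ 2 = 1 + ‖x‖ ^ 2 := Real.sq_sqrt (by positivity)
    have hy : ‖y‖ ≤ ‖x‖ + ‖x - y‖ := by
      have := norm_sub_norm_le y x
      rw [norm_sub_rev] at this
      linarith
    have hd := norm_nonneg (x - y)
    refine Real.sqrt_le_iff.2 ⟨by linarith [norm_nonneg x], ?_⟩
    nlinarith [norm_nonneg x, norm_nonneg y, mul_le_mul_of_nonneg_right hx hd]
  have h1 := key x y
  have h2 := key y x
  rw [norm_sub_rev] at h2
  exact abs_sub_le_iff.2 ⟨by linarith, by linarith⟩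

/-- The Lipschitz constant for weighted densities. -/
def dataConst : ℝ := 12 * lipschitzExtensionConstant ℝ + 1

section

variable {η : ℝ} {f₀ F₀ : Phase → ℝ}

lemma abs_weighted_le_of_dataNorm_le (hη : 0 < η)
    (h : dataNorm (fun z => bracket z.1 * f₀ z) ≤ ENNReal.ofReal η) (hF : Continuous F₀)
    (hFf : F₀ =ᵐ[volume] f₀) (z : Phase) : |bracket z.1 * F₀ z| ≤ η := by
  have hc : Continuous fun z : Phase => bracket z.1 * F₀ z :=
    (continuous_bracket.comp continuous_fst).mul hF
  have he : (fun z : Phase => bracket z.1 * F₀ z) =ᵐ[volume] fun z => bracket z.1 * f₀ z := by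
    filter_upwards [hFf] with z hz
    rw [hz]
  refine norm_le_of_eLpNorm_top_le (μ := volume) hc hη.le ?_ z
  rw [eLpNorm_congr_ae he]
  exact (eLpNorm_le_sobolevNorm _ _).trans (le_add_self.trans (le_self_add.trans h))

/-- The weighted density has a Lipschitz representative, and dividing out the weight costs only the
variation of the bracket times `|F₀| ≤ η`, which is the `+ 1` in `dataConst`. -/
lemma lipschitz_of_dataNorm_le (hη : 0 < η)
    (h : dataNorm (fun z => bracket z.1 * f₀ z) ≤ ENNReal.ofReal η) (hF : Continuous F₀)
    (hFf : F₀ =ᵐ[volume] f₀) (z z' : Phase) :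
    |F₀ z - F₀ z'| ≤ dataConst * η * ‖z - z'‖ / bracket z.1 := by
  set u : Phase → ℝ := fun z => bracket z.1 * F₀ z with hu
  have hc : Continuous u := (continuous_bracket.comp continuous_fst).mul hF
  have he : u =ᵐ[volume] fun z => bracket z.1 * f₀ z := by
    filter_upwards [hFf] with z hz
    rw [hu]; simp only; rw [hz]
  have hlt : sobolevNorm ⊤ (fun z : Phase => bracket z.1 * f₀ z) < ((2 * η).toNNReal : ℝ≥0∞) := by
    refine (le_add_self.trans (le_self_add.trans h)).trans_lt ?_
    change ENNReal.ofReal _ < ENNReal.ofReal _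
    rw [ENNReal.ofReal_lt_ofReal_iff (by positivity)]
    linarith
  obtain ⟨w, hw, hwe⟩ := exists_lipschitz_representative_phase
    (fun i => (weakNorm_x_le_sobolevNorm ⊤ _ i).trans_lt hlt)
    (fun i => (weakNorm_v_le_sobolevNorm ⊤ _ i).trans_lt hlt)
  have hwu : w = u := (Continuous.ae_eq_iff_eq volume hw.continuous hc).1 (hwe.trans he.symm)
  have hlip := hw.dist_le_mul z z'
  rw [hwu, Real.dist_eq, dist_eq_norm] at hlip
  push_cast at hlip
  rw [Real.coe_toNNReal _ (by positivity)] at hlip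
  have hb := one_le_bracket z.1
  have hsup : |F₀ z'| ≤ η :=
    (abs_le_abs_weighted F₀ z').trans (abs_weighted_le_of_dataNorm_le hη h hF hFf z')
  rw [le_div_iff₀ (by linarith)]
  have e : (F₀ z - F₀ z') * bracket z.1 = (u z - u z') + F₀ z' * (bracket z'.1 - bracket z.1) := by
    rw [hu]; ring
  have hbr : |bracket z'.1 - bracket z.1| ≤ ‖z - z'‖ :=
    (bracket_sub_le _ _).trans (norm_fst_le (z - z'))
  calc |F₀ z - F₀ z'| * bracket z.1 = |(F₀ z - F₀ z') * bracket z.1| := by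
        rw [abs_mul, abs_of_nonneg (by linarith : 0 ≤ bracket z.1)]
    _ ≤ |u z - u z'| + |F₀ z'| * |bracket z'.1 - bracket z.1| := by
        rw [e, ← abs_mul]; exact abs_add_le _ _
    _ ≤ lipschitzExtensionConstant ℝ * (6 * (2 * η)) * ‖z - z'‖ + η * ‖z - z'‖ := by gcongr
    _ = _ := by rw [dataConst]; ring

lemma eLpNorm_weighted_le_of_dataNorm_le
    (h : dataNorm (fun z => bracket z.1 * f₀ z) ≤ ENNReal.ofReal η) (hFf : F₀ =ᵐ[volume] f₀) :
    eLpNorm (fun z : Phase => bracket z.1 * F₀ z) 1 volume ≤ ENNReal.ofReal η ∧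
      normXV 1 ⊤ (fun z : Phase => bracket z.1 * F₀ z) ≤ ENNReal.ofReal η ∧
      normVX 1 ⊤ (fun z : Phase => bracket z.1 * F₀ z) ≤ ENNReal.ofReal η := by
  have he : (fun z : Phase => bracket z.1 * F₀ z) =ᵐ[volume] fun z => bracket z.1 * f₀ z := by
    filter_upwards [hFf] with z hz
    rw [hz]
  rw [eLpNorm_congr_ae he, normXV_congr _ _ he, normVX_congr _ _ he]
  exact ⟨(eLpNorm_le_sobolevNorm _ _).trans (le_self_add.trans (le_self_add.trans h)),
    (normXV_le_mixedNormXV _ _ _).trans (le_self_add.trans (le_add_self.trans h)),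
    (normVX_le_mixedNormVX _ _ _).trans (le_add_self.trans (le_add_self.trans h))⟩

end

lemma eLpNorm_le_weighted (F₀ : Phase → ℝ) :
    eLpNorm F₀ 1 volume ≤ eLpNorm (fun z : Phase => bracket z.1 * F₀ z) 1 volume :=
  eLpNorm_mono (abs_le_abs_weighted F₀)

lemma normXV_le_weighted (F₀ : Phase → ℝ) :
    normXV 1 ⊤ F₀ ≤ normXV 1 ⊤ fun z : Phase => bracket z.1 * F₀ z :=
  eLpNorm_mono_enorm fun x => by
    simpa only [enorm_eq_self] using eLpNorm_mono fun v => abs_le_abs_weighted F₀ (x, v)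

lemma normVX_le_weighted (F₀ : Phase → ℝ) :
    normVX 1 ⊤ F₀ ≤ normVX 1 ⊤ fun z : Phase => bracket z.1 * F₀ z :=
  eLpNorm_mono_enorm fun v => by
    simpa only [enorm_eq_self] using eLpNorm_mono fun x => abs_le_abs_weighted F₀ (x, v)

/-! ### Scattering -/

/-- A global solution with small dispersive data produces the data of the scattering argument. -/
lemma IsGlobalSolution.exists_scatteringData {α lam K η : ℝ} {f₀ : Phase → ℝ} {f : ℝ → Phase → ℝ}
    (hα : 0 < α) (hα' : α < 1) (hK : 0 < K) (hη : 0 < η)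
    (hκ : forceConst * (K * η) ≤ α / 4) (hκ' : forceConst * (K * η) ≤ 1 - α)
    (hdata : dataNorm (fun z => bracket z.1 * f₀ z) ≤ ENNReal.ofReal η)
    (h : IsGlobalSolution α lam f₀ f) (hd : DispersionBound α lam f (K * η)) :
    ∃ (E : ℝ → Space → Space) (F : ℝ → Phase → ℝ), TransportSolution E F ∧
      (∀ t, 0 ≤ t → F t =ᵐ[volume] f t) ∧ (∀ t, 0 ≤ t → E t = force α lam (f t)) ∧
      (∀ z, |F 0 z| ≤ η) ∧
      ScatteringData α lam (forceConst * (K * η)) η (dataConst + forceConst * K) E (F 0) := by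
  obtain ⟨E, hE, hEf⟩ := h.exists_forceField hd (by positivity) hα hα'
  obtain ⟨F, hF, hFf⟩ := h.exists_transportSolution hEf
  have hF0 : Continuous (F 0) := hF.cont.comp (Continuous.prodMk_right 0)
  have hF0f : F 0 =ᵐ[volume] f₀ := (hFf 0 le_rfl).trans h.initial
  obtain ⟨h1, hxv, hvx⟩ := eLpNorm_weighted_le_of_dataNorm_le hdata hF0f
  have h1' := ne_top_of_le_ne_top ENNReal.ofReal_ne_top ((eLpNorm_le_weighted (F 0)).trans h1)
  have hxv' := ne_top_of_le_ne_top ENNReal.ofReal_ne_top ((normXV_le_weighted (F 0)).trans hxv)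
  have hvx' := ne_top_of_le_ne_top ENNReal.ofReal_ne_top ((normVX_le_weighted (F 0)).trans hvx)
  have hforce : ∀ t, 0 ≤ t → force α lam (F t) = force α lam (f t) := fun t ht =>
    force_congr α lam (hFf t ht)
  have hrepr : ∀ t, 0 ≤ t → E t = force α lam (F t) := fun t ht =>
    hF.repr hE hα hα' (by linarith) h1' hxv' hvx' ht (by rw [hforce t ht]; exact hEf t ht)
  have hdc : 0 ≤ dataConst := by
    rw [dataConst]; linarith [(lipschitzExtensionConstant ℝ).coe_nonneg]
  have hfc := forceConst_pos
  refine ⟨E, F, hF, hFf, fun t ht => (hrepr t ht).trans (hforce t ht), fun z =>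
    (abs_le_abs_weighted (F 0) z).trans (abs_weighted_le_of_dataNorm_le hη hdata hF0 hF0f z), ?_⟩
  exact
    { field := hE
      alpha_pos := hα
      alpha_lt := hα'
      kappa_le := hκ
      kappa_le' := hκ'
      eta_pos := hη
      kappa_le_eta := by
        have := mul_nonneg hdc hη.le
        linarith
      cont := hF0
      norm_one := h1
      norm_xv := hxv
      lip := fun z z' => by
        have hb := one_le_bracket z.1
        refine (lipschitz_of_dataNorm_le hη hdata hF0 hF0f z z').trans ?_
        gcongr
        linarith [mul_pos hfc hK]
      repr := fun t ht x => by
        rw [hrepr t ht]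
        exact hF.force_eq hE hα hα' (by linarith) h1' hxv' hvx' ht x }

lemma ForceField.isCharFlow {α κ : ℝ} {E : ℝ → Space → Space} (hE : ForceField α κ E)
    (hα : 0 < α) {E' : ℝ → Space → Space} (h : ∀ t, 0 ≤ t → E t = E' t) :
    IsCharFlow E' (charX E) (charV E) where
  init_x := hE.charX_zero hα
  init_v := hE.charV_zero hα
  deriv_x z t _ := (hE.hasDerivAt_charX hα t z).hasDerivWithinAt
  deriv_v z t ht := by
    rw [← h t ht]
    exact (hE.hasDerivAt_charV hα t z).hasDerivWithinAt

/-- The original field `(v, E)` is Lipschitz though unbounded in `v`, and Lipschitz continuity is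
all that uniqueness requires. -/
lemma ForceField.isCharFlow_unique {α κ : ℝ} {E : ℝ → Space → Space} (hE : ForceField α κ E)
    (hα : 0 < α) {E' : ℝ → Space → Space} (h : ∀ t, 0 ≤ t → E t = E' t)
    {X V : ℝ → Phase → Space} (hXV : IsCharFlow E' X V) {t : ℝ} (ht : 0 ≤ t) :
    X t = charX E t ∧ V t = charV E t := by
  have key : ∀ z, (X t z, V t z) = charFlow E t z := by
    intro z
    have hd : ∀ s, 0 ≤ s → HasDerivWithinAt (fun s => (X s z, V s z))
        (charField E s (X s z, V s z)) (Ici 0) s := by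
      intro s hs
      have h2 := hXV.deriv_v z s hs
      rw [← h s hs] at h2
      exact (hXV.deriv_x z s hs).prodMk h2
    refine ODE_solution_unique_of_mem_Icc_right (v := charField E) (s := fun _ => univ)
      (K := (1 + κ).toNNReal) (a := 0) (b := t) (f := fun s => (X s z, V s z))
      (g := fun s => charFlow E s z) (fun s _ => ?_)
      (fun s hs => (hd s hs.1).continuousWithinAt.mono Icc_subset_Ici_self)
      (fun s hs => (hd s hs.1).mono (Ici_subset_Ici.2 hs.1)) (fun _ _ => trivial)
      (fun s _ => (hE.hasDerivAt_charFlow hα s z).continuousAt.continuousWithinAt)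
      (fun s _ => (hE.hasDerivAt_charFlow hα s z).hasDerivWithinAt) (fun _ _ => trivial)
      ?_ (right_mem_Icc.2 ht)
    · refine (LipschitzWith.of_dist_le_mul fun Z Z' => ?_).lipschitzOnWith
      rw [Real.coe_toNNReal _ (by linarith [hE.kappa_nonneg]), dist_eq_norm, dist_eq_norm]
      exact hE.charField_lip hα s Z Z'
    · simp only [hXV.init_x, hXV.init_v, hE.charFlow_zero hα]
  exact ⟨funext fun z => congrArg Prod.fst (key z), funext fun z => congrArg Prod.snd (key z)⟩

/-! ### The scattering limit and its integrability -/

namespace ScatteringData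

variable {α lam κ η B : ℝ} {E : ℝ → Space → Space} {F : ℝ → Phase → ℝ}

lemma continuous_corr {F₀ : Phase → ℝ} (h : ScatteringData α lam κ η B E F₀) :
    Continuous (corr α lam E F₀) := by
  have hη := h.eta_pos
  have hI := h.interactionConst_nonneg
  refine (LipschitzWith.of_dist_le_mul (K := (interactionConst α lam * η).toNNReal)
    fun a a' => ?_).continuous
  rw [Real.coe_toNNReal _ (by positivity), dist_eq_norm, dist_eq_norm]
  exact h.corr_lip a a'

lemma measurePreserving_refFlow {F₀ : Phase → ℝ} (h : ScatteringData α lam κ η B E F₀) (t : ℝ) :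
    MeasurePreserving (refFlow α (corr α lam E F₀) t) volume volume := by
  have := h.continuous_corr
  have hm := measurePreserving_shear_left
    (a := fun v => t • v - ((t ^ (1 - α) - 1) / (1 - α)) • corr α lam E F₀ v)
    (by fun_prop : Continuous _).measurable
  convert! hm using 2 with z
  simp only [refFlow, add_sub_assoc]

/-- Restoring free transport turns the twisted reference point into the reference flow; constancy
along characteristics then moves the evaluation to time `0`. -/
lemma apply_refFlow (h : ScatteringData α lam κ η B E (F 0)) (hF : TransportSolution E F) {t : ℝ}
    (ht : 0 ≤ t) (A : Space → Space) (z : Phase) :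
    F t (refFlow α A t z) = F 0 (evol (twisted E) t 0 (refTwisted α A t z)) := by
  have hα := h.alpha_pos
  rw [← hF.apply_charFlow h.field hα ht (evol (twisted E) t 0 (refTwisted α A t z))]
  congr 1
  have e : evol (twisted E) 0 t (evol (twisted E) t 0 (refTwisted α A t z)) =
      refTwisted α A t z := by
    rw [(h.field.bddLipField hα).evol_evol, (h.field.bddLipField hα).evol_self]
  rw [charFlow, charX, charV, e, refFlow, refTwisted]
  ext1
  · simp only; abel
  · rfl

/-- Modified scattering for the continuous representative. -/
theorem exists_scattering (h : ScatteringData α lam κ η B E (F 0)) (hF : TransportSolution E F)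
    (hα : 1 / 2 < α) (hB : 0 ≤ B) (hsup : ∀ z, |F 0 z| ≤ η) :
    ∃ fp : Phase → ℝ, MemLp fp 1 volume ∧ MemLp fp ⊤ volume ∧ ∀ t, 1 ≤ t → ∀ z,
      |F t (refFlow α (corr α lam E (F 0)) t z) - fp z| ≤
        B * stepConst α lam B * (2 ^ (2 * α) / (2 * α - 1)) * η ^ 2 / t ^ (2 * α - 1) := by
  set A := corr α lam E (F 0) with hA
  choose fp hlim hfp using h.exists_scattering_state hα hB
  have hFc : ∀ t, Continuous (F t) := fun t => hF.cont.comp (Continuous.prodMk_right t)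
  have hlim' : ∀ z, Tendsto (fun n : ℕ => F n (refFlow α A n z)) atTop (𝓝 (fp z)) := by
    intro z
    refine ((hlim z).comp tendsto_natCast_atTop_atTop).congr fun n => ?_
    exact (h.apply_refFlow hF n.cast_nonneg A z).symm
  have hmeas : ∀ n : ℕ, Measurable fun z => F n (refFlow α A n z) := fun n =>
    (hFc n).measurable.comp (h.measurePreserving_refFlow n).measurable
  have hfpm : Measurable fp :=
    measurable_of_tendsto_metrizable hmeas (tendsto_pi_nhds.2 hlim')
  refine ⟨fp, ⟨hfpm.aestronglyMeasurable, ?_⟩, ?_, fun t ht z => ?_⟩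
  -- The reference flow and the characteristic flow both preserve volume, so all these functions
  -- have the `L¹` norm of `F 0`, and Fatou's lemma passes it to the limit.
  · have hn : ∀ n : ℕ, eLpNorm (fun z => F n (refFlow α A n z)) 1 volume =
        eLpNorm (F 0) 1 volume := by
      intro n
      have h1 := eLpNorm_comp_measurePreserving (p := 1) (hFc n).aestronglyMeasurable
        (h.measurePreserving_refFlow n)
      have h2 := eLpNorm_comp_measurePreserving (p := 1) (hFc n).aestronglyMeasurable
        (h.field.measurePreserving_charFlow h.alpha_pos n.cast_nonneg)
      have e : F n ∘ charFlow E n = F 0 :=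
        funext fun z => hF.apply_charFlow h.field h.alpha_pos n.cast_nonneg z
      rw [e] at h2
      exact h1.trans h2.symm
    have hfat := Lp.eLpNorm_lim_le_liminf_eLpNorm (p := 1) (μ := (volume : Measure Phase))
      (fun n => (hmeas n).aestronglyMeasurable) fp (Eventually.of_forall hlim')
    simp only [hn, liminf_const] at hfat
    exact (hfat.trans ((eLpNorm_mono fun z => abs_le_abs_weighted _ z).trans h.norm_one)).trans_lt
      ENNReal.ofReal_lt_top
  · refine memLp_top_of_bound hfpm.aestronglyMeasurable η (Eventually.of_forall fun z => ?_)
    refine le_of_tendsto (hlim z).norm (Eventually.of_forall fun t => hsup _)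
  · rw [h.apply_refFlow hF (by linarith) A z]
    exact hfp z t ht

end ScatteringData

end VlasovRiesz

end

/-! ### The main theorem -/

open VlasovRiesz in
theorem theorem1p1 (α lam : ℝ) (hα : 1 / 2 < α) (hα' : α < 1) (hlam : lam ≠ 0)
    (K : ℝ) (hK : 0 < K) :
    ∃ η₀ : ℝ, 0 < η₀ ∧ ∃ C : ℝ, 0 < C ∧
      ∀ η : ℝ, 0 < η → η ≤ η₀ →
      ∀ f₀ : Phase → ℝ, 0 ≤ᵐ[volume] f₀ →
        dataNorm (fun z => bracket z.1 * f₀ z) ≤ ENNReal.ofReal η →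
      ∀ f : ℝ → Phase → ℝ, IsGlobalSolution α lam f₀ f →
        DispersionBound α lam f (K * η) →
      -- the characteristic flow exists and is unique
      ∃ X V : ℝ → Phase → Space,
        IsCharFlow (fun t => force α lam (f t)) X V ∧
        (∀ X' V' : ℝ → Phase → Space, IsCharFlow (fun t => force α lam (f t)) X' V' →
          ∀ t, 0 ≤ t → X' t = X t ∧ V' t = V t) ∧
      -- the momentum limit exists and the velocity correction is well defined
      ∃ Vp : Phase → Space,
        (∀ z, Tendsto (fun t => V t z) atTop (𝓝 (Vp z))) ∧
        (∀ v, Integrable (correctionIntegrand α lam f₀ Vp v)) ∧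
      -- modified scattering
      ∃ fp : Phase → ℝ, MemLp fp 1 volume ∧ MemLp fp ⊤ volume ∧
        ∀ t : ℝ, 1 ≤ t →
          eLpNorm (fun z => f t (refFlow α (correction α lam f₀ Vp) t z) - fp z) ⊤ volume
            ≤ ENNReal.ofReal (C * η ^ 2 / t ^ (2 * α - 1)) := by
  have hα0 : 0 < α := by linarith
  have hfc := forceConst_pos
  set B := dataConst + forceConst * K with hB
  have hB0 : 0 ≤ B := by
    have : 0 ≤ dataConst := by
      rw [dataConst]; linarith [(lipschitzExtensionConstant ℝ).coe_nonneg]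
    have := mul_pos hfc hK
    linarith
  set C₀ := B * ScatteringData.stepConst α lam B * (2 ^ (2 * α) / (2 * α - 1)) with hC₀
  -- This threshold makes the force constant `κ = forceConst * (K * η)` satisfy the two smallness
  -- conditions of backward stability; `κ ≤ α / 3` for the spreading estimate follows. Taking `|C₀|
  -- + 1` makes the constant visibly positive.
  refine ⟨min (α / 4) (1 - α) / (forceConst * K), ?_, |C₀| + 1, by positivity, ?_⟩
  · have : 0 < min (α / 4) (1 - α) := lt_min (by linarith) (by linarith)
    positivity
  intro η hη hη₀ f₀ _ hdata f hf hdisp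
  have hκ : forceConst * (K * η) ≤ min (α / 4) (1 - α) := by
    rw [le_div_iff₀ (by positivity)] at hη₀
    linarith
  obtain ⟨E, F, hF, hFf, hEf, hsup, hS⟩ := hf.exists_scatteringData hα0 hα' hK hη
    (hκ.trans (min_le_left _ _)) (hκ.trans (min_le_right _ _)) hdata hdisp
  have hF0f : F 0 =ᵐ[volume] f₀ := (hFf 0 le_rfl).trans hf.initial
  have hint : ∀ v, (fun z => F 0 z • kernel α lam (v - asymV E z)) =ᵐ[volume]
      correctionIntegrand α lam f₀ (asymV E) v := by
    intro v
    filter_upwards [hF0f] with z hz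
    rw [correctionIntegrand, gradient_potential, hz]
  have hcorr : correction α lam f₀ (asymV E) = corr α lam E (F 0) := by
    ext1 v
    rw [correction, corr, integral_congr_ae (hint v)]
  obtain ⟨fp, hfp1, hfpt, hfp⟩ := hS.exists_scattering hF hα hB0 hsup
  refine ⟨charX E, charV E, hS.field.isCharFlow hα0 hEf,
    fun X' V' h t ht => hS.field.isCharFlow_unique hα0 hEf h ht, asymV E,
    hS.field.tendsto_charV hα0, fun v => ?_, fp, hfp1, hfpt, fun t ht => ?_⟩
  · exact (hS.integrable (hS.field.measurable_asymV hα0)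
      (hS.field.antilipschitz_asymV hα0 hS.kappa_le_third) v).congr (hint v)
  · rw [hcorr, eLpNorm_exponent_top]
    refine eLpNormEssSup_le_of_ae_bound ?_
    have ht0 : 0 ≤ t := by linarith
    -- The reference flow pulls null sets back to null sets, so `f t` may be replaced by its
    -- continuous representative after composition.
    filter_upwards [(hS.measurePreserving_refFlow t).quasiMeasurePreserving.ae (hFf t ht0)] with z hz
    rw [← hz]
    refine (hfp t ht z).trans ?_
    gcongr
    linarith [le_abs_self C₀]
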